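/- Let $P$ be a subfactor planar algebra (complex, with all $P_n$ finite-dimensional and $P_{0_\pm}$ one-dimensional, with positive modulus $\delta$, spherical, each $P_n$ a C*-algebra whose involution is compatible with reflection of tangles, and with faithful positive normalised picture trace $\tau(x)=\delta^{-n}Z_{TR_n^0}(x)$ for $x \in P_n$). Let $k$ be a positive integer and suppose that $P$ is of finite depth at most $k$, i.e. $P_{d+1}=P_dE_{d+1}P_d$ (linear span) for some integer $1\le d\le k$, where $E_{d+1}$ is the non-normalised Jones projection. Then $P$ is generated by a single $2k$-box: there is $z\in P_{2k}$ such that the only planar subalgebra of $P$ (family of subspaces of the $P_n$ stable under the action of all planar tangles) that contains $z$ is $P$ itself. More precisely, there is $x\in P_k$ which generates the (finite-dimensional, unital) C*-algebra $P_k$ and satisfies $\tau(x)\neq 0$; and for every such $x$ the planar algebra $P$ is generated by the $2k$-box $z = x \sqcup x^*$, where $x\sqcup x^*$ is the result of inserting $x$ and $x^*$ in two disjoint $k$-boxes inside a $2k$-box, the first $2k$ marked points of the external box (counted clockwise from $*$) being joined in order to those of the box of $x$ and the last $2k$ in order to those of the box of $x^*$. -/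

import Mathlib

universe u

namespace Planar

/-- The colours `0₊ = nat 0`, `0₋ = zeroMinus`, and `n = nat n` for `n ≥ 1`. -/
inductive Colour where
  | nat (n : ℕ) : Colour
  | zeroMinus : Colour

namespace Colour

/-- A box of colour `c` has `2 * c.size` marked points. -/
def size : Colour → ℕ
  | nat n => n
  | zeroMinus => 0

/-- Is the region at the `*` of a box of this colour white?  (Only `0₋` is surrounded by black.) -/
def white : Colour → Bool
  | nat _ => true
  | zeroMinus => false

/-- The marked points of a box, numbered clockwise from the `*`. -/
abbrev Pt (c : Colour) : Type := Fin (2 * c.size)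

/-- The boundary intervals of a box, numbered clockwise: point `j` lies between the intervals `j`
and `j + 1`, and the first and the last interval are both the `*`-interval (for a box without
marked points the single interval is the whole boundary). -/
abbrev Gap (c : Colour) : Type := Fin (2 * c.size + 1)

/-- The shading at the `j`-th interval of a box of colour `c`: `true` is white. -/
def shadeAt (c : Colour) (j : ℕ) : Bool := xor c.white (decide (j % 2 = 1))

end Colour

/-- The boxes of a diagram with internal boxes `ι` are `none` (the external box) and `some i`. -/
abbrev boxColour {ι : Type} (c : ι → Colour) (c₀ : Colour) (b : Option ι) : Colour :=
  b.elim c₀ c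

/-- The incidence data of a shaded diagram with internal boxes `i : ι` of colours `c i` and external
box of colour `c₀`: its strings (arcs and closed loops), its shaded regions, the two regions along
each string (`side s true` is the white one), the string at each marked point and the region at each
boundary interval of a box. -/
structure PreTangle {ι : Type} (c : ι → Colour) (c₀ : Colour) where
  Str : Type
  Reg : Type
  shade : Reg → Bool
  side : Str → Bool → Reg
  str : (b : Option ι) → (boxColour c c₀ b).Pt → Str
  reg : (b : Option ι) → (boxColour c c₀ b).Gap → Reg
  shade_side : ∀ s w, shade (side s w) = w
  shade_reg : ∀ b j, shade (reg b j) = (boxColour c c₀ b).shadeAt j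
  reg_last : ∀ b, reg b (Fin.last _) = reg b 0
  side_before : ∀ b j, side (str b j) ((boxColour c c₀ b).shadeAt j) = reg b j.castSucc
  side_after : ∀ b j, side (str b j) (!(boxColour c c₀ b).shadeAt j) = reg b j.succ

/-- Orient each string so that white is on its left.  This says whether the string at the `j`-th
point of the box leaves that box there: it does at the points `0, 2, …` of an internal box and at the
points `1, 3, …` of the external one. -/
def leaves {ι : Type} : Option ι → ℕ → Bool
  | none, j => decide (j % 2 = 1)
  | some _, j => decide (j % 2 = 0)

namespace PreTangle

variable {ι : Type} {c : ι → Colour} {c₀ : Colour}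

/-- All marked points of all boxes. -/
abbrev End (_T : PreTangle c c₀) : Type := (b : Option ι) × (boxColour c c₀ b).Pt

/-- Two boxes joined by a string. -/
def Joined (T : PreTangle c c₀) (b b' : Option ι) : Prop := ∃ j j', T.str b j = T.str b' j'

/-- Two regions separated by a string. -/
def Adjacent (T : PreTangle c c₀) (r r' : T.Reg) : Prop :=
  ∃ s, T.side s true = r ∧ T.side s false = r'

/-- Incidence data come from a planar picture, i.e. they are those of a planar tangle.
* A string either meets no marked point (a loop) or has exactly one initial and one final point.
* One can pass from any region to any other by crossing strings.
* Euler's formula: `V - E + F = 1 + C` on the sphere, with the `|ι| + 1` boxes as vertices, the arcs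
  as edges, and the boxes' connected components and the loops counted in `C`.  The loops cancel
  when all strings are counted on the right-hand side below.

For connected data satisfying the first condition `V - E + F ≤ 1 + C` always holds, with equality
exactly if each component has genus zero and the components are nested as on a sphere.  The data
of a planar tangle determine it up to planar isotopy. -/
structure IsPlanar (T : PreTangle c c₀) : Prop where
  finite_box : Finite ι
  finite_str : Finite T.Str
  finite_reg : Finite T.Reg
  end_unique : ∀ e e' : T.End, T.str e.1 e.2 = T.str e'.1 e'.2 →
    leaves e.1 e.2 = leaves e'.1 e'.2 → e = e'
  end_partner : ∀ e : T.End, ∃ e' : T.End, T.str e'.1 e'.2 = T.str e.1 e.2 ∧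
    leaves e'.1 e'.2 ≠ leaves e.1 e.2
  connected : ∀ r r', Relation.EqvGen T.Adjacent r r'
  euler : Nat.card ι + Nat.card T.Reg = Nat.card T.Str + Nat.card (Quot T.Joined)

/-- Isomorphism of diagrams: a relabelling of strings and regions. -/
structure Iso (T U : PreTangle c c₀) where
  strEquiv : T.Str ≃ U.Str
  regEquiv : T.Reg ≃ U.Reg
  map_shade : ∀ r, U.shade (regEquiv r) = T.shade r
  map_side : ∀ s w, U.side (strEquiv s) w = regEquiv (T.side s w)
  map_str : ∀ b j, U.str b j = strEquiv (T.str b j)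
  map_reg : ∀ b j, U.reg b j = regEquiv (T.reg b j)

/-- Isomorphism of diagrams on the sphere: nothing is required at the external box. -/
structure SphereIso {c₁ : Colour} (T : PreTangle c c₀) (U : PreTangle c c₁) where
  strEquiv : T.Str ≃ U.Str
  regEquiv : T.Reg ≃ U.Reg
  map_shade : ∀ r, U.shade (regEquiv r) = T.shade r
  map_side : ∀ s w, U.side (strEquiv s) w = regEquiv (T.side s w)
  map_str : ∀ (i : ι) j, U.str (some i) j = strEquiv (T.str (some i) j)
  map_reg : ∀ (i : ι) j, U.reg (some i) j = regEquiv (T.reg (some i) j)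

/-- Renumbering of the internal boxes. -/
def reindex {κ : Type} (T : PreTangle c c₀) (e : κ → ι) : PreTangle (c ∘ e) c₀ where
  Str := T.Str
  Reg := T.Reg
  shade := T.shade
  side := T.side
  str
    | none => T.str none
    | some i => T.str (some (e i))
  reg
    | none => T.reg none
    | some i => T.reg (some (e i))
  shade_side := T.shade_side
  shade_reg
    | none => T.shade_reg none
    | some i => T.shade_reg (some (e i))
  reg_last
    | none => T.reg_last none
    | some i => T.reg_last (some (e i))
  side_before
    | none => T.side_before none
    | some i => T.side_before (some (e i))
  side_after
    | none => T.side_after none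
    | some i => T.side_after (some (e i))

section comp

variable {κ : ι → Type} {d : (i : ι) → κ i → Colour}

/-- The gluing of strings when `S i` is substituted into the `i`-th box of `T`. -/
inductive StrGlue (T : PreTangle c c₀) (S : (i : ι) → PreTangle (d i) (c i)) :
    T.Str ⊕ ((i : ι) × (S i).Str) → T.Str ⊕ ((i : ι) × (S i).Str) → Prop
  | mk (i : ι) (j : (c i).Pt) :
      StrGlue T S (Sum.inl (T.str (some i) j)) (Sum.inr ⟨i, (S i).str none j⟩)

/-- The gluing of regions when `S i` is substituted into the `i`-th box of `T`. -/
inductive RegGlue (T : PreTangle c c₀) (S : (i : ι) → PreTangle (d i) (c i)) :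
    T.Reg ⊕ ((i : ι) × (S i).Reg) → T.Reg ⊕ ((i : ι) × (S i).Reg) → Prop
  | mk (i : ι) (j : (c i).Gap) :
      RegGlue T S (Sum.inl (T.reg (some i) j)) (Sum.inr ⟨i, (S i).reg none j⟩)

/-- The string of the composite diagram that contains a given string of `T`. -/
def outerStr (T : PreTangle c c₀) (S : (i : ι) → PreTangle (d i) (c i)) (s : T.Str) :
    Quot (StrGlue T S) := Quot.mk _ (Sum.inl s)

/-- The string of the composite diagram that contains a given string of `S i`. -/
def innerStr (T : PreTangle c c₀) (S : (i : ι) → PreTangle (d i) (c i)) (i : ι) (s : (S i).Str) :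
    Quot (StrGlue T S) := Quot.mk _ (Sum.inr ⟨i, s⟩)

/-- The region of the composite diagram that contains a given region of `T`. -/
def outerReg (T : PreTangle c c₀) (S : (i : ι) → PreTangle (d i) (c i)) (r : T.Reg) :
    Quot (RegGlue T S) := Quot.mk _ (Sum.inl r)

/-- The region of the composite diagram that contains a given region of `S i`. -/
def innerReg (T : PreTangle c c₀) (S : (i : ι) → PreTangle (d i) (c i)) (i : ι) (r : (S i).Reg) :
    Quot (RegGlue T S) := Quot.mk _ (Sum.inr ⟨i, r⟩)

/-- Substitution of the diagrams `S i` into the boxes of `T`. -/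
def comp (T : PreTangle c c₀) (S : (i : ι) → PreTangle (d i) (c i)) :
    PreTangle (fun p : (i : ι) × κ i => d p.1 p.2) c₀ where
  Str := Quot (StrGlue T S)
  Reg := Quot (RegGlue T S)
  shade := Quot.lift (Sum.elim T.shade (fun p => (S p.1).shade p.2)) (by
    rintro _ _ ⟨i, j⟩
    exact (T.shade_reg (some i) j).trans ((S i).shade_reg none j).symm)
  side s w := Quot.lift
    (Sum.elim (fun s => outerReg T S (T.side s w))
      (fun p => innerReg T S p.1 ((S p.1).side p.2 w))) (by
    rintro _ _ ⟨i, j⟩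
    have h1 := T.side_before (some i) j
    have h2 := (S i).side_before none j
    have h3 := T.side_after (some i) j
    have h4 := (S i).side_after none j
    simp only [Sum.elim_inl, Sum.elim_inr]
    by_cases hw : w = (c i).shadeAt j
    · subst hw
      exact (congrArg (outerReg T S) h1).trans
        ((Quot.sound (RegGlue.mk i j.castSucc)).trans (congrArg (innerReg T S i) h2.symm))
    · have hw' : w = !(c i).shadeAt j := by
        cases w <;> cases h : (c i).shadeAt j <;> simp_all
      subst hw'
      exact (congrArg (outerReg T S) h3).trans
        ((Quot.sound (RegGlue.mk i j.succ)).trans (congrArg (innerReg T S i) h4.symm))) s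
  str
    | none => fun j => outerStr T S (T.str none j)
    | some p => fun j => innerStr T S p.1 ((S p.1).str (some p.2) j)
  reg
    | none => fun j => outerReg T S (T.reg none j)
    | some p => fun j => innerReg T S p.1 ((S p.1).reg (some p.2) j)
  shade_side := by
    rintro ⟨s | p⟩ w
    · exact T.shade_side s w
    · exact (S p.1).shade_side p.2 w
  shade_reg
    | none => fun j => T.shade_reg none j
    | some p => fun j => (S p.1).shade_reg (some p.2) j
  reg_last
    | none => congrArg (outerReg T S) (T.reg_last none)
    | some p => congrArg (innerReg T S p.1) ((S p.1).reg_last (some p.2))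
  side_before
    | none => fun j => congrArg (outerReg T S) (T.side_before none j)
    | some p => fun j => congrArg (innerReg T S p.1) ((S p.1).side_before (some p.2) j)
  side_after
    | none => fun j => congrArg (outerReg T S) (T.side_after none j)
    | some p => fun j => congrArg (innerReg T S p.1) ((S p.1).side_after (some p.2) j)

end comp

/-- Draw a new small closed loop inside the region `r`. -/
def addLoop (T : PreTangle c c₀) (r : T.Reg) : PreTangle c c₀ where
  Str := Option T.Str
  Reg := Option T.Reg
  shade q := q.elim (!T.shade r) T.shade
  side s w := s.elim (if w = T.shade r then some r else none) (fun s => some (T.side s w))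
  str b j := some (T.str b j)
  reg b j := some (T.reg b j)
  shade_side := by
    rintro (_ | s) w
    · by_cases h : w = T.shade r
      · simp [h]
      · simp only [Option.elim_none, h, if_false]
        cases w <;> cases h' : T.shade r <;> simp_all
    · exact T.shade_side s w
  shade_reg := T.shade_reg
  reg_last b := congrArg some (T.reg_last b)
  side_before b j := congrArg some (T.side_before b j)
  side_after b j := congrArg some (T.side_after b j)

theorem shadeAt_rev (e : Colour) (j : e.Gap) : e.shadeAt (Fin.rev j) = e.shadeAt j := by
  have := j.2
  have h : (2 * e.size + 1 - ((j : ℕ) + 1)) % 2 = (j : ℕ) % 2 := by omega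
  simp only [Colour.shadeAt, Fin.val_rev, h]

theorem shadeAt_rev_pt (e : Colour) (j : e.Pt) :
    e.shadeAt (Fin.rev j : Fin _) = !e.shadeAt j := by
  have := j.2
  rcases Nat.mod_two_eq_zero_or_one (j : ℕ) with h | h
  · have h' : (2 * e.size - ((j : ℕ) + 1)) % 2 = 1 := by omega
    simp [Colour.shadeAt, Fin.val_rev, h, h']
  · have h' : (2 * e.size - ((j : ℕ) + 1)) % 2 = 0 := by omega
    simp [Colour.shadeAt, Fin.val_rev, h, h']

/-- The reflection of a diagram, with every `*` staying in its region: on each box the clockwise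
numbering of points and intervals is reversed. -/
def adj (T : PreTangle c c₀) : PreTangle c c₀ where
  Str := T.Str
  Reg := T.Reg
  shade := T.shade
  side := T.side
  str b j := T.str b (Fin.rev j)
  reg b j := T.reg b (Fin.rev j)
  shade_side := T.shade_side
  shade_reg b j := (T.shade_reg b (Fin.rev j)).trans (shadeAt_rev _ j)
  reg_last b := by
    rw [Fin.rev_last, Fin.rev_zero, T.reg_last]
  side_before b j := by
    have h := T.side_after b (Fin.rev j)
    rw [shadeAt_rev_pt, Bool.not_not] at h
    rw [h, Fin.rev_castSucc]
  side_after b j := by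
    have h := T.side_before b (Fin.rev j)
    rw [shadeAt_rev_pt] at h
    rw [h, Fin.rev_succ]

section stack

variable (m : ℕ) (c : Colour)

/-- The region to the left of the `j`-th strand at level `l` of `m` stacked boxes (`j = 0` and
`j = n` are the regions to the left and to the right of the whole column). -/
def cell (m n : ℕ) (l : Fin (m + 1)) (j : Fin (n + 1)) : Fin (n + 1) ⊕ (Fin m × Fin (n - 1)) :=
  if h : (l : ℕ) = 0 ∨ (j : ℕ) = 0 ∨ (j : ℕ) = n then Sum.inl j
  else Sum.inr (⟨l - 1, by omega⟩, ⟨j - 1, by omega⟩)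

/-- The strand at the `j`-th point of a box with `n` strands leaving upwards at level `t` and `n`
strands leaving downwards at level `l`. -/
def stackStr (t l : Fin (m + 1)) (j : c.Pt) : Fin (m + 1) × Fin c.size :=
  if h : (j : ℕ) < c.size then (t, ⟨j, h⟩) else (l, ⟨2 * c.size - 1 - j, by omega⟩)

/-- The region at the `j`-th interval of a box with `n` strands leaving upwards at level `t` and `n`
strands leaving downwards at level `l`. -/
def stackReg (t l : Fin (m + 1)) (j : c.Gap) : Fin (c.size + 1) ⊕ (Fin m × Fin (c.size - 1)) :=
  if h : (j : ℕ) ≤ c.size then cell m c.size t ⟨j, by omega⟩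
  else cell m c.size l ⟨2 * c.size - j, by omega⟩

/-- The regions to the left and to the right of a strand in a stack. -/
def stackSide (s : Fin (m + 1) × Fin c.size) (w : Bool) :
    Fin (c.size + 1) ⊕ (Fin m × Fin (c.size - 1)) :=
  cell m c.size s.1 (if w = c.shadeAt s.2 then s.2.castSucc else s.2.succ)

theorem shadeAt_succ (c : Colour) (j : ℕ) : c.shadeAt (j + 1) = !c.shadeAt j := by
  rcases Nat.mod_two_eq_zero_or_one j with h | h
  · have h' : (j + 1) % 2 = 1 := by omega
    simp [Colour.shadeAt, h, h']
  · have h' : (j + 1) % 2 = 0 := by omega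
    simp [Colour.shadeAt, h, h']

theorem shadeAt_opp (c : Colour) {i j : ℕ} (h : i % 2 ≠ j % 2) : c.shadeAt i = !c.shadeAt j := by
  rcases Nat.mod_two_eq_zero_or_one i with h1 | h1 <;>
    rcases Nat.mod_two_eq_zero_or_one j with h2 | h2 <;> simp_all [Colour.shadeAt]

theorem shadeAt_congr (c : Colour) {i j : ℕ} (h : i % 2 = j % 2) : c.shadeAt i = c.shadeAt j := by
  simp [Colour.shadeAt, h]

/-- The shading of the regions of a stack. -/
def stackShade : Fin (c.size + 1) ⊕ (Fin m × Fin (c.size - 1)) → Bool :=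
  Sum.elim (fun j => c.shadeAt j) (fun q => c.shadeAt (q.2 + 1))

theorem stackShade_cell (l : Fin (m + 1)) (j : Fin (c.size + 1)) :
    stackShade m c (cell m c.size l j) = c.shadeAt j := by
  unfold cell
  split_ifs with h
  · rfl
  · simp only [stackShade, Sum.elim_inr]
    congr 1
    omega

theorem stack_shade_side (s : Fin (m + 1) × Fin c.size) (w : Bool) :
    stackShade m c (stackSide m c s w) = w := by
  rw [stackSide, stackShade_cell]
  split_ifs with h
  · exact h.symm
  · rw [Fin.val_succ, shadeAt_succ]
    cases w <;> cases h' : c.shadeAt s.2 <;> simp_all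

theorem stack_shade_reg (t l : Fin (m + 1)) (j : c.Gap) :
    stackShade m c (stackReg m c t l j) = c.shadeAt j := by
  have := j.2
  unfold stackReg
  split_ifs with h
  · rw [stackShade_cell]
  · rw [stackShade_cell]
    exact shadeAt_congr c (by simp only; omega)

theorem stack_reg_last (t l : Fin (m + 1)) :
    stackReg m c t l (Fin.last _) = stackReg m c t l 0 := by
  by_cases h : c.size = 0
  · congr 1
    ext
    simp [h]
  · simp [stackReg, cell, h]
    omega

theorem stack_side_before (t l : Fin (m + 1)) (j : c.Pt) :
    stackSide m c (stackStr m c t l j) (c.shadeAt j) = stackReg m c t l j.castSucc := by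
  have := j.2
  unfold stackStr stackReg stackSide
  by_cases h : (j : ℕ) < c.size
  · simp [h, h.le]
  · have e : c.shadeAt j ≠ c.shadeAt (2 * c.size - 1 - j) := by
      rw [shadeAt_opp c (i := j) (by omega : _ ≠ (2 * c.size - 1 - j) % 2)]
      simp
    by_cases h' : (j : ℕ) = c.size
    · have : 2 * c.size - 1 - c.size + 1 = c.size := by omega
      simp only [h, dite_false, e, if_false]
      simp [cell, h', this]
    · have h2 : ¬ (j : ℕ) ≤ c.size := by omega
      simp only [h, dite_false, e, if_false, Fin.val_castSucc, h2]
      congr 1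
      ext
      simp
      omega

theorem stack_side_after (t l : Fin (m + 1)) (j : c.Pt) :
    stackSide m c (stackStr m c t l j) (!c.shadeAt j) = stackReg m c t l j.succ := by
  have := j.2
  unfold stackStr stackReg stackSide
  by_cases h : (j : ℕ) < c.size
  · have h' : (j : ℕ) + 1 ≤ c.size := h
    simp [h, h']
  · have e : (!c.shadeAt j) = c.shadeAt (2 * c.size - 1 - j) := by
      rw [shadeAt_opp c (i := j) (by omega : _ ≠ (2 * c.size - 1 - j) % 2), Bool.not_not]
    have h2 : ¬ (j : ℕ) + 1 ≤ c.size := by omega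
    simp only [h, dite_false, e, if_true, Fin.val_succ, h2]
    congr 1
    ext
    simp
    omega

/-- `m` boxes of colour `c` stacked vertically, the first on top, with `n` vertical strands between
any two neighbours (the external box counts as a neighbour): the multiplicative identity for `m = 0`,
the identity tangle for `m = 1`, and multiplication for `m = 2`. -/
def stack : PreTangle (fun _ : Fin m => c) c where
  Str := Fin (m + 1) × Fin c.size
  Reg := Fin (c.size + 1) ⊕ (Fin m × Fin (c.size - 1))
  shade := stackShade m c
  side := stackSide m c
  str
    | none => stackStr m c 0 (Fin.last m)
    | some i => stackStr m c i.castSucc i.succ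
  reg
    | none => stackReg m c 0 (Fin.last m)
    | some i => stackReg m c i.castSucc i.succ
  shade_side := stack_shade_side m c
  shade_reg
    | none => stack_shade_reg m c _ _
    | some _ => stack_shade_reg m c _ _
  reg_last
    | none => stack_reg_last m c _ _
    | some _ => stack_reg_last m c _ _
  side_before
    | none => stack_side_before m c _ _
    | some _ => stack_side_before m c _ _
  side_after
    | none => stack_side_after m c _ _
    | some _ => stack_side_after m c _ _

end stack

section addCap

variable {ι : Type} {c : ι → Colour} {n : ℕ}

/-- The string at the `j`-th external point after a cap has been inserted at position `p`. -/
def capStr (T : PreTangle c (.nat n)) (p : ℕ) (hp : p ≤ 2 * n) (j : (Colour.nat (n + 1)).Pt) :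
    Option T.Str :=
  if h : (j : ℕ) < p then some (T.str none (⟨j, lt_of_lt_of_le h hp⟩ : Fin (2 * n)))
  else if h' : (j : ℕ) < p + 2 then none
  else some (T.str none (⟨j - 2, by have : (j : ℕ) < 2 * (n + 1) := j.2; omega⟩ : Fin (2 * n)))

/-- The region at the `j`-th external interval after a cap has been inserted at position `p`. -/
def capReg (T : PreTangle c (.nat n)) (p : ℕ) (hp : p ≤ 2 * n) (j : (Colour.nat (n + 1)).Gap) :
    Option T.Reg :=
  if h : (j : ℕ) ≤ p then
    some (T.reg none (⟨j, Nat.lt_succ_of_le (le_trans h hp)⟩ : Fin (2 * n + 1)))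
  else if h' : (j : ℕ) = p + 1 then none
  else some (T.reg none
    (⟨j - 2, by have : (j : ℕ) < 2 * (n + 1) + 1 := j.2; omega⟩ : Fin (2 * n + 1)))

/-- The regions along a string after a cap has been inserted at position `p`. -/
def capSide (T : PreTangle c (.nat n)) (p : ℕ) (hp : p ≤ 2 * n) (s : Option T.Str) (w : Bool) :
    Option T.Reg :=
  s.elim
    (if w = (Colour.nat n).shadeAt p then
      some (T.reg none (⟨p, Nat.lt_succ_of_le hp⟩ : Fin (2 * n + 1))) else none)
    (fun s => some (T.side s w))

/-- Insert two new neighbouring points `p`, `p + 1` on the external box and join them by a string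
close to its boundary. -/
def addCap (T : PreTangle c (.nat n)) (p : ℕ) (hp : p ≤ 2 * n) : PreTangle c (.nat (n + 1)) where
  Str := Option T.Str
  Reg := Option T.Reg
  shade q := q.elim (!(Colour.nat n).shadeAt p) T.shade
  side := capSide T p hp
  str
    | none => capStr T p hp
    | some i => fun j => some (T.str (some i) j)
  reg
    | none => capReg T p hp
    | some i => fun j => some (T.reg (some i) j)
  shade_side := by
    rintro (_ | s) w
    · by_cases h : w = (Colour.nat n).shadeAt p
      · simp only [capSide, Option.elim_none, h, if_true, Option.elim_some]
        exact T.shade_reg none (⟨p, Nat.lt_succ_of_le hp⟩ : Fin (2 * n + 1))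
      · simp only [capSide, Option.elim_none, h, if_false]
        cases w <;> cases h' : (Colour.nat n).shadeAt p <;> simp_all
    · exact T.shade_side s w
  shade_reg
    | some i => T.shade_reg (some i)
    | none => by
      intro j
      have hj : (j : ℕ) < 2 * (n + 1) + 1 := j.2
      show (capReg T p hp j).elim _ _ = (Colour.nat n).shadeAt j
      unfold capReg
      split_ifs with h h'
      · exact T.shade_reg none (⟨j, by omega⟩ : Fin (2 * n + 1))
      · rw [h', shadeAt_succ]; rfl
      · exact (T.shade_reg none (⟨j - 2, by omega⟩ : Fin (2 * n + 1))).trans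
          (shadeAt_congr _ (by show (j - 2 : ℕ) % 2 = _; omega))
  reg_last
    | some i => congrArg some (T.reg_last (some i))
    | none => by
      have h1 : ¬ 2 * (n + 1) ≤ p := by omega
      have h2 : ¬ 2 * (n + 1) = p + 1 := by omega
      show capReg T p hp (⟨2 * (n + 1), by omega⟩ : Fin (2 * (n + 1) + 1)) =
        capReg T p hp (⟨0, by omega⟩ : Fin (2 * (n + 1) + 1))
      simp only [capReg, h1, h2, dite_false, zero_le, dite_true]
      exact congrArg some (T.reg_last none)
  side_before
    | some i => fun j => congrArg some (T.side_before (some i) j)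
    | none => by
      intro j
      have hj : (j : ℕ) < 2 * (n + 1) := j.2
      show capSide T p hp (capStr T p hp j) ((Colour.nat n).shadeAt j) =
        capReg T p hp (⟨j, by omega⟩ : Fin (2 * (n + 1) + 1))
      by_cases h1 : (j : ℕ) < p
      · simp only [capStr, capReg, h1, h1.le, dite_true]
        exact congrArg some (T.side_before none (⟨j, by omega⟩ : Fin (2 * n)))
      by_cases h2 : (j : ℕ) = p
      · simp [capSide, capStr, capReg, h2]
      by_cases h3 : (j : ℕ) = p + 1
      · simp only [capStr, capReg, h3]
        simp [capSide, shadeAt_succ]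
      · have h4 : ¬ (j : ℕ) < p + 2 := by omega
        have h5 : ¬ (j : ℕ) ≤ p := by omega
        simp only [capStr, capReg, h1, h3, h4, h5, dite_false]
        have e := T.side_before none (⟨j - 2, by omega⟩ : Fin (2 * n))
        rw [shadeAt_congr _ (show (j - 2 : ℕ) % 2 = (j : ℕ) % 2 by omega)] at e
        exact congrArg some e
  side_after
    | some i => fun j => congrArg some (T.side_after (some i) j)
    | none => by
      intro j
      have hj : (j : ℕ) < 2 * (n + 1) := j.2
      show capSide T p hp (capStr T p hp j) (!(Colour.nat n).shadeAt j) =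
        capReg T p hp (⟨j + 1, by omega⟩ : Fin (2 * (n + 1) + 1))
      by_cases h1 : (j : ℕ) < p
      · have h2 : (j : ℕ) + 1 ≤ p := h1
        simp only [capStr, capReg, h1, h2, dite_true]
        exact congrArg some (T.side_after none (⟨j, by omega⟩ : Fin (2 * n)))
      by_cases h2 : (j : ℕ) = p
      · simp only [capStr, capReg, h2]
        simp [capSide]
      by_cases h3 : (j : ℕ) = p + 1
      · simp only [capStr, capReg, h3]
        simp [capSide, shadeAt_succ]
      · have h4 : ¬ (j : ℕ) < p + 2 := by omega
        have h5 : ¬ (j : ℕ) + 1 ≤ p := by omega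
        have h6 : ¬ (j : ℕ) + 1 = p + 1 := by omega
        simp only [capStr, capReg, h1, h4, h5, h6, dite_false]
        have e := T.side_after none (⟨j - 2, by omega⟩ : Fin (2 * n))
        rw [shadeAt_congr _ (show (j - 2 : ℕ) % 2 = (j : ℕ) % 2 by omega)] at e
        refine (congrArg some e).trans ?_
        congr 2
        ext
        show (j - 2 : ℕ) + 1 = j + 1 - 2
        omega

end addCap

section close

variable (n : ℕ)

/-- The strand of the trace tangle at the `j`-th point of the internal box. -/
def closeStr (j : Fin (2 * n)) : Fin n := ⟨min j (2 * n - 1 - j), by omega⟩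

/-- The region of the trace tangle at the `j`-th interval of the internal box. -/
def closeReg (j : Fin (2 * n + 1)) : Fin (n + 1) := ⟨min j (2 * n - j), by omega⟩

/-- The regions along a strand of the trace tangle. -/
def closeSide (s : Fin n) (w : Bool) : Fin (n + 1) :=
  if w = (Colour.nat n).shadeAt s then s.castSucc else s.succ

theorem close_side_before (j : Fin (2 * n)) :
    closeSide n (closeStr n j) ((Colour.nat n).shadeAt j) = closeReg n j.castSucc := by
  have := j.2
  unfold closeSide closeStr closeReg
  by_cases h : (j : ℕ) < n
  · have h1 : min (j : ℕ) (2 * n - 1 - j) = j := by omega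
    simp only [h1, if_true]
    ext
    simp
    omega
  · have h1 : min (j : ℕ) (2 * n - 1 - j) = 2 * n - 1 - j := by omega
    have e : (Colour.nat n).shadeAt j ≠ (Colour.nat n).shadeAt (2 * n - 1 - j) := by
      rw [shadeAt_opp _ (i := j) (by omega : _ ≠ (2 * n - 1 - j) % 2)]
      simp
    simp only [h1, e, if_false]
    ext
    simp
    omega

theorem close_side_after (j : Fin (2 * n)) :
    closeSide n (closeStr n j) (!(Colour.nat n).shadeAt j) = closeReg n j.succ := by
  have := j.2
  unfold closeSide closeStr closeReg
  by_cases h : (j : ℕ) < n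
  · have h1 : min (j : ℕ) (2 * n - 1 - j) = j := by omega
    simp only [h1, Bool.not_eq_eq_eq_not, Bool.eq_not_self, if_false]
    ext
    simp
    omega
  · have h1 : min (j : ℕ) (2 * n - 1 - j) = 2 * n - 1 - j := by omega
    have e : (!(Colour.nat n).shadeAt j) = (Colour.nat n).shadeAt (2 * n - 1 - j) := by
      rw [shadeAt_opp _ (i := j) (by omega : _ ≠ (2 * n - 1 - j) % 2), Bool.not_not]
    simp only [h1, e, if_true]
    ext
    simp
    omega

/-- The trace tangle: the `j`-th strand at the top of an `n`-box is joined, around the right of the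
box, to the `j`-th strand at the bottom. -/
def close : PreTangle (fun _ : Fin 1 => Colour.nat n) (.nat 0) where
  Str := Fin n
  Reg := Fin (n + 1)
  shade j := (Colour.nat n).shadeAt j
  side := closeSide n
  str
    | none => fun j => absurd j.2 (by simp [Colour.size])
    | some _ => closeStr n
  reg
    | none => fun _ => 0
    | some _ => closeReg n
  shade_side s w := by
    unfold closeSide
    split_ifs with h
    · exact h.symm
    · rw [Fin.val_succ, shadeAt_succ]
      cases w <;> cases h' : (Colour.nat n).shadeAt s <;> simp_all
  shade_reg
    | none => fun j => by
      have hj : (j : ℕ) < 2 * 0 + 1 := j.2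
      exact shadeAt_congr _ (by simp; omega)
    | some _ => fun j => by
      have hj : (j : ℕ) < 2 * n + 1 := j.2
      exact shadeAt_congr _ (by simp only [closeReg]; omega)
  reg_last
    | none => rfl
    | some _ => by
      show closeReg n (Fin.last _) = closeReg n 0
      ext
      simp [closeReg]
  side_before
    | none => fun j => absurd j.2 (by simp [Colour.size])
    | some _ => close_side_before n
  side_after
    | none => fun j => absurd j.2 (by simp [Colour.size])
    | some _ => close_side_after n

end close

section juxt

variable (n : ℕ)

/-- The region at the `j`-th interval of the `i`-th of two juxtaposed boxes; `none` is the common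
`*`-region. -/
def juxtReg (i : Fin 2) (j : Fin (2 * n + 1)) : Option (Fin 2 × Fin (2 * n - 1)) :=
  if h : (j : ℕ) = 0 ∨ (j : ℕ) = 2 * n then none else some (i, ⟨j - 1, by omega⟩)

/-- The shading of the regions around two juxtaposed boxes. -/
def juxtShade : Option (Fin 2 × Fin (2 * n - 1)) → Bool :=
  fun q => q.elim true (fun q => (Colour.nat n).shadeAt (q.2 + 1))

/-- The regions along the strand at a point of the first or second of two juxtaposed boxes. -/
def juxtSide (s : Fin 2 × Fin (2 * n)) (w : Bool) : Option (Fin 2 × Fin (2 * n - 1)) :=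
  juxtReg n s.1 (if w = (Colour.nat n).shadeAt s.2 then s.2.castSucc else s.2.succ)

theorem juxt_shade (i : Fin 2) (j : Fin (2 * n + 1)) :
    juxtShade n (juxtReg n i j) = (Colour.nat n).shadeAt j := by
  unfold juxtReg
  split_ifs with h
  · have h' : (j : ℕ) % 2 = 0 := by omega
    simp [juxtShade, Colour.shadeAt, Colour.white, h']
  · simp only [juxtShade, Option.elim_some]
    congr 1
    omega

/-- The strand at the `j`-th point of the external box of the juxtaposition. -/
def juxtOutStr (j : Fin (2 * (2 * n))) : Fin 2 × Fin (2 * n) :=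
  if h : (j : ℕ) < 2 * n then (0, ⟨j, h⟩) else (1, ⟨j - 2 * n, by omega⟩)

/-- The region at the `j`-th interval of the external box of the juxtaposition. -/
def juxtOutReg (j : Fin (2 * (2 * n) + 1)) : Option (Fin 2 × Fin (2 * n - 1)) :=
  if h : (j : ℕ) ≤ 2 * n then juxtReg n 0 ⟨j, by omega⟩ else juxtReg n 1 ⟨j - 2 * n, by omega⟩

theorem juxt_side_before (j : Fin (2 * (2 * n))) :
    juxtSide n (juxtOutStr n j) ((Colour.nat n).shadeAt j) = juxtOutReg n j.castSucc := by
  have hj := j.2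
  unfold juxtOutStr juxtOutReg
  by_cases h : (j : ℕ) < 2 * n
  · simp [juxtSide, h, h.le]
  · have e : (Colour.nat n).shadeAt j = (Colour.nat n).shadeAt (j - 2 * n) :=
      shadeAt_congr _ (by omega)
    by_cases h' : (j : ℕ) = 2 * n
    · have e' : (Colour.nat n).shadeAt (2 * n) = (Colour.nat n).shadeAt 0 :=
        shadeAt_congr _ (by omega)
      simp [juxtSide, juxtReg, h', e']
    · have h2 : ¬ (j : ℕ) ≤ 2 * n := by omega
      simp [juxtSide, h, h2, e]

theorem juxt_side_after (j : Fin (2 * (2 * n))) :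
    juxtSide n (juxtOutStr n j) (!(Colour.nat n).shadeAt j) = juxtOutReg n j.succ := by
  have hj := j.2
  unfold juxtOutStr juxtOutReg
  by_cases h : (j : ℕ) < 2 * n
  · have h' : (j : ℕ) + 1 ≤ 2 * n := h
    simp [juxtSide, h, h']
  · have e : (Colour.nat n).shadeAt j = (Colour.nat n).shadeAt (j - 2 * n) :=
      shadeAt_congr _ (by omega)
    have h2 : ¬ (j : ℕ) + 1 ≤ 2 * n := by omega
    have h3 : (j : ℕ) + 1 - 2 * n = j - 2 * n + 1 := by omega
    simp [juxtSide, h, h2, h3, e]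

/-- The two `n`-boxes side by side in a `2n`-box: the points `0, …, 2n - 1` of the first box are
joined, in this order, to the points `0, …, 2n - 1` of the external box, and those of the second box to
the points `2n, …, 4n - 1`. -/
def juxt : PreTangle (fun _ : Fin 2 => Colour.nat n) (.nat (2 * n)) where
  Str := Fin 2 × Fin (2 * n)
  Reg := Option (Fin 2 × Fin (2 * n - 1))
  shade := juxtShade n
  side := juxtSide n
  str
    | none => juxtOutStr n
    | some i => fun j => (i, j)
  reg
    | none => juxtOutReg n
    | some i => juxtReg n i
  shade_side s w := by
    unfold juxtSide
    rw [juxt_shade]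
    split_ifs with h
    · exact h.symm
    · rw [Fin.val_succ, shadeAt_succ]
      cases w <;> cases h' : (Colour.nat n).shadeAt s.2 <;> simp_all
  shade_reg
    | none => fun j => by
      show juxtShade n (juxtOutReg n j) = (Colour.nat n).shadeAt j
      unfold juxtOutReg
      split_ifs with h
      · rw [juxt_shade]
      · rw [juxt_shade]
        exact shadeAt_congr _ (by simp only; omega)
    | some i => juxt_shade n i
  reg_last
    | none => by
      show juxtOutReg n (Fin.last _) = juxtOutReg n 0
      by_cases h : n = 0
      · subst h
        rfl
      · have h1 : ¬ 2 * (2 * n) ≤ 2 * n := by omega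
        have h2 : 2 * (2 * n) - 2 * n = 2 * n := by omega
        simp [juxtOutReg, juxtReg, h1, h2]
    | some i => by
      show juxtReg n i (Fin.last _) = juxtReg n i 0
      simp [juxtReg]
  side_before
    | none => juxt_side_before n
    | some i => fun j => by
      show juxtSide n (i, j) ((Colour.nat n).shadeAt j) = juxtReg n i j.castSucc
      simp [juxtSide]
      rfl
  side_after
    | none => juxt_side_after n
    | some i => fun j => by
      show juxtSide n (i, j) (!(Colour.nat n).shadeAt j) = juxtReg n i j.succ
      simp [juxtSide]
      rfl

end juxt

section planarity

variable {ι : Type} {c : ι → Colour} {c₀ : Colour}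

theorem eqvGen_side (T : PreTangle c c₀) (s : T.Str) (w w' : Bool) :
    Relation.EqvGen T.Adjacent (T.side s w) (T.side s w') := by
  have h : Relation.EqvGen T.Adjacent (T.side s true) (T.side s false) :=
    Relation.EqvGen.rel _ _ ⟨s, rfl, rfl⟩
  cases w <;> cases w'
  · exact Relation.EqvGen.refl _
  · exact Relation.EqvGen.symm _ _ h
  · exact h
  · exact Relation.EqvGen.refl _

theorem card_joined_of_connected (T : PreTangle c c₀)
    (h : ∀ i, Quot.mk T.Joined (some i) = Quot.mk T.Joined none) :
    Nat.card (Quot T.Joined) = 1 := by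
  rw [Nat.card_eq_one_iff_unique]
  refine ⟨⟨?_⟩, ⟨Quot.mk _ none⟩⟩
  have key : ∀ q : Quot T.Joined, q = Quot.mk _ none := by
    rintro ⟨_ | i⟩
    · rfl
    · exact h i
  intro a b
  rw [key a, key b]

theorem card_joined_of_disjoint [Finite ι] (T : PreTangle c c₀)
    (h : ∀ b b', T.Joined b b' → b = b') :
    Nat.card (Quot T.Joined) = Nat.card ι + 1 := by
  rw [← Finite.card_option]
  exact Nat.card_congr
    { toFun := Quot.lift id h
      invFun := Quot.mk _
      left_inv := by rintro ⟨b⟩; rfl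
      right_inv := fun _ => rfl }

theorem stack_end_unique (m : ℕ) (c : Colour) (e e' : (stack m c).End)
    (hs : (stack m c).str e.1 e.2 = (stack m c).str e'.1 e'.2)
    (hl : leaves e.1 e.2 = leaves e'.1 e'.2) : e = e' := by
  obtain ⟨b, j⟩ := e
  obtain ⟨b', j'⟩ := e'
  have hj : (j : ℕ) < 2 * c.size := by
    cases b <;> exact j.2
  have hj' : (j' : ℕ) < 2 * c.size := by
    cases b' <;> exact j'.2
  rcases b with _ | i <;> rcases b' with _ | i' <;>
    simp only [stack, stackStr, leaves] at hs hl <;>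
    (split_ifs at hs <;>
      simp only [Prod.mk.injEq, Fin.ext_iff, Fin.val_castSucc, Fin.val_succ, Fin.val_last,
        Fin.val_zero, decide_eq_decide] at hs hl)
  all_goals first
    | (exfalso; omega)
    | (obtain rfl : j = j' := Fin.ext (by omega); rfl)
    | (obtain rfl : i = i' := Fin.ext (by omega)
       obtain rfl : j = j' := Fin.ext (by omega)
       rfl)

theorem stack_end_partner (m : ℕ) (c : Colour) (e : (stack m c).End) :
    ∃ e' : (stack m c).End, (stack m c).str e'.1 e'.2 = (stack m c).str e.1 e.2 ∧
      leaves e'.1 e'.2 ≠ leaves e.1 e.2 := by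
  obtain ⟨b, j⟩ := e
  have hj : (j : ℕ) < 2 * c.size := by
    cases b <;> exact j.2
  have keyN : ∀ j' : c.Pt, (stack m c).str none j' = (stack m c).str b j →
      leaves (none : Option (Fin m)) j' ≠ leaves b j → ∃ e' : (stack m c).End,
        (stack m c).str e'.1 e'.2 = (stack m c).str b j ∧ leaves e'.1 e'.2 ≠ leaves b j :=
    fun j' h1 h2 => ⟨⟨none, j'⟩, h1, h2⟩
  have keyS : ∀ (i' : Fin m) (j' : c.Pt), (stack m c).str (some i') j' = (stack m c).str b j →
      leaves (some i') j' ≠ leaves b j → ∃ e' : (stack m c).End,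
        (stack m c).str e'.1 e'.2 = (stack m c).str b j ∧ leaves e'.1 e'.2 ≠ leaves b j :=
    fun i' j' h1 h2 => ⟨⟨some i', j'⟩, h1, h2⟩
  by_cases h : (j : ℕ) < c.size
  · rcases b with _ | i
    · by_cases hm : m = 0
      · refine keyN ⟨2 * c.size - 1 - j, by omega⟩ ?_ ?_
        · have h' : ¬ 2 * c.size - 1 - j < c.size := by omega
          have h'' : 2 * c.size - 1 - (2 * c.size - 1 - j) = j := by omega
          simp [stack, stackStr, h, h', h'', hm, Fin.ext_iff]
        · simp only [leaves, ne_eq, decide_eq_decide]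
          omega
      · refine keyS ⟨0, by omega⟩ j ?_ ?_
        · simp [stack, stackStr, h]
        · simp only [leaves, ne_eq, decide_eq_decide]
          omega
    · by_cases hi : (i : ℕ) = 0
      · refine keyN j ?_ ?_
        · simp [stack, stackStr, h, Fin.ext_iff, hi]
        · simp only [leaves, ne_eq, decide_eq_decide]
          omega
      · refine keyS ⟨i - 1, by omega⟩ ⟨2 * c.size - 1 - j, by omega⟩ ?_ ?_
        · have h' : ¬ 2 * c.size - 1 - j < c.size := by omega
          have h'' : 2 * c.size - 1 - (2 * c.size - 1 - j) = j := by omega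
          have h3 : (i : ℕ) - 1 + 1 = i := by omega
          simp [stack, stackStr, h, h', h'', h3, Fin.ext_iff]
        · simp only [leaves, ne_eq, decide_eq_decide]
          omega
  · have h' : 2 * c.size - 1 - j < c.size := by omega
    rcases b with _ | i
    · by_cases hm : m = 0
      · refine keyN ⟨2 * c.size - 1 - j, by omega⟩ ?_ ?_
        · simp [stack, stackStr, h, h', hm, Fin.ext_iff]
        · simp only [leaves, ne_eq, decide_eq_decide]
          omega
      · refine keyS ⟨m - 1, by omega⟩ j ?_ ?_
        · have h3 : m - 1 + 1 = m := by omega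
          simp [stack, stackStr, h, h3, Fin.ext_iff]
        · simp only [leaves, ne_eq, decide_eq_decide]
          omega
    · by_cases hi : (i : ℕ) + 1 = m
      · refine keyN j ?_ ?_
        · simp [stack, stackStr, h, Fin.ext_iff, hi]
        · simp only [leaves, ne_eq, decide_eq_decide]
          omega
      · refine keyS ⟨i + 1, by omega⟩ ⟨2 * c.size - 1 - j, by omega⟩ ?_ ?_
        · simp [stack, stackStr, h, h', Fin.ext_iff]
        · simp only [leaves, ne_eq, decide_eq_decide]
          omega

theorem stack_connected (m : ℕ) (c : Colour) (r r' : (stack m c).Reg) :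
    Relation.EqvGen (stack m c).Adjacent r r' := by
  have key : ∀ (l : Fin (m + 1)) (j : ℕ) (hj : j < c.size + 1),
      Relation.EqvGen (stack m c).Adjacent (cell m c.size l ⟨j, hj⟩ : (stack m c).Reg)
        (Sum.inl 0 : Fin (c.size + 1) ⊕ (Fin m × Fin (c.size - 1))) := by
    intro l j
    induction j with
    | zero =>
      intro hj
      have : cell m c.size l ⟨0, hj⟩ = Sum.inl 0 := by simp [cell]
      rw [this]
      exact Relation.EqvGen.refl _
    | succ j ih =>
      intro hj
      refine Relation.EqvGen.trans _ _ _ ?_ (ih (by omega))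
      have h := eqvGen_side (stack m c) (l, ⟨j, by omega⟩) (!c.shadeAt j) (c.shadeAt j)
      simpa [stack, stackSide] using h
  have key' : ∀ r : (stack m c).Reg, Relation.EqvGen (stack m c).Adjacent r
      (Sum.inl 0 : Fin (c.size + 1) ⊕ (Fin m × Fin (c.size - 1))) := by
    rintro (j | ⟨l, j⟩)
    · have h := key 0 j j.2
      simpa [cell] using h
    · have h := key l.succ (j + 1) (by omega)
      have h2 : ¬ (j : ℕ) + 1 = c.size := by omega
      simpa [cell, h2] using h
  exact Relation.EqvGen.trans _ _ _ (key' r) (Relation.EqvGen.symm _ _ (key' r'))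

theorem stack_euler (m : ℕ) (c : Colour) :
    Nat.card (Fin m) + Nat.card (stack m c).Reg =
      Nat.card (stack m c).Str + Nat.card (Quot (stack m c).Joined) := by
  have hr : Nat.card (stack m c).Reg = c.size + 1 + m * (c.size - 1) := by
    show Nat.card (Fin (c.size + 1) ⊕ (Fin m × Fin (c.size - 1))) = _
    simp
  have hs : Nat.card (stack m c).Str = (m + 1) * c.size := by
    show Nat.card (Fin (m + 1) × Fin c.size) = _
    simp
  rw [hr, hs]
  by_cases h : c.size = 0
  · rw [card_joined_of_disjoint]
    · simp [h]
    · rintro b b' ⟨j, -⟩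
      have hj : (j : ℕ) < 2 * c.size := by
        cases b <;> exact j.2
      omega
  · rw [card_joined_of_connected]
    · obtain ⟨n, hn⟩ := Nat.exists_eq_succ_of_ne_zero h
      rw [hn]
      simp
      ring
    · rintro ⟨i, hi⟩
      induction i with
      | zero =>
        refine (Quot.sound ?_).symm
        exact ⟨(⟨0, by omega⟩ : c.Pt), (⟨0, by omega⟩ : c.Pt), by
          simp [stack, stackStr, Nat.pos_of_ne_zero h]⟩
      | succ i ih =>
        refine (Quot.sound ?_).symm.trans (ih (by omega))
        refine ⟨(⟨2 * c.size - 1, by omega⟩ : c.Pt), (⟨0, by omega⟩ : c.Pt), ?_⟩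
        have h1 : ¬ 2 * c.size - 1 < c.size := by omega
        simp [stack, stackStr, Nat.pos_of_ne_zero h, h1]

theorem stack_isPlanar (m : ℕ) (c : Colour) : (stack m c).IsPlanar where
  finite_box := inferInstance
  finite_str := inferInstanceAs (Finite (Fin (m + 1) × Fin c.size))
  finite_reg := inferInstanceAs (Finite (Fin (c.size + 1) ⊕ (Fin m × Fin (c.size - 1))))
  end_unique := stack_end_unique m c
  end_partner := stack_end_partner m c
  connected := stack_connected m c
  euler := stack_euler m c

theorem adj_isPlanar {T : PreTangle c c₀} (hT : T.IsPlanar) : T.adj.IsPlanar where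
  finite_box := hT.finite_box
  finite_str := hT.finite_str
  finite_reg := hT.finite_reg
  end_unique := by
    rintro ⟨b, j⟩ ⟨b', j'⟩ hs hl
    have hj := j.2
    have hj' := j'.2
    have h := hT.end_unique ⟨b, Fin.rev j⟩ ⟨b', Fin.rev j'⟩ hs (by
      cases b <;> cases b' <;>
        simp only [leaves, Fin.val_rev, decide_eq_decide] at hl ⊢ <;> omega)
    obtain rfl : b = b' := congrArg Sigma.fst h
    simpa using h
  end_partner := by
    rintro ⟨b, j⟩
    have hj := j.2
    obtain ⟨⟨b', j'⟩, h1, h2⟩ := hT.end_partner ⟨b, Fin.rev j⟩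
    have hj' := j'.2
    refine ⟨⟨b', Fin.rev j'⟩, ?_, ?_⟩
    · simpa [adj] using h1
    · cases b <;> cases b' <;>
        simp only [leaves, Fin.val_rev, ne_eq, decide_eq_decide] at h2 ⊢ <;> omega
  connected := hT.connected
  euler := by
    have h : T.adj.Joined = T.Joined := by
      ext b b'
      constructor
      · rintro ⟨j, j', h⟩
        exact ⟨Fin.rev j, Fin.rev j', h⟩
      · rintro ⟨j, j', h⟩
        exact ⟨Fin.rev j, Fin.rev j', by simpa [adj] using h⟩
    rw [h]
    exact hT.euler

theorem addCap_end_unique {n : ℕ} {T : PreTangle c (.nat n)} (hT : T.IsPlanar) {p : ℕ}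
    (hp : p ≤ 2 * n) (e e' : (T.addCap p hp).End)
    (hs : (T.addCap p hp).str e.1 e.2 = (T.addCap p hp).str e'.1 e'.2)
    (hl : leaves e.1 e.2 = leaves e'.1 e'.2) : e = e' := by
  obtain ⟨b, j⟩ := e
  obtain ⟨b', j'⟩ := e'
  have noneNone : ∀ j j' : (Colour.nat (n + 1)).Pt, capStr T p hp j = capStr T p hp j' →
      (j : ℕ) % 2 = j' % 2 → j = j' := by
    intro j j' hs hl
    have hj : (j : ℕ) < 2 * (n + 1) := j.2
    have hj' : (j' : ℕ) < 2 * (n + 1) := j'.2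
    have key : ∀ i i' : Fin (2 * n), T.str none i = T.str none i' → (i : ℕ) % 2 = i' % 2 →
        (i : ℕ) = i' := by
      intro i i' h1 h2
      have := hT.end_unique ⟨none, i⟩ ⟨none, i'⟩ h1 (by
        simp only [leaves, decide_eq_decide]; omega)
      have := eq_of_heq (Sigma.mk.inj this).2
      exact congrArg Fin.val this
    unfold capStr at hs
    ext
    split_ifs at hs
    · exact key _ _ (Option.some.inj hs) hl
    · have := key _ _ (Option.some.inj hs) (by simp only; omega)
      simp only at this
      omega
    · omega
    · have := key _ _ (Option.some.inj hs) (by simp only; omega)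
      simp only at this
      omega
    · have := key _ _ (Option.some.inj hs) (by simp only; omega)
      simp only at this
      omega
  have noneSome : ∀ (j : (Colour.nat (n + 1)).Pt) (i : ι) (j' : (c i).Pt),
      capStr T p hp j = some (T.str (some i) j') →
      leaves (none : Option ι) j = leaves (some i) j' → False := by
    intro j i j' hs hl
    have hj : (j : ℕ) < 2 * (n + 1) := j.2
    have key : ∀ k : Fin (2 * n), T.str none k = T.str (some i) j' → (k : ℕ) % 2 = j % 2 →
        False := by
      intro k h1 h2
      have := hT.end_unique ⟨none, k⟩ ⟨some i, j'⟩ h1 (by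
        rw [← hl]
        simp only [leaves, decide_eq_decide]; omega)
      cases this
    unfold capStr at hs
    split_ifs at hs
    · exact key _ (Option.some.inj hs) rfl
    · exact key _ (Option.some.inj hs) (by simp only; omega)
  rcases b with _ | i <;> rcases b' with _ | i'
  · obtain rfl : j = j' := noneNone j j' hs (by
      simp only [leaves, decide_eq_decide] at hl
      omega)
    rfl
  · exact (noneSome j i' j' hs hl).elim
  · exact (noneSome j' i j hs.symm hl.symm).elim
  · have h := hT.end_unique ⟨some i, j⟩ ⟨some i', j'⟩ (Option.some.inj hs) hl
    cases h
    rfl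

theorem addCap_end_partner {n : ℕ} {T : PreTangle c (.nat n)} (hT : T.IsPlanar) {p : ℕ}
    (hp : p ≤ 2 * n) (e : (T.addCap p hp).End) :
    ∃ e' : (T.addCap p hp).End, (T.addCap p hp).str e'.1 e'.2 = (T.addCap p hp).str e.1 e.2 ∧
      leaves e'.1 e'.2 ≠ leaves e.1 e.2 := by
  have lift : ∀ e : T.End, ∃ e' : (T.addCap p hp).End,
      (T.addCap p hp).str e'.1 e'.2 = some (T.str e.1 e.2) ∧
      leaves e'.1 e'.2 = leaves e.1 e.2 := by
    rintro ⟨_ | i, j⟩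
    · have hj : (j : ℕ) < 2 * n := j.2
      by_cases h : (j : ℕ) < p
      · refine ⟨⟨none, (⟨j, by omega⟩ : Fin (2 * (n + 1)))⟩, ?_, rfl⟩
        show capStr T p hp (⟨j, by omega⟩ : Fin (2 * (n + 1))) = _
        simp [capStr, h]
        rfl
      · refine ⟨⟨none, (⟨j + 2, by omega⟩ : Fin (2 * (n + 1)))⟩, ?_, ?_⟩
        · show capStr T p hp (⟨j + 2, by omega⟩ : Fin (2 * (n + 1))) = _
          have h1 : ¬ (j : ℕ) + 2 < p := by omega
          simp [capStr, h, h1]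
          rfl
        · simp only [leaves, decide_eq_decide]
          omega
    · exact ⟨⟨some i, j⟩, rfl, rfl⟩
  have old : ∀ (e : (T.addCap p hp).End) (e₀ : T.End),
      (T.addCap p hp).str e.1 e.2 = some (T.str e₀.1 e₀.2) →
      leaves e.1 e.2 = leaves e₀.1 e₀.2 →
      ∃ e' : (T.addCap p hp).End, (T.addCap p hp).str e'.1 e'.2 = (T.addCap p hp).str e.1 e.2 ∧
        leaves e'.1 e'.2 ≠ leaves e.1 e.2 := by
    intro e e₀ h1 h2
    obtain ⟨e₁, h3, h4⟩ := hT.end_partner e₀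
    obtain ⟨e', h5, h6⟩ := lift e₁
    refine ⟨e', ?_, ?_⟩
    · rw [h5, h1, h3]
    · rw [h6, h2]
      exact h4
  obtain ⟨_ | i, j⟩ := e
  · have hj : (j : ℕ) < 2 * (n + 1) := j.2
    by_cases h1 : (j : ℕ) < p
    · refine old ⟨none, j⟩ ⟨none, (⟨j, by omega⟩ : Fin (2 * n))⟩ ?_ rfl
      show capStr T p hp j = _
      simp [capStr, h1]
    by_cases h2 : (j : ℕ) = p
    · refine ⟨⟨none, (⟨p + 1, by omega⟩ : Fin (2 * (n + 1)))⟩, ?_, ?_⟩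
      · show capStr T p hp (⟨p + 1, by omega⟩ : Fin (2 * (n + 1))) = capStr T p hp j
        simp [capStr, h2]
      · simp only [leaves, ne_eq, decide_eq_decide]
        omega
    by_cases h3 : (j : ℕ) = p + 1
    · refine ⟨⟨none, (⟨p, by omega⟩ : Fin (2 * (n + 1)))⟩, ?_, ?_⟩
      · show capStr T p hp (⟨p, by omega⟩ : Fin (2 * (n + 1))) = capStr T p hp j
        simp [capStr, h3]
      · simp only [leaves, ne_eq, decide_eq_decide]
        omega
    · refine old ⟨none, j⟩ ⟨none, (⟨j - 2, by omega⟩ : Fin (2 * n))⟩ ?_ ?_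
      · show capStr T p hp j = _
        have h4 : ¬ (j : ℕ) < p + 2 := by omega
        simp [capStr, h1, h4]
      · simp only [leaves, decide_eq_decide]
        omega
  · exact old ⟨some i, j⟩ ⟨some i, j⟩ rfl rfl

theorem addCap_connected {n : ℕ} {T : PreTangle c (.nat n)} (hT : T.IsPlanar) {p : ℕ}
    (hp : p ≤ 2 * n) (r r' : (T.addCap p hp).Reg) :
    Relation.EqvGen (T.addCap p hp).Adjacent r r' := by
  have old : ∀ r r' : T.Reg, Relation.EqvGen T.Adjacent r r' →
      Relation.EqvGen (T.addCap p hp).Adjacent (some r : Option T.Reg) (some r' : Option T.Reg) := by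
    intro r r' h
    induction h with
    | rel _ _ h =>
      obtain ⟨s, rfl, rfl⟩ := h
      exact Relation.EqvGen.rel _ _ ⟨(some s : Option T.Str), rfl, rfl⟩
    | refl => exact Relation.EqvGen.refl _
    | symm _ _ _ ih => exact Relation.EqvGen.symm _ _ ih
    | trans _ _ _ _ _ ih ih' => exact Relation.EqvGen.trans _ _ _ ih ih'
  have new : ∃ r : T.Reg,
      Relation.EqvGen (T.addCap p hp).Adjacent (none : Option T.Reg) (some r : Option T.Reg) := by
    refine ⟨T.reg none (⟨p, Nat.lt_succ_of_le hp⟩ : Fin (2 * n + 1)), ?_⟩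
    have h := eqvGen_side (T.addCap p hp) (none : Option T.Str) (!(Colour.nat n).shadeAt p)
      ((Colour.nat n).shadeAt p)
    simpa [addCap, capSide] using h
  obtain ⟨r₀, h₀⟩ := new
  have all : ∀ r : Option T.Reg,
      Relation.EqvGen (T.addCap p hp).Adjacent r (some r₀ : Option T.Reg) := by
    rintro (_ | r)
    · exact h₀
    · exact old _ _ (hT.connected _ _)
  exact Relation.EqvGen.trans _ _ _ (all r) (Relation.EqvGen.symm _ _ (all r'))

theorem addCap_joined {n : ℕ} (T : PreTangle c (.nat n)) {p : ℕ} (hp : p ≤ 2 * n)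
    (b b' : Option ι) : (T.addCap p hp).Joined b b' → b = b' ∨ T.Joined b b' := by
  have old : ∀ (b : Option ι) (j), (T.addCap p hp).str b j = (none : Option T.Str) → b = none := by
    rintro (_ | i) j h
    · rfl
    · cases h
  have old' : ∀ (b : Option ι) (j) (s : T.Str),
      (T.addCap p hp).str b j = (some s : Option T.Str) → ∃ j', T.str b j' = s := by
    rintro (_ | i) j s h
    · change capStr T p hp j = some s at h
      unfold capStr at h
      split_ifs at h
      · exact ⟨_, Option.some.inj h⟩
      · exact ⟨_, Option.some.inj h⟩
    · exact ⟨j, Option.some.inj h⟩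
  rintro ⟨j, j', h⟩
  cases hs : ((T.addCap p hp).str b j : Option T.Str) with
  | none =>
    left
    rw [old b j hs, old b' j' (h.symm.trans hs)]
  | some s =>
    right
    obtain ⟨k, hk⟩ := old' b j s hs
    obtain ⟨k', hk'⟩ := old' b' j' s (h.symm.trans hs)
    exact ⟨k, k', hk.trans hk'.symm⟩

theorem joined_addCap {n : ℕ} (T : PreTangle c (.nat n)) {p : ℕ} (hp : p ≤ 2 * n)
    (b b' : Option ι) : T.Joined b b' → (T.addCap p hp).Joined b b' := by
  have old : ∀ (b : Option ι) (j),
      ∃ j', (T.addCap p hp).str b j' = (some (T.str b j) : Option T.Str) := by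
    rintro (_ | i) j
    · have hj : (j : ℕ) < 2 * n := j.2
      by_cases h : (j : ℕ) < p
      · refine ⟨(⟨j, by omega⟩ : Fin (2 * (n + 1))), ?_⟩
        show capStr T p hp (⟨j, by omega⟩ : Fin (2 * (n + 1))) = _
        simp [capStr, h]
        rfl
      · refine ⟨(⟨j + 2, by omega⟩ : Fin (2 * (n + 1))), ?_⟩
        show capStr T p hp (⟨j + 2, by omega⟩ : Fin (2 * (n + 1))) = _
        have h1 : ¬ (j : ℕ) + 2 < p := by omega
        simp [capStr, h, h1]
        rfl
    · exact ⟨j, rfl⟩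
  rintro ⟨j, j', h⟩
  obtain ⟨k, hk⟩ := old b j
  obtain ⟨k', hk'⟩ := old b' j'
  exact ⟨k, k', by rw [hk, hk', h]⟩

theorem addCap_isPlanar {n : ℕ} {T : PreTangle c (.nat n)} (hT : T.IsPlanar) {p : ℕ}
    (hp : p ≤ 2 * n) : (T.addCap p hp).IsPlanar where
  finite_box := hT.finite_box
  finite_str := by
    have := hT.finite_str
    exact inferInstanceAs (Finite (Option T.Str))
  finite_reg := by
    have := hT.finite_reg
    exact inferInstanceAs (Finite (Option T.Reg))
  end_unique := addCap_end_unique hT hp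
  end_partner := addCap_end_partner hT hp
  connected := addCap_connected hT hp
  euler := by
    have := hT.finite_str
    have := hT.finite_reg
    have hs : Nat.card (T.addCap p hp).Str = Nat.card T.Str + 1 := Finite.card_option
    have hr : Nat.card (T.addCap p hp).Reg = Nat.card T.Reg + 1 := Finite.card_option
    have hq : Nat.card (Quot (T.addCap p hp).Joined) = Nat.card (Quot T.Joined) :=
      Nat.card_congr
        { toFun := Quot.lift (Quot.mk _) (fun b b' h => by
            rcases addCap_joined T hp b b' h with rfl | h
            · rfl
            · exact Quot.sound h)
          invFun := Quot.map id (joined_addCap T hp)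
          left_inv := by rintro ⟨b⟩; rfl
          right_inv := by rintro ⟨b⟩; rfl }
    rw [hs, hr, hq]
    have := hT.euler
    omega

theorem close_isPlanar (n : ℕ) : (close n).IsPlanar where
  finite_box := inferInstance
  finite_str := inferInstanceAs (Finite (Fin n))
  finite_reg := inferInstanceAs (Finite (Fin (n + 1)))
  end_unique := by
    rintro ⟨_ | i, j⟩ ⟨_ | i', j'⟩ hs hl
    · exact absurd j.2 (by simp [Colour.size])
    · exact absurd j.2 (by simp [Colour.size])
    · exact absurd j'.2 (by simp [Colour.size])
    · have hj : (j : ℕ) < 2 * n := j.2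
      have hj' : (j' : ℕ) < 2 * n := j'.2
      obtain rfl : i = i' := Subsingleton.elim _ _
      have hs' : min (j : ℕ) (2 * n - 1 - j) = min (j' : ℕ) (2 * n - 1 - j') :=
        congrArg Fin.val hs
      simp only [leaves, decide_eq_decide] at hl
      obtain rfl : j = j' := Fin.ext (by omega)
      rfl
  end_partner := by
    rintro ⟨_ | i, j⟩
    · exact absurd j.2 (by simp [Colour.size])
    · have hj : (j : ℕ) < 2 * n := j.2
      refine ⟨⟨some i, (⟨2 * n - 1 - j, by omega⟩ : Fin (2 * n))⟩, ?_, ?_⟩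
      · show closeStr n _ = closeStr n _
        ext
        simp only [closeStr]
        omega
      · simp only [leaves, ne_eq, decide_eq_decide]
        omega
  connected := by
    have key : ∀ (j : ℕ) (hj : j < n + 1), Relation.EqvGen (close n).Adjacent
        (⟨j, hj⟩ : Fin (n + 1)) (0 : Fin (n + 1)) := by
      intro j
      induction j with
      | zero => exact fun _ => Relation.EqvGen.refl _
      | succ j ih =>
        intro hj
        refine Relation.EqvGen.trans _ _ _ ?_ (ih (by omega))
        have h := eqvGen_side (close n) (⟨j, by omega⟩ : Fin n) (!(Colour.nat n).shadeAt j)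
          ((Colour.nat n).shadeAt j)
        simpa [close, closeSide] using h
    intro r r'
    exact Relation.EqvGen.trans _ _ _ (key r.1 r.2) (Relation.EqvGen.symm _ _ (key r'.1 r'.2))
  euler := by
    rw [card_joined_of_disjoint]
    · have hs : Nat.card (close n).Str = n := Nat.card_fin n
      have hr : Nat.card (close n).Reg = n + 1 := Nat.card_fin (n + 1)
      rw [hs, hr]
      simp
      omega
    · rintro (_ | i) (_ | i') ⟨j, j', -⟩
      · rfl
      · exact absurd j.2 (by simp [Colour.size])
      · exact absurd j'.2 (by simp [Colour.size])
      · rw [Subsingleton.elim i i']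

theorem juxt_isPlanar (n : ℕ) : (juxt n).IsPlanar where
  finite_box := inferInstance
  finite_str := inferInstanceAs (Finite (Fin 2 × Fin (2 * n)))
  finite_reg := inferInstanceAs (Finite (Option (Fin 2 × Fin (2 * n - 1))))
  end_unique := by
    have noneNone : ∀ j j' : Fin (2 * (2 * n)), juxtOutStr n j = juxtOutStr n j' → j = j' := by
      intro j j' h
      unfold juxtOutStr at h
      split_ifs at h <;> simp [Prod.mk.injEq, Fin.ext_iff] at h <;> ext <;> omega
    have noneSome : ∀ (j : Fin (2 * (2 * n))) (i : Fin 2) (j' : Fin (2 * n)),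
        juxtOutStr n j = (i, j') → (j : ℕ) % 2 = j' % 2 := by
      intro j i j' h
      unfold juxtOutStr at h
      split_ifs at h <;> simp [Prod.mk.injEq, Fin.ext_iff] at h <;> omega
    rintro ⟨_ | i, j⟩ ⟨_ | i', j'⟩ hs hl
    · obtain rfl : j = j' := noneNone j j' hs
      rfl
    · have := noneSome j i' j' hs
      simp only [leaves, decide_eq_decide] at hl
      omega
    · have := noneSome j' i j hs.symm
      simp only [leaves, decide_eq_decide] at hl
      omega
    · have h : ((i, j) : Fin 2 × Fin (2 * n)) = (i', j') := hs
      cases h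
      rfl
  end_partner := by
    rintro ⟨_ | i, j⟩
    · have hj : (j : ℕ) < 2 * (2 * n) := j.2
      refine ⟨⟨some (juxtOutStr n j).1, (juxtOutStr n j).2⟩, rfl, ?_⟩
      simp only [leaves, juxtOutStr, ne_eq]
      split_ifs with h <;> simp <;> omega
    · have hj : (j : ℕ) < 2 * n := j.2
      by_cases hi : i = 0
      · subst hi
        refine ⟨⟨none, (⟨j, by omega⟩ : Fin (2 * (2 * n)))⟩, ?_, ?_⟩
        · show juxtOutStr n _ = (0, j)
          simp [juxtOutStr, hj]
          rfl
        · simp only [leaves, ne_eq, decide_eq_decide]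
          omega
      · obtain rfl : i = 1 := by omega
        refine ⟨⟨none, (⟨2 * n + j, by omega⟩ : Fin (2 * (2 * n)))⟩, ?_, ?_⟩
        · show juxtOutStr n _ = (1, j)
          simp [juxtOutStr]
          rfl
        · simp only [leaves, ne_eq, decide_eq_decide]
          omega
  connected := by
    have key : ∀ (i : Fin 2) (j : ℕ) (hj : j < 2 * n + 1), Relation.EqvGen (juxt n).Adjacent
        (juxtReg n i ⟨j, hj⟩) (none : Option (Fin 2 × Fin (2 * n - 1))) := by
      intro i j
      induction j with
      | zero =>
        intro hj
        have : juxtReg n i ⟨0, hj⟩ = none := by simp [juxtReg]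
        rw [this]
        exact Relation.EqvGen.refl _
      | succ j ih =>
        intro hj
        refine Relation.EqvGen.trans _ _ _ ?_ (ih (by omega))
        have h := eqvGen_side (juxt n) (i, (⟨j, by omega⟩ : Fin (2 * n)))
          (!(Colour.nat n).shadeAt j) ((Colour.nat n).shadeAt j)
        simpa [juxt, juxtSide] using h
    have key' : ∀ r : (juxt n).Reg, Relation.EqvGen (juxt n).Adjacent r
        (none : Option (Fin 2 × Fin (2 * n - 1))) := by
      rintro (_ | ⟨i, j⟩)
      · exact Relation.EqvGen.refl _
      · have hj := j.2
        have h := key i (j + 1) (by omega)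
        have h2 : ¬ (j : ℕ) + 1 = 2 * n := by omega
        simpa [juxtReg, h2] using h
    intro r r'
    exact Relation.EqvGen.trans _ _ _ (key' r) (Relation.EqvGen.symm _ _ (key' r'))
  euler := by
    have hs : Nat.card (juxt n).Str = 2 * (2 * n) := by
      show Nat.card (Fin 2 × Fin (2 * n)) = _
      simp
    have hr : Nat.card (juxt n).Reg = 2 * (2 * n - 1) + 1 := by
      show Nat.card (Option (Fin 2 × Fin (2 * n - 1))) = _
      simp
    rw [hs, hr]
    by_cases h : n = 0
    · subst h
      rw [card_joined_of_disjoint]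
      · simp
      · rintro b b' ⟨j, -⟩
        cases b <;> exact absurd j.2 (by simp [Colour.size])
    · rw [card_joined_of_connected]
      · simp
        omega
      · intro i
        refine Quot.sound ?_
        by_cases hi : i = 0
        · subst hi
          refine ⟨(⟨0, by omega⟩ : Fin (2 * n)), (⟨0, by omega⟩ : Fin (2 * (2 * n))), ?_⟩
          show _ = juxtOutStr n _
          simp [juxtOutStr, Nat.pos_of_ne_zero h, juxt]
        · obtain rfl : i = 1 := by omega
          refine ⟨(⟨0, by omega⟩ : Fin (2 * n)), (⟨2 * n, by omega⟩ : Fin (2 * (2 * n))), ?_⟩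
          show _ = juxtOutStr n _
          simp [juxtOutStr, juxt]

end planarity

end PreTangle

/-- Planar tangles with internal boxes `i : ι` of colours `c i` and external box of colour `c₀`. -/
structure Tangle {ι : Type} (c : ι → Colour) (c₀ : Colour) extends PreTangle c c₀ where
  planar : toPreTangle.IsPlanar

namespace Tangle

/-- The multiplicative identity `1^c`. -/
def one (c : Colour) : Tangle (fun _ : Fin 0 => c) c := ⟨_, PreTangle.stack_isPlanar 0 c⟩

/-- The identity tangle `I_c^c`. -/
def ident (c : Colour) : Tangle (fun _ : Fin 1 => c) c := ⟨_, PreTangle.stack_isPlanar 1 c⟩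

/-- The multiplication tangle `M_{c,c}^c`. -/
def mul (c : Colour) : Tangle (fun _ : Fin 2 => c) c := ⟨_, PreTangle.stack_isPlanar 2 c⟩

/-- The inclusion tangle `I_n^{n+1}`: a strand is added on the right. -/
def incl (n : ℕ) : Tangle (fun _ : Fin 1 => Colour.nat n) (.nat (n + 1)) :=
  ⟨(ident (.nat n)).addCap n (by omega), PreTangle.addCap_isPlanar (ident (.nat n)).planar _⟩

/-- The Jones projection tangle `E^{m+2}`: `m` vertical strands, then a cup at the top and a cap at
the bottom. -/
def jones (m : ℕ) : Tangle (fun _ : Fin 0 => Colour.nat m) (.nat (m + 2)) :=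
  ⟨((one (.nat m)).addCap m (by omega)).addCap (m + 2) (by omega),
    PreTangle.addCap_isPlanar (PreTangle.addCap_isPlanar (one (.nat m)).planar _) _⟩

/-- The trace tangle `TR_n^0`. -/
def trace (n : ℕ) : Tangle (fun _ : Fin 1 => Colour.nat n) (.nat 0) :=
  ⟨_, PreTangle.close_isPlanar n⟩

/-- Two disjoint `n`-boxes in a `2n`-box, whose points are those of the first box followed by
those of the second. -/
def juxt (n : ℕ) : Tangle (fun _ : Fin 2 => Colour.nat n) (.nat (2 * n)) :=
  ⟨_, PreTangle.juxt_isPlanar n⟩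

/-- The adjoint tangle. -/
def adj {ι : Type} {c : ι → Colour} {c₀ : Colour} (T : Tangle c c₀) : Tangle c c₀ :=
  ⟨T.toPreTangle.adj, PreTangle.adj_isPlanar T.planar⟩

end Tangle

/-- A complex planar algebra: an algebra over the coloured operad of planar tangles. -/
structure PlanarAlgebra where
  V : Colour → Type u
  [addCommGroup : ∀ c, AddCommGroup (V c)]
  [module : ∀ c, Module ℂ (V c)]
  Z : {ι : Type} → {c : ι → Colour} → {c₀ : Colour} → Tangle c c₀ →
    MultilinearMap ℂ (fun i => V (c i)) (V c₀)
  /-- Invariance under isotopy and compatibility with renumbering. -/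
  Z_reindex : ∀ {ι κ : Type} {c : ι → Colour} {c₀ : Colour} (e : κ ≃ ι) (T : Tangle c c₀)
    (U : Tangle (c ∘ e) c₀), Nonempty (U.Iso (T.reindex e)) →
    ∀ x : (i : ι) → V (c i), Z U (fun i => x (e i)) = Z T x
  Z_ident : ∀ c (x : V c), Z (Tangle.ident c) (fun _ => x) = x
  /-- Compatibility with substitution. -/
  Z_comp : ∀ {ι : Type} {κ : ι → Type} {d : (i : ι) → κ i → Colour} {c : ι → Colour}
    {c₀ : Colour} (T : Tangle c c₀) (S : (i : ι) → Tangle (d i) (c i))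
    (U : Tangle (fun p : (i : ι) × κ i => d p.1 p.2) c₀),
    Nonempty (U.Iso (T.comp fun i => (S i).toPreTangle)) →
    ∀ x : (p : (i : ι) × κ i) → V (d p.1 p.2),
      Z U x = Z T (fun i => Z (S i) (fun j => x ⟨i, j⟩))

attribute [instance] PlanarAlgebra.addCommGroup PlanarAlgebra.module

namespace PlanarAlgebra

variable (P : PlanarAlgebra.{u})

/-- The unit `1_c` of `P_c`. -/
def one (c : Colour) : P.V c := P.Z (Tangle.one c) (fun i => i.elim0)

/-- The multiplication of `P_c`. -/
def mul {c : Colour} (x y : P.V c) : P.V c := P.Z (Tangle.mul c) ![x, y]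

/-- The inclusion `P_n → P_{n+1}`. -/
def incl {n : ℕ} (x : P.V (.nat n)) : P.V (.nat (n + 1)) := P.Z (Tangle.incl n) (fun _ => x)

/-- The non-normalised Jones projection `E_{m+2}` in `P_{m+2}`. -/
def jones (m : ℕ) : P.V (.nat (m + 2)) := P.Z (Tangle.jones m) (fun i => i.elim0)

/-- `P` is of finite depth at most `k`: `P_{d+1} = P_d E_{d+1} P_d` (the linear span) for some
positive `d = m + 1 ≤ k`. -/
def DepthAtMost (k : ℕ) : Prop :=
  ∃ m, m + 1 ≤ k ∧
    Submodule.span ℂ {z : P.V (.nat (m + 2)) | ∃ x y : P.V (.nat (m + 1)),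
      z = P.mul (P.mul (P.incl x) (P.jones m)) (P.incl y)} = ⊤

/-- A planar subalgebra: subspaces stable under all planar tangles. -/
structure Subalgebra where
  carrier : (c : Colour) → Submodule ℂ (P.V c)
  Z_mem : ∀ {ι : Type} {c : ι → Colour} {c₀ : Colour} (T : Tangle c c₀)
    (x : (i : ι) → P.V (c i)), (∀ i, x i ∈ carrier (c i)) → P.Z T x ∈ carrier c₀

/-- `P` is generated, as a planar algebra, by the single element `z`. -/
def GeneratedBy {c : Colour} (z : P.V c) : Prop :=
  ∀ Q : P.Subalgebra, z ∈ Q.carrier c → ∀ c', Q.carrier c' = ⊤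

end PlanarAlgebra

/-- A subfactor planar algebra. -/
structure SubfactorPlanarAlgebra extends PlanarAlgebra.{u} where
  finiteDimensional : ∀ c, FiniteDimensional ℂ (V c)
  /-- `P_{0₊}` and `P_{0₋}` are one-dimensional. -/
  connected : ∀ c, c.size = 0 → Module.finrank ℂ (V c) = 1
  /-- The modulus. -/
  δ : ℝ
  δ_pos : 0 < δ
  /-- Closed loops contribute a factor `δ`. -/
  modulus : ∀ {ι : Type} {c : ι → Colour} {c₀ : Colour} (T U : Tangle c c₀) (r : T.Reg),
    Nonempty (U.Iso (T.addLoop r)) → ∀ x : (i : ι) → V (c i), Z U x = (δ : ℂ) • Z T x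
  /-- Sphericality, with `P_{0₊} = ℂ = P_{0₋}` through the units. -/
  spherical : ∀ {ι : Type} {c : ι → Colour} {c₀ c₁ : Colour}, c₀.size = 0 → c₁.size = 0 →
    ∀ (T : Tangle c c₀) (U : Tangle c c₁), Nonempty (T.SphereIso U.toPreTangle) →
    ∀ (x : (i : ι) → V (c i)) (a : ℂ),
      Z T x = a • toPlanarAlgebra.one c₀ → Z U x = a • toPlanarAlgebra.one c₁
  /-- The involution of `P_c`. -/
  star : {c : Colour} → V c → V c
  /-- With the multiplication given by the tangle and this involution, `P_c` is a C*-algebra. -/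
  cstar : ∀ c, ∃ (A : Type u) (_ : CStarAlgebra A) (φ : V c ≃ₗ[ℂ] A),
    (∀ x y, φ (toPlanarAlgebra.mul x y) = φ x * φ y) ∧ ∀ x, φ (star x) = Star.star (φ x)
  star_Z : ∀ {ι : Type} {c : ι → Colour} {c₀ : Colour} (T : Tangle c c₀)
    (x : (i : ι) → V (c i)), star (Z T x) = Z T.adj (fun i => star (x i))
  /-- The trace `τ(x) = δ⁻ⁿ Z_{TR}(x)` is positive and faithful. -/
  trace_pos : ∀ (n : ℕ) (x : V (.nat n)), x ≠ 0 → ∃ a : ℝ, 0 < a ∧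
    ((δ : ℂ) ^ n)⁻¹ • Z (Tangle.trace n) (fun _ => toPlanarAlgebra.mul (star x) x) =
      (a : ℂ) • toPlanarAlgebra.one (.nat 0)

namespace SubfactorPlanarAlgebra

variable (P : SubfactorPlanarAlgebra.{u})

/-- The normalised picture trace, with values in the line `P_0 = ℂ 1_0`. -/
noncomputable def tau {n : ℕ} (x : P.V (.nat n)) : P.V (.nat 0) :=
  ((P.δ : ℂ) ^ n)⁻¹ • P.Z (Tangle.trace n) (fun _ => x)

/-- `x` generates the (finite-dimensional) C*-algebra `P_n`: every subspace which contains `x` and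
the unit and is stable under multiplication and the involution is all of `P_n`. -/
def GeneratesCStar {n : ℕ} (x : P.V (.nat n)) : Prop :=
  ∀ W : Submodule ℂ (P.V (.nat n)), x ∈ W → P.one _ ∈ W → (∀ y ∈ W, ∀ z ∈ W, P.mul y z ∈ W) →
    (∀ y ∈ W, P.star y ∈ W) → W = ⊤

/-- The juxtaposition of `x` and `x*`, a `2n`-box. -/
def juxtStar {n : ℕ} (x : P.V (.nat n)) : P.V (.nat (2 * n)) :=
  P.Z (Tangle.juxt n) ![x, P.star x]

end SubfactorPlanarAlgebra

end Planar

/-!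
Let `Q` be a planar subalgebra which contains `z = x ⊔ x*`.  Closing up one half of the `2k`-box
`z` leaves the other half next to a trace: the results are `tr(x*) x` and `tr(x) x*`
(`PlanarAlgebra.closeOne_juxt`).  The trace tangle is its own reflection, so `tr(x*)` is the
adjoint of `tr(x)` and both are non-zero; hence `Q` contains `x` and `x*`.  The elements `y` of
`P_k` for which both `y` and `y*` lie in `Q` form a unital *-subalgebra, and so `Q` contains
`P_k`.

From `P_k` one gets to the other colours as follows.  Inserting a cap and capping it off again is
multiplication by `δ ≠ 0` (`SubfactorPlanarAlgebra.capOff_cap`), which gives the lower colours.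
For the higher colours let a `D`-box `w` act on an `n`-box `z` with `D ≤ n` by hanging `z` below
`w` (`PlanarAlgebra.hang`): this is the product of `w`, included in `P_n`, and `z`, and it makes
`P_n` a module over `P_D`.  A Jones projection acts by capping off two points and inserting a cap
there (`PlanarAlgebra.hang_jones`).  Finite depth writes the unit of `P_{d+1}` as a sum of
products `a E b` with `a`, `b` from `P_d`, so every `z` in `P_{n+1}` with `n ≥ d` is a sum of
terms `a · cap (capOff (b · z))`, where `capOff (b · z)` has colour `n`.  By induction `Q`
contains everything (`PlanarAlgebra.Subalgebra.carrier_succ_eq_top`).  The colour `0₋` is spanned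
by its unit.

It remains to find `x`.  A finite-dimensional C*-algebra is semisimple, hence a product of matrix
algebras, and as such it is generated by a diagonal matrix with distinct non-zero entries together
with the element all of whose entries are `1`.  There is a complex line of pairs which passes
through this pair at the parameter `i` and consists of pairs `(a, a*)` at the real parameters.  A
determinant formed from finitely many words in the pair is an entire function of the parameter and
does not vanish at `i`, so it is non-zero at some real parameter, where `a` generates the
C*-algebra (`exists_cstar_generator`).  The trace is treated in the same way, as a further entire
factor: it is non-zero at the unit, by positivity, and so one may start from a pair whose first
element has non-zero trace.

Each relation used rests on an identification of a composite of diagrams with an explicit diagram.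
`PreTangle.ReIso` is the notion of isomorphism for this, with the boxes renumbered and colours
equal only propositionally.  `PreTangle.ReIso.comp` recognises an explicit diagram as a composite,
and `PreTangle.ReIso.ofTight` uses that a diagram whose strings and regions all meet a box is
determined by the partition of its boundary points and intervals.  Planarity is proved for the
explicit diagrams only and carried over to the composites (`PreTangle.ReIso.isPlanar`).  An
annulus of radial strands, `PreTangle.ringId`, serves as identity tangle: unlike the vertical
picture of the identity, it has the same form at every boundary point, so that caps may be
inserted anywhere and boxes hung anywhere.
-/

namespace Planar

/-! ### Diagrams with renumbered boxes, and composites -/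

namespace PreTangle

/-- Isomorphism of diagrams whose internal boxes correspond under `e`.  The colours of corresponding
boxes need only be propositionally equal, so points and intervals are compared by their numbers. -/
structure ReIso {ι κ : Type} {c : ι → Colour} {c' : κ → Colour} {c₀ : Colour} (T : PreTangle c c₀)
    (U : PreTangle c' c₀) (e : κ ≃ ι) where
  color : ∀ k, c' k = c (e k)
  strEquiv : T.Str ≃ U.Str
  regEquiv : T.Reg ≃ U.Reg
  map_shade : ∀ r, U.shade (regEquiv r) = T.shade r
  map_side : ∀ s w, U.side (strEquiv s) w = regEquiv (T.side s w)
  map_str : ∀ (b : Option κ) (j : (boxColour c' c₀ b).Pt) (j' : (boxColour c c₀ (b.map e)).Pt),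
    (j : ℕ) = j' → U.str b j = strEquiv (T.str (b.map e) j')
  map_reg : ∀ (b : Option κ) (j : (boxColour c' c₀ b).Gap) (j' : (boxColour c c₀ (b.map e)).Gap),
    (j : ℕ) = j' → U.reg b j = regEquiv (T.reg (b.map e) j')

theorem boxColour_map {ι κ : Type} {c : ι → Colour} {c' : κ → Colour} {c₀ : Colour} (e : κ → ι)
    (hc : ∀ k, c' k = c (e k)) (b : Option κ) :
    boxColour c' c₀ b = boxColour c c₀ (b.map e) := by
  cases b
  · rfl
  · exact hc _

theorem leaves_map {ι κ : Type} (e : κ → ι) (b : Option κ) (j : ℕ) :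
    leaves (b.map e) j = leaves b j := by
  cases b <;> rfl

/-- An isomorphism in the sense of `Iso`, once the colours agree definitionally. -/
theorem ReIso.nonempty_iso {ι κ : Type} {c : ι → Colour} {c₀ : Colour} {T : PreTangle c c₀}
    {e : κ ≃ ι} {U : PreTangle (c ∘ e) c₀} (h : ReIso T U e) : Nonempty (U.Iso (T.reindex e)) :=
  ⟨{ strEquiv := h.strEquiv.symm
     regEquiv := h.regEquiv.symm
     map_shade := fun r => by
       have := h.map_shade (h.regEquiv.symm r)
       rw [Equiv.apply_symm_apply] at this
       exact this.symm
     map_side := fun s w => by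
       have := h.map_side (h.strEquiv.symm s) w
       rw [Equiv.apply_symm_apply] at this
       rw [this]
       exact (h.regEquiv.symm_apply_apply _).symm
     map_str := by
       rintro (_ | k) j
       · exact (h.strEquiv.symm_apply_eq.mpr (h.map_str none j j rfl)).symm
       · exact (h.strEquiv.symm_apply_eq.mpr (h.map_str (some k) j j rfl)).symm
     map_reg := by
       rintro (_ | k) j
       · exact (h.regEquiv.symm_apply_eq.mpr (h.map_reg none j j rfl)).symm
       · exact (h.regEquiv.symm_apply_eq.mpr (h.map_reg (some k) j j rfl)).symm }⟩

/-- Planarity is carried along an isomorphism.  A composite identified with an explicit planar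
diagram is thereby planar. -/
theorem ReIso.isPlanar {ι κ : Type} {c : ι → Colour} {c' : κ → Colour} {c₀ : Colour}
    {T : PreTangle c c₀} {U : PreTangle c' c₀} {e : κ ≃ ι} (h : ReIso T U e) (hU : U.IsPlanar) :
    T.IsPlanar := by
  have hsurj : Function.Surjective (Option.map e) := (Equiv.optionCongr e).surjective
  have hcol := boxColour_map (c₀ := c₀) e h.color
  -- every end of `T` is the image of an end of `U`
  have lift : ∀ E : T.End, ∃ E' : U.End, E.1 = E'.1.map e ∧ (E.2 : ℕ) = E'.2 ∧
      U.str E'.1 E'.2 = h.strEquiv (T.str E.1 E.2) ∧ leaves E'.1 E'.2 = leaves E.1 E.2 := by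
    rintro ⟨b, j⟩
    obtain ⟨b, rfl⟩ := hsurj b
    refine ⟨⟨b, ⟨j, by rw [hcol]; exact j.2⟩⟩, rfl, rfl, h.map_str _ _ _ rfl, ?_⟩
    exact (leaves_map e b j).symm
  have push : ∀ E' : U.End, ∃ E : T.End,
      U.str E'.1 E'.2 = h.strEquiv (T.str E.1 E.2) ∧ leaves E'.1 E'.2 = leaves E.1 E.2 := by
    rintro ⟨b, j⟩
    exact ⟨⟨b.map e, ⟨j, by rw [← hcol]; exact j.2⟩⟩, h.map_str _ _ _ rfl,
      (leaves_map e b j).symm⟩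
  refine ⟨?_, ?_, ?_, ?_, ?_, ?_, ?_⟩
  · have := hU.finite_box
    exact Finite.of_equiv _ e
  · have := hU.finite_str
    exact Finite.of_equiv _ h.strEquiv.symm
  · have := hU.finite_reg
    exact Finite.of_equiv _ h.regEquiv.symm
  · intro E₁ E₂ hs hl
    obtain ⟨F₁, hb₁, hj₁, hs₁, hl₁⟩ := lift E₁
    obtain ⟨F₂, hb₂, hj₂, hs₂, hl₂⟩ := lift E₂
    have := hU.end_unique F₁ F₂ (by rw [hs₁, hs₂, hs]) (by rw [hl₁, hl₂, hl])
    subst this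
    obtain ⟨b₁, j₁⟩ := E₁
    obtain ⟨b₂, j₂⟩ := E₂
    obtain rfl : b₁ = b₂ := hb₁.trans hb₂.symm
    obtain rfl : j₁ = j₂ := Fin.ext (hj₁.trans hj₂.symm)
    rfl
  · intro E
    obtain ⟨F, -, -, hs, hl⟩ := lift E
    obtain ⟨F', hs', hl'⟩ := hU.end_partner F
    obtain ⟨E', hs'', hl''⟩ := push F'
    refine ⟨E', h.strEquiv.injective ?_, ?_⟩
    · rw [← hs'', hs', hs]
    · rw [← hl'', ← hl]; exact hl'
  · have key : ∀ r r' : U.Reg, Relation.EqvGen U.Adjacent r r' →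
        Relation.EqvGen T.Adjacent (h.regEquiv.symm r) (h.regEquiv.symm r') := by
      intro r r' hr
      induction hr with
      | rel _ _ hr =>
        obtain ⟨s, rfl, rfl⟩ := hr
        refine Relation.EqvGen.rel _ _ ⟨h.strEquiv.symm s, ?_, ?_⟩ <;>
        · rw [Equiv.eq_symm_apply, ← h.map_side, Equiv.apply_symm_apply]
      | refl => exact Relation.EqvGen.refl _
      | symm _ _ _ ih => exact Relation.EqvGen.symm _ _ ih
      | trans _ _ _ _ _ ih ih' => exact Relation.EqvGen.trans _ _ _ ih ih'
    intro r r'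
    simpa using key _ _ (hU.connected (h.regEquiv r) (h.regEquiv r'))
  · have hq : Nat.card (Quot T.Joined) = Nat.card (Quot U.Joined) := by
      refine (Nat.card_congr (Quot.congr (Equiv.optionCongr e) ?_)).symm
      intro b b'
      constructor
      · rintro ⟨j, j', hj⟩
        refine ⟨⟨j, ?_⟩, ⟨j', ?_⟩, h.strEquiv.injective ?_⟩
        · exact (congrArg (fun x : Colour => (j : ℕ) < 2 * x.size) (hcol b)).mp j.2
        · exact (congrArg (fun x : Colour => (j' : ℕ) < 2 * x.size) (hcol b')).mp j'.2
        · exact (h.map_str b j _ rfl).symm.trans (hj.trans (h.map_str b' j' _ rfl))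
      · rintro ⟨j, j', hj⟩
        refine ⟨⟨j, ?_⟩, ⟨j', ?_⟩, ?_⟩
        · exact (congrArg (fun x : Colour => (j : ℕ) < 2 * x.size) (hcol b)).mpr j.2
        · exact (congrArg (fun x : Colour => (j' : ℕ) < 2 * x.size) (hcol b')).mpr j'.2
        · exact (h.map_str b _ j rfl).trans ((congrArg _ hj).trans (h.map_str b' _ j' rfl).symm)
    rw [hq, Nat.card_congr e.symm, Nat.card_congr h.strEquiv, Nat.card_congr h.regEquiv]
    exact hU.euler

/-- Every string ends at a box and every region touches one. -/
structure Tight {ι : Type} {c : ι → Colour} {c₀ : Colour} (T : PreTangle c c₀) : Prop where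
  str_surj : ∀ s, ∃ b j, T.str b j = s
  reg_surj : ∀ r, ∃ b j, T.reg b j = r

section boundary

variable {ι κ : Type} {c : ι → Colour} {c₀ : Colour} {c' : κ → Colour} {c₀' : Colour}

/-- Maps of strings and regions which respect the boundary of a box respect the sides of the
strings ending there: these are regions at boundary intervals. -/
theorem side_of_boundary (T : PreTangle c c₀) (U : PreTangle c' c₀') {b : Option ι} {b' : Option κ}
    (hc : boxColour c c₀ b = boxColour c' c₀' b') {f : T.Str → U.Str} {g : T.Reg → U.Reg}
    (hf : ∀ (j : (boxColour c' c₀' b').Pt) (j' : (boxColour c c₀ b).Pt), (j : ℕ) = j' →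
      U.str b' j = f (T.str b j'))
    (hg : ∀ (j : (boxColour c' c₀' b').Gap) (j' : (boxColour c c₀ b).Gap), (j : ℕ) = j' →
      U.reg b' j = g (T.reg b j')) (j : (boxColour c c₀ b).Pt) (w : Bool) :
    U.side (f (T.str b j)) w = g (T.side (T.str b j) w) := by
  have hj : (j : ℕ) < 2 * (boxColour c' c₀' b').size := by rw [← hc]; exact j.2
  have hsh : ∀ i, (boxColour c c₀ b).shadeAt i = (boxColour c' c₀' b').shadeAt i := by simp [hc]
  rw [← hf ⟨j, hj⟩ j rfl]
  by_cases hw : w = (boxColour c c₀ b).shadeAt j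
  · rw [hw, T.side_before, ← hg (Fin.castSucc ⟨j, hj⟩) _ rfl, ← U.side_before, hsh]
  · have hw' : w = !(boxColour c c₀ b).shadeAt j := by
      cases w <;> cases h : (boxColour c c₀ b).shadeAt j <;> simp_all
    rw [hw', T.side_after, ← hg (Fin.succ ⟨j, hj⟩) _ rfl, ← U.side_after, hsh]

/-- A map of regions which respects the boundary of a box respects the shading of the regions
there: it is fixed by the colour of the box. -/
theorem shade_of_boundary (T : PreTangle c c₀) (U : PreTangle c' c₀') {b : Option ι}
    {b' : Option κ} (hc : boxColour c c₀ b = boxColour c' c₀' b') {g : T.Reg → U.Reg}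
    (hg : ∀ (j : (boxColour c' c₀' b').Gap) (j' : (boxColour c c₀ b).Gap), (j : ℕ) = j' →
      U.reg b' j = g (T.reg b j')) (j : (boxColour c c₀ b).Gap) :
    U.shade (g (T.reg b j)) = T.shade (T.reg b j) := by
  have hj : (j : ℕ) < 2 * (boxColour c' c₀' b').size + 1 := by rw [← hc]; exact j.2
  have hsh : ∀ i, (boxColour c c₀ b).shadeAt i = (boxColour c' c₀' b').shadeAt i := by simp [hc]
  rw [← hg ⟨j, hj⟩ j rfl, U.shade_reg, T.shade_reg, hsh]

/-- A diagram is determined by the partition of the marked points and the boundary intervals into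
those on the same string or region, if these meet all strings and regions. -/
noncomputable def ReIso.ofTight {T : PreTangle c c₀} {U : PreTangle c' c₀} (e : κ ≃ ι)
    (hc : ∀ k, c' k = c (e k)) (hU : U.Tight) (f : T.Str → U.Str) (g : T.Reg → U.Reg)
    (hf : Function.Injective f) (hg : Function.Injective g)
    (map_str : ∀ (b : Option κ) (j : (boxColour c' c₀ b).Pt)
      (j' : (boxColour c c₀ (b.map e)).Pt), (j : ℕ) = j' → U.str b j = f (T.str (b.map e) j'))
    (map_reg : ∀ (b : Option κ) (j : (boxColour c' c₀ b).Gap)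
      (j' : (boxColour c c₀ (b.map e)).Gap), (j : ℕ) = j' → U.reg b j = g (T.reg (b.map e) j')) :
    ReIso T U e :=
  have hcol := boxColour_map (c₀ := c₀) e hc
  have hs : ∀ u, ∃ (b : Option κ) (j : _), f (T.str (b.map e) j) = u := fun u => by
    obtain ⟨b, j, rfl⟩ := hU.str_surj u
    exact ⟨b, ⟨j, by rw [← hcol]; exact j.2⟩, (map_str b j ⟨j, _⟩ rfl).symm⟩
  have hr : ∀ u, ∃ (b : Option κ) (j : _), g (T.reg (b.map e) j) = u := fun u => by
    obtain ⟨b, j, rfl⟩ := hU.reg_surj u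
    exact ⟨b, ⟨j, by rw [← hcol]; exact j.2⟩, (map_reg b j ⟨j, _⟩ rfl).symm⟩
  { color := hc
    strEquiv := Equiv.ofBijective f ⟨hf, fun u => by
      obtain ⟨b, j, h⟩ := hs u
      exact ⟨_, h⟩⟩
    regEquiv := Equiv.ofBijective g ⟨hg, fun u => by
      obtain ⟨b, j, h⟩ := hr u
      exact ⟨_, h⟩⟩
    map_shade := fun r => by
      obtain ⟨b, j, h⟩ := hr (g r)
      obtain rfl := hg h
      exact shade_of_boundary T U (hcol b).symm (map_reg b) j
    map_side := fun s w => by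
      obtain ⟨b, j, h⟩ := hs (f s)
      obtain rfl := hf h
      exact side_of_boundary T U (hcol b).symm (map_str b) (map_reg b) j w
    map_str := map_str
    map_reg := map_reg }

end boundary

section comp

variable {ι : Type} {κ : ι → Type} {κ' : Type} {c : ι → Colour} {d : (i : ι) → κ i → Colour}
  {c' : κ' → Colour} {c₀ : Colour}

/-- Compatible maps from `T` and the `S i` to `U` which are jointly bijective up to the gluing
identify `U` with the composite of `T` and the `S i`.  The sides of the strings and the shading of
the regions of `T` take care of themselves when `T` is tight. -/
def ReIso.comp {T : PreTangle c c₀} {S : (i : ι) → PreTangle (d i) (c i)}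
    {U : PreTangle c' c₀} (e : κ' ≃ (i : ι) × κ i) (hc : ∀ k, c' k = d (e k).1 (e k).2)
    (hT : T.Tight) (fT : T.Str → U.Str) (fS : (i : ι) → (S i).Str → U.Str)
    (gT : T.Reg → U.Reg) (gS : (i : ι) → (S i).Reg → U.Reg)
    (f_glue : ∀ i j, fT (T.str (some i) j) = fS i ((S i).str none j))
    (g_glue : ∀ i j, gT (T.reg (some i) j) = gS i ((S i).reg none j))
    (f_none : ∀ j, U.str none j = fT (T.str none j))
    (g_none : ∀ j, U.reg none j = gT (T.reg none j))
    (f_some : ∀ (k : κ') (j : (c' k).Pt) (j' : (d (e k).1 (e k).2).Pt), (j : ℕ) = j' →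
      U.str (some k) j = fS (e k).1 ((S (e k).1).str (some (e k).2) j'))
    (g_some : ∀ (k : κ') (j : (c' k).Gap) (j' : (d (e k).1 (e k).2).Gap), (j : ℕ) = j' →
      U.reg (some k) j = gS (e k).1 ((S (e k).1).reg (some (e k).2) j'))
    (sideS : ∀ i s w, U.side (fS i s) w = gS i ((S i).side s w))
    (shadeS : ∀ i r, U.shade (gS i r) = (S i).shade r)
    (σ : U.Str → Quot (StrGlue T S)) (ρ : U.Reg → Quot (RegGlue T S))
    (σT : ∀ s, σ (fT s) = outerStr T S s) (σS : ∀ i s, σ (fS i s) = innerStr T S i s)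
    (ρT : ∀ r, ρ (gT r) = outerReg T S r) (ρS : ∀ i r, ρ (gS i r) = innerReg T S i r)
    (f_surj : ∀ u, (∃ s, fT s = u) ∨ ∃ i s, fS i s = u)
    (g_surj : ∀ u, (∃ r, gT r = u) ∨ ∃ i r, gS i r = u) :
    ReIso (T.comp S) U e where
  color := hc
  strEquiv :=
    { toFun := Quot.lift (Sum.elim fT fun p => fS p.1 p.2) (by rintro _ _ ⟨i, j⟩; exact f_glue i j)
      invFun := σ
      left_inv := by
        rintro ⟨s | ⟨i, s⟩⟩
        · exact σT s
        · exact σS i s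
      right_inv := fun u => by
        rcases f_surj u with ⟨s, rfl⟩ | ⟨i, s, rfl⟩
        · rw [σT]; rfl
        · rw [σS]; rfl }
  regEquiv :=
    { toFun := Quot.lift (Sum.elim gT fun p => gS p.1 p.2) (by rintro _ _ ⟨i, j⟩; exact g_glue i j)
      invFun := ρ
      left_inv := by
        rintro ⟨s | ⟨i, s⟩⟩
        · exact ρT s
        · exact ρS i s
      right_inv := fun u => by
        rcases g_surj u with ⟨s, rfl⟩ | ⟨i, s, rfl⟩
        · rw [ρT]; rfl
        · rw [ρS]; rfl }
  map_shade := by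
    rintro ⟨r | ⟨i, r⟩⟩
    · obtain ⟨b, j, rfl⟩ := hT.reg_surj r
      rcases b with _ | i
      · exact shade_of_boundary T U (b := none) (b' := none) rfl
          (fun j j' h => by obtain rfl := Fin.ext h; exact g_none j) j
      · exact (congrArg U.shade (g_glue i j)).trans ((shadeS i _).trans
          (((S i).shade_reg none j).trans (T.shade_reg (some i) j).symm))
    · exact shadeS i r
  map_side := by
    rintro ⟨s | ⟨i, s⟩⟩ w
    · obtain ⟨b, j, rfl⟩ := hT.str_surj s
      rcases b with _ | i
      · exact side_of_boundary T U (b := none) (b' := none) rfl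
          (fun j j' h => by obtain rfl := Fin.ext h; exact f_none j)
          (fun j j' h => by obtain rfl := Fin.ext h; exact g_none j) j w
      · show U.side (fT (T.str (some i) j)) w = gT (T.side (T.str (some i) j) w)
        rw [f_glue, sideS]
        by_cases hw : w = (c i).shadeAt j
        · rw [hw]
          exact (congrArg (gS i) ((S i).side_before none j)).trans
            ((g_glue i j.castSucc).symm.trans (congrArg gT (T.side_before (some i) j).symm))
        · have hw' : w = !(c i).shadeAt j := by
            cases w <;> cases h : (c i).shadeAt j <;> simp_all
          rw [hw']
          exact (congrArg (gS i) ((S i).side_after none j)).trans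
            ((g_glue i j.succ).symm.trans (congrArg gT (T.side_after (some i) j).symm))
    · exact sideS i s w
  map_str := by
    rintro (_ | k) j j' h
    · obtain rfl := Fin.ext h
      exact f_none j
    · exact f_some k j j' h
  map_reg := by
    rintro (_ | k) j j' h
    · obtain rfl := Fin.ext h
      exact g_none j
    · exact g_some k j j' h

end comp

/-- The gluing of strings in a composite. -/
theorem outerStr_eq {ι : Type} {κ : ι → Type} {c : ι → Colour} {d : (i : ι) → κ i → Colour}
    {c₀ : Colour} (T : PreTangle c c₀) (S : (i : ι) → PreTangle (d i) (c i)) (i : ι)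
    (j : (c i).Pt) :
    outerStr T S (T.str (some i) j) = innerStr T S i ((S i).str none j) :=
  Quot.sound (StrGlue.mk i j)

/-- The gluing of regions in a composite. -/
theorem outerReg_eq {ι : Type} {κ : ι → Type} {c : ι → Colour} {d : (i : ι) → κ i → Colour}
    {c₀ : Colour} (T : PreTangle c c₀) (S : (i : ι) → PreTangle (d i) (c i)) (i : ι)
    (j : (c i).Gap) :
    outerReg T S (T.reg (some i) j) = innerReg T S i ((S i).reg none j) :=
  Quot.sound (RegGlue.mk i j)

end PreTangle

namespace PlanarAlgebra

variable (P : PlanarAlgebra.{u})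

/-- The value of a tangle at given elements depends only on its isomorphism class.  The elements are
compared by `HEq`, as the colours of corresponding boxes agree only propositionally. -/
theorem Z_of_reIso {ι κ : Type} {c : ι → Colour} {c' : κ → Colour} {c₀ : Colour} {T : Tangle c c₀}
    {U : Tangle c' c₀} {e : κ ≃ ι} (h : PreTangle.ReIso T.toPreTangle U.toPreTangle e)
    (x : (i : ι) → P.V (c i)) (y : (k : κ) → P.V (c' k)) (hxy : ∀ k, HEq (y k) (x (e k))) :
    P.Z U y = P.Z T x := by
  obtain rfl : c' = c ∘ e := funext h.color
  obtain rfl : y = fun k => x (e k) := funext fun k => eq_of_heq (hxy k)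
  exact P.Z_reindex e T U h.nonempty_iso x

/-- The value of a tangle which has been identified with a composite. -/
theorem Z_of_reIso_comp {ι : Type} {κ : ι → Type} {κ' : Type} {c : ι → Colour}
    {d : (i : ι) → κ i → Colour} {c' : κ' → Colour} {c₀ : Colour} {T : Tangle c c₀}
    {S : (i : ι) → Tangle (d i) (c i)} {U : Tangle c' c₀} {e : κ' ≃ (i : ι) × κ i}
    (h : PreTangle.ReIso (T.comp fun i => (S i).toPreTangle) U.toPreTangle e)
    (x : (p : (i : ι) × κ i) → P.V (d p.1 p.2)) (y : (k : κ') → P.V (c' k))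
    (hxy : ∀ k, HEq (y k) (x (e k))) :
    P.Z U y = P.Z T (fun i => P.Z (S i) (fun j => x ⟨i, j⟩)) := by
  have hpl := h.isPlanar U.planar
  rw [← P.Z_comp T S ⟨_, hpl⟩ ⟨⟨Equiv.refl _, Equiv.refl _, fun _ => rfl, fun _ _ => rfl,
    fun _ _ => rfl, fun _ _ => rfl⟩⟩ x]
  exact P.Z_of_reIso (T := ⟨_, hpl⟩) h x y hxy

end PlanarAlgebra

/-! ### The annular identity, annuli turned inside out, and hanging boxes -/

namespace PreTangle

theorem eq_not_of_ne {a b : Bool} (h : ¬ a = b) : a = !b := by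
  cases a <;> cases b <;> simp_all

/-- The white and the black side of a strand whose neighbouring intervals are `s` and `s + 1`. -/
theorem shade_ite {R : Type} (shade : R → Bool) (c : Colour) (G : ℕ → R) {m : ℕ}
    (hG : ∀ j, j ≤ m → shade (G j) = c.shadeAt j) {s : ℕ} (hs : s < m) (w : Bool) :
    shade (G (if w = c.shadeAt s then s else s + 1)) = w := by
  split_ifs with h
  · rw [hG s hs.le, h]
  · rw [hG (s + 1) hs, shadeAt_succ, ← eq_not_of_ne h]

section ring

/-- The region at the `j`-th interval of a box with `2 * n` strands; `none` is the `*`-region. -/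
def ringReg (n j : ℕ) : Option (Fin (2 * n - 1)) :=
  if h : 0 < j ∧ j < 2 * n then some ⟨j - 1, by omega⟩ else none

theorem shade_ringReg (n j : ℕ) (hj : j ≤ 2 * n) :
    (ringReg n j).elim true (fun q => (Colour.nat n).shadeAt (q + 1)) =
      (Colour.nat n).shadeAt j := by
  unfold ringReg
  split_ifs with h
  · simp only [Option.elim_some]
    congr 1
    omega
  · have h' : j % 2 = 0 := by omega
    simp [Colour.shadeAt, Colour.white, h']

theorem ringReg_last (n : ℕ) : ringReg n (2 * n) = ringReg n 0 := by
  simp [ringReg]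

theorem ringReg_eq_iff {n i j : ℕ} (hi : i ≤ 2 * n) (hj : j ≤ 2 * n) :
    ringReg n i = ringReg n j ↔ i = j ∨ (i = 0 ∧ j = 2 * n) ∨ (i = 2 * n ∧ j = 0) := by
  unfold ringReg
  split_ifs <;> simp <;> omega

/-- An annulus with `2 * n` radial strands: the identity tangle of colour `n`, with one string for
each marked point and one region for each boundary interval. -/
def ringId (n : ℕ) : PreTangle (fun _ : Fin 1 => Colour.nat n) (.nat n) where
  Str := Fin (2 * n)
  Reg := Option (Fin (2 * n - 1))
  shade q := q.elim true (fun q => (Colour.nat n).shadeAt (q + 1))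
  side s w := ringReg n (if w = (Colour.nat n).shadeAt s then s else s + 1)
  str
    | none => fun j => j
    | some _ => fun j => j
  reg
    | none => fun j => ringReg n j
    | some _ => fun j => ringReg n j
  shade_side s w := shade_ite
    (fun q : Option (Fin (2 * n - 1)) => q.elim true (fun q => (Colour.nat n).shadeAt (q + 1)))
    (.nat n) (ringReg n) (shade_ringReg n) s.2 w
  shade_reg
    | none => fun j => shade_ringReg n j (Nat.le_of_lt_succ j.2)
    | some _ => fun j => shade_ringReg n j (Nat.le_of_lt_succ j.2)
  reg_last
    | none => ringReg_last n
    | some _ => ringReg_last n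
  side_before
    | none => fun _ => congrArg (ringReg n) (if_pos rfl)
    | some _ => fun _ => congrArg (ringReg n) (if_pos rfl)
  side_after
    | none => fun _ => congrArg (ringReg n) (if_neg (Bool.not_ne_self _))
    | some _ => fun _ => congrArg (ringReg n) (if_neg (Bool.not_ne_self _))

theorem ringReg_surj (n : ℕ) (r : Option (Fin (2 * n - 1))) :
    ∃ j : Fin (2 * n + 1), ringReg n j = r := by
  rcases r with _ | q
  · exact ⟨0, by simp [ringReg]⟩
  · refine ⟨⟨q + 1, by omega⟩, ?_⟩
    have : (q : ℕ) + 1 < 2 * n := by omega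
    simp [ringReg, this]

theorem ringId_tight (n : ℕ) : (ringId n).Tight where
  str_surj := fun s : Fin (2 * n) => ⟨none, s, rfl⟩
  reg_surj := fun r : Option (Fin (2 * n - 1)) => ⟨none, ringReg_surj n r⟩

end ring

section insideOut

/-- Exchange the roles of the external box and of the only internal box. -/
def insideOut {a b : Colour} (T : PreTangle (fun _ : Fin 1 => a) b) :
    PreTangle (fun _ : Fin 1 => b) a where
  Str := T.Str
  Reg := T.Reg
  shade := T.shade
  side := T.side
  str
    | none => T.str (some 0)
    | some _ => T.str none
  reg
    | none => T.reg (some 0)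
    | some _ => T.reg none
  shade_side := T.shade_side
  shade_reg
    | none => T.shade_reg (some 0)
    | some _ => T.shade_reg none
  reg_last
    | none => T.reg_last (some 0)
    | some _ => T.reg_last none
  side_before
    | none => T.side_before (some 0)
    | some _ => T.side_before none
  side_after
    | none => T.side_after (some 0)
    | some _ => T.side_after none

theorem leaves_none_eq {ι : Type} (i : ι) (j : ℕ) :
    leaves (none : Option ι) j = !leaves (some i) j := by
  rcases Nat.mod_two_eq_zero_or_one j with h | h <;> simp [leaves, h]

theorem insideOut_isPlanar {a b : Colour} {T : PreTangle (fun _ : Fin 1 => a) b}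
    (hT : T.IsPlanar) : T.insideOut.IsPlanar := by
  have lift : ∀ E : T.insideOut.End, ∃ E' : T.End, T.insideOut.str E.1 E.2 = T.str E'.1 E'.2 ∧
      leaves E.1 E.2 = !leaves E'.1 E'.2 ∧ ((E.1 = none ↔ E'.1 ≠ none) ∧ (E.2 : ℕ) = E'.2) := by
    rintro ⟨_ | i, j⟩
    · exact ⟨⟨some 0, j⟩, rfl, leaves_none_eq _ _, by simp, rfl⟩
    · exact ⟨⟨none, j⟩, rfl, by rw [leaves_none_eq i]; simp, by simp, rfl⟩
  have push : ∀ E' : T.End, ∃ E : T.insideOut.End, T.insideOut.str E.1 E.2 = T.str E'.1 E'.2 ∧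
      leaves E.1 E.2 = !leaves E'.1 E'.2 := by
    rintro ⟨_ | i, j⟩
    · refine ⟨⟨some 0, j⟩, rfl, by rw [leaves_none_eq 0]; simp⟩
    · obtain rfl : i = 0 := Subsingleton.elim _ _
      exact ⟨⟨none, j⟩, rfl, leaves_none_eq _ _⟩
  refine ⟨hT.finite_box, hT.finite_str, hT.finite_reg, ?_, ?_, hT.connected, ?_⟩
  · intro E₁ E₂ hs hl
    obtain ⟨F₁, hs₁, hl₁, hb₁, hj₁⟩ := lift E₁
    obtain ⟨F₂, hs₂, hl₂, hb₂, hj₂⟩ := lift E₂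
    have := hT.end_unique F₁ F₂ (by rw [← hs₁, ← hs₂, hs])
      (Bool.not_inj (hl₁.symm.trans (hl.trans hl₂)))
    subst this
    obtain ⟨b₁, j₁⟩ := E₁
    obtain ⟨b₂, j₂⟩ := E₂
    have hb : b₁ = b₂ := by
      rcases b₁ with _ | i <;> rcases b₂ with _ | i'
      · rfl
      · simp_all
      · simp_all
      · rw [Subsingleton.elim i i']
    subst hb
    obtain rfl : j₁ = j₂ := Fin.ext (hj₁.trans hj₂.symm)
    rfl
  · intro E
    obtain ⟨F, hs, hl, -⟩ := lift E
    obtain ⟨F', hs', hl'⟩ := hT.end_partner F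
    obtain ⟨E', hs'', hl''⟩ := push F'
    refine ⟨E', by rw [hs'', hs', hs], ?_⟩
    rw [hl'', hl]
    simpa using hl'
  · have hq : Nat.card (Quot T.Joined) = Nat.card (Quot T.insideOut.Joined) := by
      refine Nat.card_congr (Quot.congr (Equiv.swap none (some 0)) ?_)
      have hsw : ∀ i : Fin 1, Equiv.swap (none : Option (Fin 1)) (some 0) (some i) = none := by
        intro i
        rw [Subsingleton.elim i 0]
        simp
      have hsn : Equiv.swap (none : Option (Fin 1)) (some 0) none = some 0 := by simp
      rintro (_ | i) (_ | i')
      · rw [hsn]; exact Iff.rfl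
      · rw [hsn, hsw, Subsingleton.elim i' 0]; exact Iff.rfl
      · rw [hsn, hsw, Subsingleton.elim i 0]; exact Iff.rfl
      · rw [hsw, hsw, Subsingleton.elim i 0, Subsingleton.elim i' 0]; exact Iff.rfl
    rw [← hq]
    exact hT.euler

theorem insideOut_tight {a b : Colour} {T : PreTangle (fun _ : Fin 1 => a) b} (hT : T.Tight) :
    T.insideOut.Tight where
  str_surj s := by
    obtain ⟨_ | i, j, rfl⟩ := hT.str_surj s
    · exact ⟨some 0, j, rfl⟩
    · obtain rfl : i = 0 := Subsingleton.elim _ _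
      exact ⟨none, j, rfl⟩
  reg_surj s := by
    obtain ⟨_ | i, j, rfl⟩ := hT.reg_surj s
    · exact ⟨some 0, j, rfl⟩
    · obtain rfl : i = 0 := Subsingleton.elim _ _
      exact ⟨none, j, rfl⟩

end insideOut

section capTight

variable {ι : Type} {c : ι → Colour} {n : ℕ}

theorem addCap_tight {T : PreTangle c (.nat n)} (hT : T.Tight) {p : ℕ} (hp : p ≤ 2 * n) :
    (T.addCap p hp).Tight where
  str_surj := by
    rintro (_ | s)
    · refine ⟨none, (⟨p, by omega⟩ : Fin (2 * (n + 1))), ?_⟩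
      show capStr T p hp (⟨p, by omega⟩ : Fin (2 * (n + 1))) = none
      simp [capStr]
    · obtain ⟨_ | i, j, rfl⟩ := hT.str_surj s
      · have hj : (j : ℕ) < 2 * n := j.2
        by_cases h : (j : ℕ) < p
        · refine ⟨none, (⟨j, by omega⟩ : Fin (2 * (n + 1))), ?_⟩
          show capStr T p hp (⟨j, by omega⟩ : Fin (2 * (n + 1))) = _
          simp [capStr, h]
          rfl
        · refine ⟨none, (⟨j + 2, by omega⟩ : Fin (2 * (n + 1))), ?_⟩
          show capStr T p hp (⟨j + 2, by omega⟩ : Fin (2 * (n + 1))) = _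
          have h1 : ¬ (j : ℕ) + 2 < p := by omega
          simp [capStr, h, h1]
          rfl
      · exact ⟨some i, j, rfl⟩
  reg_surj := by
    rintro (_ | s)
    · refine ⟨none, (⟨p + 1, by omega⟩ : Fin (2 * (n + 1) + 1)), ?_⟩
      show capReg T p hp (⟨p + 1, by omega⟩ : Fin (2 * (n + 1) + 1)) = none
      simp [capReg]
    · obtain ⟨_ | i, j, rfl⟩ := hT.reg_surj s
      · have hj : (j : ℕ) < 2 * n + 1 := j.2
        by_cases h : (j : ℕ) ≤ p
        · refine ⟨none, (⟨j, by omega⟩ : Fin (2 * (n + 1) + 1)), ?_⟩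
          show capReg T p hp (⟨j, by omega⟩ : Fin (2 * (n + 1) + 1)) = _
          simp [capReg, h]
          rfl
        · refine ⟨none, (⟨j + 2, by omega⟩ : Fin (2 * (n + 1) + 1)), ?_⟩
          show capReg T p hp (⟨j + 2, by omega⟩ : Fin (2 * (n + 1) + 1)) = _
          have h1 : ¬ (j : ℕ) + 2 ≤ p := by omega
          have h2 : ¬ (j : ℕ) + 2 = p + 1 := by omega
          simp [capReg, h1, h2]
          rfl
      · exact ⟨some i, j, rfl⟩

end capTight

section hang

variable {κ : Type} {d : κ → Colour} {D : ℕ}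

/-- The strand at the `j`-th external point when an `n`-box is hung below `S`. -/
def hangOut (S : PreTangle d (.nat D)) (n : ℕ) (j : Fin (2 * n)) : S.Str ⊕ Fin (2 * n - D) :=
  if h : (j : ℕ) < D then Sum.inl (S.str none (⟨j, by omega⟩ : Fin (2 * D)))
  else Sum.inr ⟨j - D, by omega⟩

/-- The strand at the `j`-th point of the `n`-box hung below `S`. -/
def hangIn (S : PreTangle d (.nat D)) (n : ℕ) (j : Fin (2 * n)) : S.Str ⊕ Fin (2 * n - D) :=
  if h : (j : ℕ) < D then Sum.inl (S.str none (⟨2 * D - 1 - j, by omega⟩ : Fin (2 * D)))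
  else Sum.inr ⟨j - D, by omega⟩

/-- The region at the `j`-th external interval when an `n`-box is hung below `S`. -/
def hangOutReg (S : PreTangle d (.nat D)) (n j : ℕ) : S.Reg ⊕ Fin (2 * n - 1 - D) :=
  if h : j ≤ D then Sum.inl (S.reg none (⟨j, by omega⟩ : Fin (2 * D + 1)))
  else if h' : j < 2 * n then Sum.inr ⟨j - D - 1, by omega⟩
  else Sum.inl (S.reg none (0 : Fin (2 * D + 1)))

/-- The region at the `j`-th interval of the `n`-box hung below `S`. -/
def hangInReg (S : PreTangle d (.nat D)) (n j : ℕ) : S.Reg ⊕ Fin (2 * n - 1 - D) :=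
  if h : j ≤ D then Sum.inl (S.reg none (⟨2 * D - j, by omega⟩ : Fin (2 * D + 1)))
  else if h' : j < 2 * n then Sum.inr ⟨j - D - 1, by omega⟩
  else Sum.inl (S.reg none (0 : Fin (2 * D + 1)))

theorem hangInReg_eq (S : PreTangle d (.nat D)) (n : ℕ) {j : ℕ} (hj : D ≤ j) :
    hangInReg S n j = hangOutReg S n j := by
  unfold hangInReg hangOutReg
  split_ifs
  · congr 3
    omega
  · rfl
  · rfl

/-- The shading when an `n`-box is hung below `S`. -/
def hangShade (S : PreTangle d (.nat D)) (n : ℕ) : S.Reg ⊕ Fin (2 * n - 1 - D) → Bool :=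
  Sum.elim S.shade (fun q => (Colour.nat n).shadeAt (q + D + 1))

theorem shade_hangOutReg (S : PreTangle d (.nat D)) (n : ℕ) {j : ℕ} (hj : j ≤ 2 * n) :
    hangShade S n (hangOutReg S n j) = (Colour.nat n).shadeAt j := by
  unfold hangOutReg
  split_ifs with h h'
  · exact S.shade_reg none (⟨j, by omega⟩ : Fin (2 * D + 1))
  · simp only [hangShade, Sum.elim_inr]
    congr 1
    omega
  · exact (S.shade_reg none (0 : Fin (2 * D + 1))).trans (shadeAt_congr (.nat n) (by simp; omega))

theorem shade_hangInReg (S : PreTangle d (.nat D)) (n : ℕ) {j : ℕ} (hj : j ≤ 2 * n) :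
    hangShade S n (hangInReg S n j) = (Colour.nat n).shadeAt j := by
  by_cases h : D ≤ j
  · rw [hangInReg_eq S n h, shade_hangOutReg S n hj]
  · have h' : j ≤ D := by omega
    simp only [hangInReg, h', dite_true]
    exact (S.shade_reg none (⟨2 * D - j, by omega⟩ : Fin (2 * D + 1))).trans
      (shadeAt_congr (.nat n) (by simp only; omega))

/-- The regions along a string when an `n`-box is hung below `S`. -/
def hangSide (S : PreTangle d (.nat D)) (n : ℕ) (s : S.Str ⊕ Fin (2 * n - D)) (w : Bool) :
    S.Reg ⊕ Fin (2 * n - 1 - D) :=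
  s.elim (fun s => Sum.inl (S.side s w)) (fun q : Fin (2 * n - D) =>
    hangOutReg S n (if w = (Colour.nat n).shadeAt ((q : ℕ) + D) then (q : ℕ) + D else q + D + 1))

theorem hangSide_before (S : PreTangle d (.nat D)) (n : ℕ) (j : Fin (2 * n)) :
    hangSide S n (hangOut S n j) ((Colour.nat n).shadeAt j) = hangOutReg S n j := by
  unfold hangOut
  split_ifs with h
  · simp only [hangSide, Sum.elim_inl, hangOutReg, h.le, dite_true]
    exact congrArg Sum.inl (S.side_before none (⟨j, by omega⟩ : Fin (2 * D)))
  · have e : (j : ℕ) - D + D = j := by omega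
    simp [hangSide, e]

theorem hangSide_after (S : PreTangle d (.nat D)) (n : ℕ) (j : Fin (2 * n)) :
    hangSide S n (hangOut S n j) (!(Colour.nat n).shadeAt j) = hangOutReg S n (j + 1) := by
  unfold hangOut
  split_ifs with h
  · have h1 : (j : ℕ) + 1 ≤ D := h
    simp only [hangSide, Sum.elim_inl, hangOutReg, h1, dite_true]
    exact congrArg Sum.inl (S.side_after none (⟨j, by omega⟩ : Fin (2 * D)))
  · have e : (j : ℕ) - D + D = j := by omega
    simp [hangSide, e]

theorem hangSide_in_before (S : PreTangle d (.nat D)) (n : ℕ) (j : Fin (2 * n)) :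
    hangSide S n (hangIn S n j) ((Colour.nat n).shadeAt j) = hangInReg S n j := by
  unfold hangIn
  split_ifs with h
  · simp only [hangSide, Sum.elim_inl, hangInReg, h.le, dite_true]
    have e := S.side_after none (⟨2 * D - 1 - j, by omega⟩ : Fin (2 * D))
    have e' : (!(boxColour d (.nat D) none).shadeAt
        ((⟨2 * D - 1 - j, by omega⟩ : Fin (2 * D)) : ℕ)) = (Colour.nat n).shadeAt j :=
      (shadeAt_opp (.nat n) (by simp only; omega)).symm
    rw [e'] at e
    refine congrArg Sum.inl (e.trans ?_)
    congr 1
    ext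
    show 2 * D - 1 - (j : ℕ) + 1 = 2 * D - j
    omega
  · have e : (j : ℕ) - D + D = j := by omega
    rw [hangInReg_eq S n (by omega)]
    simp [hangSide, e]

theorem hangSide_in_after (S : PreTangle d (.nat D)) (n : ℕ) (j : Fin (2 * n)) :
    hangSide S n (hangIn S n j) (!(Colour.nat n).shadeAt j) = hangInReg S n (j + 1) := by
  unfold hangIn
  split_ifs with h
  · have h1 : (j : ℕ) + 1 ≤ D := h
    simp only [hangSide, Sum.elim_inl, hangInReg, h1, dite_true]
    have e := S.side_before none (⟨2 * D - 1 - j, by omega⟩ : Fin (2 * D))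
    have e' : (boxColour d (.nat D) none).shadeAt
        ((⟨2 * D - 1 - j, by omega⟩ : Fin (2 * D)) : ℕ) = !(Colour.nat n).shadeAt j :=
      shadeAt_opp (.nat n) (by simp only; omega)
    rw [e'] at e
    refine congrArg Sum.inl (e.trans ?_)
    congr 1
    ext
    show 2 * D - 1 - (j : ℕ) = 2 * D - (j + 1)
    omega
  · have e : (j : ℕ) - D + D = j := by omega
    rw [hangInReg_eq S n (by omega)]
    simp [hangSide, e]

/-- Hang an `n`-box (the box `none`) below the diagram `S`: the points `0, …, D - 1` of that box are
joined to the lower points of `S`, the points `0, …, D - 1` of the external box to the upper points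
of `S`, and the remaining points of the two boxes to each other.  For `D = 0` this puts the closed
diagram `S` into the `*`-region of an identity tangle. -/
def hang (S : PreTangle d (.nat D)) (n : ℕ) (hn : D < 2 * n) :
    PreTangle (boxColour d (.nat n)) (.nat n) where
  Str := S.Str ⊕ Fin (2 * n - D)
  Reg := S.Reg ⊕ Fin (2 * n - 1 - D)
  shade := hangShade S n
  side := hangSide S n
  str
    | none => hangOut S n
    | some none => hangIn S n
    | some (some k) => fun j => Sum.inl (S.str (some k) j)
  reg
    | none => fun j => hangOutReg S n j
    | some none => fun j => hangInReg S n j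
    | some (some k) => fun j => Sum.inl (S.reg (some k) j)
  shade_side := by
    rintro (s | q) w
    · exact S.shade_side s w
    · exact shade_ite (hangShade S n) (.nat n) (hangOutReg S n)
        (fun j => shade_hangOutReg S n) (by omega : (q : ℕ) + D < 2 * n) w
  shade_reg
    | none => fun j => shade_hangOutReg S n (Nat.le_of_lt_succ j.2)
    | some none => fun j => shade_hangInReg S n (Nat.le_of_lt_succ j.2)
    | some (some k) => S.shade_reg (some k)
  reg_last
    | none => by
      show hangOutReg S n (2 * n) = hangOutReg S n 0
      have h : ¬ 2 * n ≤ D := by omega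
      simp [hangOutReg, h]
    | some none => by
      show hangInReg S n (2 * n) = hangInReg S n 0
      have h : ¬ 2 * n ≤ D := by omega
      simp only [hangInReg, h, dite_false, lt_self_iff_false, zero_le, dite_true]
      exact congrArg Sum.inl (S.reg_last none).symm
    | some (some k) => congrArg Sum.inl (S.reg_last (some k))
  side_before
    | none => hangSide_before S n
    | some none => hangSide_in_before S n
    | some (some k) => fun j => congrArg Sum.inl (S.side_before (some k) j)
  side_after
    | none => hangSide_after S n
    | some none => hangSide_in_after S n
    | some (some k) => fun j => congrArg Sum.inl (S.side_after (some k) j)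

theorem hang_tight {S : PreTangle d (.nat D)} (hS : S.Tight) (n : ℕ) (hn : D < 2 * n)
    (hD : D ≤ n) : (S.hang n hn).Tight where
  str_surj := by
    rintro (s | q)
    · obtain ⟨_ | k, j, rfl⟩ := hS.str_surj s
      · have hj : (j : ℕ) < 2 * D := j.2
        by_cases h : (j : ℕ) < D
        · refine ⟨none, (⟨j, by omega⟩ : Fin (2 * n)), ?_⟩
          show hangOut S n _ = _
          simp [hangOut, h]
          rfl
        · refine ⟨some none, (⟨2 * D - 1 - j, by omega⟩ : Fin (2 * n)), ?_⟩
          show hangIn S n _ = _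
          have h1 : 2 * D - 1 - (j : ℕ) < D := by omega
          have h2 : 2 * D - 1 - (2 * D - 1 - (j : ℕ)) = j := by omega
          simp [hangIn, h1, h2]
          rfl
      · exact ⟨some (some k), j, rfl⟩
    · refine ⟨none, (⟨q + D, by omega⟩ : Fin (2 * n)), ?_⟩
      show hangOut S n _ = _
      simp [hangOut]
  reg_surj := by
    rintro (r | q)
    · obtain ⟨_ | k, j, rfl⟩ := hS.reg_surj r
      · have hj : (j : ℕ) < 2 * D + 1 := j.2
        by_cases h : (j : ℕ) ≤ D
        · refine ⟨none, (⟨j, by omega⟩ : Fin (2 * n + 1)), ?_⟩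
          show hangOutReg S n _ = _
          simp [hangOutReg, h]
          rfl
        · refine ⟨some none, (⟨2 * D - j, by omega⟩ : Fin (2 * n + 1)), ?_⟩
          show hangInReg S n _ = _
          have h1 : 2 * D - (j : ℕ) ≤ D := by omega
          have h2 : 2 * D - (2 * D - (j : ℕ)) = j := by omega
          simp only [hangInReg, h1, h2, dite_true]
          rfl
      · exact ⟨some (some k), j, rfl⟩
    · refine ⟨none, (⟨q + D + 1, by omega⟩ : Fin (2 * n + 1)), ?_⟩
      show hangOutReg S n _ = _
      have h1 : ¬ (q : ℕ) + D + 1 ≤ D := by omega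
      have h2 : (q : ℕ) + D + 1 < 2 * n := by omega
      simp only [hangOutReg, h1, h2, dite_false, dite_true]
      congr 1
      ext
      simp only
      omega

/-- The end of the diagram with an `n`-box hung below `S` which lies on the continuation of a given
end of `S`. -/
def hangEnd (S : PreTangle d (.nat D)) (n : ℕ) (hn : D < 2 * n) (hD : D ≤ n) :
    S.End → (S.hang n hn).End
  | ⟨none, j⟩ =>
    have hj : (j : ℕ) < 2 * D := j.2
    if h : (j : ℕ) < D then ⟨none, (⟨j, by omega⟩ : Fin (2 * n))⟩
    else ⟨some none, (⟨2 * D - 1 - j, by omega⟩ : Fin (2 * n))⟩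
  | ⟨some k, j⟩ => ⟨some (some k), j⟩

theorem hangEnd_of_lt (S : PreTangle d (.nat D)) (n : ℕ) (hn : D < 2 * n) (hD : D ≤ n)
    (j : Fin (2 * D)) (h : (j : ℕ) < D) :
    hangEnd S n hn hD ⟨none, j⟩ = ⟨none, (⟨j, by omega⟩ : Fin (2 * n))⟩ := by
  simp [hangEnd, h]

theorem hangEnd_of_ge (S : PreTangle d (.nat D)) (n : ℕ) (hn : D < 2 * n) (hD : D ≤ n)
    (j : Fin (2 * D)) (h : ¬ (j : ℕ) < D) :
    hangEnd S n hn hD ⟨none, j⟩ = ⟨some none, (⟨2 * D - 1 - j, by omega⟩ : Fin (2 * n))⟩ := by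
  simp [hangEnd, h]

theorem str_hangEnd (S : PreTangle d (.nat D)) (n : ℕ) (hn : D < 2 * n) (hD : D ≤ n) (E : S.End) :
    (S.hang n hn).str (hangEnd S n hn hD E).1 (hangEnd S n hn hD E).2 =
      (Sum.inl (S.str E.1 E.2) : S.Str ⊕ Fin (2 * n - D)) := by
  obtain ⟨_ | k, j⟩ := E
  · have hj : (j : ℕ) < 2 * D := j.2
    by_cases h : (j : ℕ) < D
    · rw [hangEnd_of_lt S n hn hD j h]
      show hangOut S n _ = _
      simp [hangOut, h]
      rfl
    · rw [hangEnd_of_ge S n hn hD j h]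
      show hangIn S n _ = _
      have h1 : 2 * D - 1 - (j : ℕ) < D := by omega
      have h2 : 2 * D - 1 - (2 * D - 1 - (j : ℕ)) = j := by omega
      simp [hangIn, h1, h2]
      rfl
  · rfl

theorem leaves_hangEnd (S : PreTangle d (.nat D)) (n : ℕ) (hn : D < 2 * n) (hD : D ≤ n)
    (E : S.End) :
    leaves (hangEnd S n hn hD E).1 (hangEnd S n hn hD E).2 = leaves E.1 E.2 := by
  obtain ⟨_ | k, j⟩ := E
  · have hj : (j : ℕ) < 2 * D := j.2
    by_cases h : (j : ℕ) < D
    · rw [hangEnd_of_lt S n hn hD j h]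
      rfl
    · rw [hangEnd_of_ge S n hn hD j h]
      simp only [leaves, decide_eq_decide]
      omega
  · rfl

/-- An end of a diagram with a box hung below `S` comes from an end of `S` or lies on a strand which
joins that box straight to the external one. -/
theorem hang_end_cases (S : PreTangle d (.nat D)) (n : ℕ) (hn : D < 2 * n) (hD : D ≤ n)
    (E : (S.hang n hn).End) :
    (∃ E', E = hangEnd S n hn hD E') ∨
      ∃ j : Fin (2 * n), D ≤ (j : ℕ) ∧ (E = ⟨none, j⟩ ∨ E = ⟨some none, j⟩) := by
  obtain ⟨_ | _ | k, j⟩ := E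
  · have hj : (j : ℕ) < 2 * n := j.2
    by_cases h : (j : ℕ) < D
    · refine Or.inl ⟨⟨none, (⟨j, by omega⟩ : Fin (2 * D))⟩, ?_⟩
      simp [hangEnd, h]
      rfl
    · exact Or.inr ⟨j, by omega, Or.inl rfl⟩
  · have hj : (j : ℕ) < 2 * n := j.2
    by_cases h : (j : ℕ) < D
    · refine Or.inl ⟨⟨none, (⟨2 * D - 1 - j, by omega⟩ : Fin (2 * D))⟩, ?_⟩
      have h1 : ¬ 2 * D - 1 - (j : ℕ) < D := by omega
      have h2 : 2 * D - 1 - (2 * D - 1 - (j : ℕ)) = j := by omega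
      simp [hangEnd, h1, h2]
      rfl
    · exact Or.inr ⟨j, by omega, Or.inr rfl⟩
  · exact Or.inl ⟨⟨some k, j⟩, rfl⟩

theorem hang_str_straight (S : PreTangle d (.nat D)) (n : ℕ) (hn : D < 2 * n)
    (j : Fin (2 * n)) (h : D ≤ (j : ℕ)) :
    (S.hang n hn).str none j = (Sum.inr ⟨j - D, by omega⟩ : S.Str ⊕ Fin (2 * n - D)) ∧
    (S.hang n hn).str (some none) j = (Sum.inr ⟨j - D, by omega⟩ : S.Str ⊕ Fin (2 * n - D)) := by
  have h' : ¬ (j : ℕ) < D := by omega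
  constructor
  · show hangOut S n j = _
    simp [hangOut, h']
  · show hangIn S n j = _
    simp [hangIn, h']

theorem hang_isPlanar {S : PreTangle d (.nat D)} (hS : S.IsPlanar) (n : ℕ) (hn : D < 2 * n)
    (hD : D ≤ n) : (S.hang n hn).IsPlanar where
  finite_box := by
    have := hS.finite_box
    infer_instance
  finite_str := by
    have := hS.finite_str
    exact inferInstanceAs (Finite (S.Str ⊕ Fin (2 * n - D)))
  finite_reg := by
    have := hS.finite_reg
    exact inferInstanceAs (Finite (S.Reg ⊕ Fin (2 * n - 1 - D)))
  end_unique := by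
    intro E₁ E₂ hs hl
    rcases hang_end_cases S n hn hD E₁ with ⟨F₁, rfl⟩ | ⟨j₁, hj₁, h₁⟩ <;>
      rcases hang_end_cases S n hn hD E₂ with ⟨F₂, rfl⟩ | ⟨j₂, hj₂, h₂⟩
    · rw [str_hangEnd, str_hangEnd] at hs
      rw [leaves_hangEnd, leaves_hangEnd] at hl
      rw [hS.end_unique F₁ F₂ (Sum.inl.inj hs) hl]
    · obtain ⟨e₁, e₂⟩ := hang_str_straight S n hn j₂ hj₂
      rcases h₂ with rfl | rfl
      · rw [str_hangEnd, e₁] at hs; cases hs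
      · rw [str_hangEnd, e₂] at hs; cases hs
    · obtain ⟨e₁, e₂⟩ := hang_str_straight S n hn j₁ hj₁
      rcases h₁ with rfl | rfl
      · rw [str_hangEnd, e₁] at hs; cases hs
      · rw [str_hangEnd, e₂] at hs; cases hs
    · obtain ⟨e₁, e₂⟩ := hang_str_straight S n hn j₁ hj₁
      obtain ⟨e₃, e₄⟩ := hang_str_straight S n hn j₂ hj₂
      have key : (j₁ : ℕ) - D = j₂ - D → j₁ = j₂ := fun h => Fin.ext (by omega)
      rcases h₁ with rfl | rfl <;> rcases h₂ with rfl | rfl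
      · rw [e₁, e₃] at hs
        rw [key (congrArg Fin.val (Sum.inr.inj hs))]
      · rw [e₁, e₄] at hs
        obtain rfl := key (congrArg Fin.val (Sum.inr.inj hs))
        simp only [leaves, decide_eq_decide] at hl
        omega
      · rw [e₂, e₃] at hs
        obtain rfl := key (congrArg Fin.val (Sum.inr.inj hs))
        simp only [leaves, decide_eq_decide] at hl
        omega
      · rw [e₂, e₄] at hs
        rw [key (congrArg Fin.val (Sum.inr.inj hs))]
  end_partner := by
    intro E
    rcases hang_end_cases S n hn hD E with ⟨F, rfl⟩ | ⟨j, hj, h⟩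
    · obtain ⟨F', h1, h2⟩ := hS.end_partner F
      refine ⟨hangEnd S n hn hD F', ?_, ?_⟩
      · rw [str_hangEnd, str_hangEnd, h1]
      · rw [leaves_hangEnd, leaves_hangEnd]
        exact h2
    · obtain ⟨e₁, e₂⟩ := hang_str_straight S n hn j hj
      rcases h with rfl | rfl
      · refine ⟨⟨some none, j⟩, e₂.trans e₁.symm, ?_⟩
        simp only [leaves, ne_eq, decide_eq_decide]
        omega
      · refine ⟨⟨none, j⟩, e₁.trans e₂.symm, ?_⟩
        simp only [leaves, ne_eq, decide_eq_decide]
        omega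
  connected := by
    have old : ∀ r r' : S.Reg, Relation.EqvGen S.Adjacent r r' →
        Relation.EqvGen (S.hang n hn).Adjacent (Sum.inl r : S.Reg ⊕ Fin (2 * n - 1 - D))
          (Sum.inl r' : S.Reg ⊕ Fin (2 * n - 1 - D)) := by
      intro r r' h
      induction h with
      | rel _ _ h =>
        obtain ⟨s, rfl, rfl⟩ := h
        exact Relation.EqvGen.rel _ _ ⟨(Sum.inl s : S.Str ⊕ Fin (2 * n - D)), rfl, rfl⟩
      | refl => exact Relation.EqvGen.refl _
      | symm _ _ _ ih => exact Relation.EqvGen.symm _ _ ih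
      | trans _ _ _ _ _ ih ih' => exact Relation.EqvGen.trans _ _ _ ih ih'
    have key : ∀ q, D + q ≤ 2 * n → Relation.EqvGen (S.hang n hn).Adjacent
        (hangOutReg S n (D + q)) (hangOutReg S n D) := by
      intro q
      induction q with
      | zero => exact fun _ => Relation.EqvGen.refl _
      | succ q ih =>
        intro hq
        refine Relation.EqvGen.trans _ _ _ ?_ (ih (by omega))
        have h := eqvGen_side (S.hang n hn) (Sum.inr ⟨q, by omega⟩ : S.Str ⊕ Fin (2 * n - D))
          (!(Colour.nat n).shadeAt (q + D)) ((Colour.nat n).shadeAt (q + D))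
        rw [show D + (q + 1) = q + D + 1 by omega, show D + q = q + D by omega]
        simpa [hang, hangSide] using h
    have all : ∀ r : S.Reg ⊕ Fin (2 * n - 1 - D), Relation.EqvGen (S.hang n hn).Adjacent r
        (hangOutReg S n D) := by
      rintro (r | q)
      · have : hangOutReg S n D = Sum.inl (S.reg none (⟨D, by omega⟩ : Fin (2 * D + 1))) := by
          simp [hangOutReg]
        rw [this]
        exact old _ _ (hS.connected _ _)
      · have h := key (q + 1) (by omega)
        have h2 : D + ((q : ℕ) + 1) < 2 * n := by omega
        have h3 : D + ((q : ℕ) + 1) - D - 1 = q := by omega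
        simpa [hangOutReg, h2, h3] using h
    exact fun r r' => Relation.EqvGen.trans _ _ _ (all r) (Relation.EqvGen.symm _ _ (all r'))
  euler := by
    have := hS.finite_box
    have := hS.finite_str
    have := hS.finite_reg
    have hb : Nat.card (Option κ) = Nat.card κ + 1 := Finite.card_option
    have hs : Nat.card (S.hang n hn).Str = Nat.card S.Str + (2 * n - D) := by
      show Nat.card (S.Str ⊕ Fin (2 * n - D)) = _
      simp [Nat.card_sum]
    have hr : Nat.card (S.hang n hn).Reg = Nat.card S.Reg + (2 * n - 1 - D) := by
      show Nat.card (S.Reg ⊕ Fin (2 * n - 1 - D)) = _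
      simp [Nat.card_sum]
    -- the new box is in the component of the external one
    let π : Option (Option κ) → Option κ := fun b => b.elim none id
    have base : (S.hang n hn).Joined none (some none) := by
      obtain ⟨e₁, e₂⟩ := hang_str_straight S n hn ⟨D, hn⟩ le_rfl
      exact ⟨_, _, e₁.trans e₂.symm⟩
    have hπ : ∀ E, π (hangEnd S n hn hD E).1 = E.1 := by
      rintro ⟨_ | k, j⟩
      · by_cases h : (j : ℕ) < D
        · rw [hangEnd_of_lt S n hn hD j h]
          rfl
        · rw [hangEnd_of_ge S n hn hD j h]
          rfl
      · rfl
    have down : ∀ b b', (S.hang n hn).Joined b b' →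
        Quot.mk S.Joined (π b) = Quot.mk S.Joined (π b') := by
      rintro b b' ⟨j, j', h⟩
      have h1 : ∀ (b : Option (Option κ)) (j : _), (∃ E, (⟨b, j⟩ : (S.hang n hn).End) =
          hangEnd S n hn hD E) ∨ (π b = none ∧ ∃ q,
            (S.hang n hn).str b j = (Sum.inr q : S.Str ⊕ Fin (2 * n - D))) := by
        intro b j
        rcases hang_end_cases S n hn hD ⟨b, j⟩ with h | ⟨i, hi, h | h⟩
        · exact Or.inl h
        · cases h
          exact Or.inr ⟨rfl, _, (hang_str_straight S n hn i hi).1⟩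
        · cases h
          exact Or.inr ⟨rfl, _, (hang_str_straight S n hn i hi).2⟩
      rcases h1 b j with ⟨E, hE⟩ | ⟨hb, q, hq⟩ <;> rcases h1 b' j' with ⟨E', hE'⟩ | ⟨hb', q', hq'⟩
      · have e₁ := hπ E
        have e₂ := hπ E'
        have s₁ := str_hangEnd S n hn hD E
        have s₂ := str_hangEnd S n hn hD E'
        rw [← hE] at e₁ s₁
        rw [← hE'] at e₂ s₂
        simp only at e₁ e₂ s₁ s₂
        rw [e₁, e₂]
        exact Quot.sound ⟨E.2, E'.2, Sum.inl.inj (s₁.symm.trans (h.trans s₂))⟩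
      · have s₁ := str_hangEnd S n hn hD E
        rw [← hE] at s₁
        have := s₁.symm.trans (h.trans hq')
        cases this
      · have s₂ := str_hangEnd S n hn hD E'
        rw [← hE'] at s₂
        have := s₂.symm.trans (h.symm.trans hq)
        cases this
      · rw [hb, hb']
    have up : ∀ b b', S.Joined b b' → Quot.mk (S.hang n hn).Joined (b.map some) =
        Quot.mk (S.hang n hn).Joined (b'.map some) := by
      have aux : ∀ E : S.End, Quot.mk (S.hang n hn).Joined (E.1.map some) =
          Quot.mk (S.hang n hn).Joined (hangEnd S n hn hD E).1 := by
        rintro ⟨_ | k, j⟩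
        · by_cases h : (j : ℕ) < D
          · rw [hangEnd_of_lt S n hn hD j h]
            rfl
          · rw [hangEnd_of_ge S n hn hD j h]
            exact Quot.sound base
        · rfl
      rintro b b' ⟨j, j', h⟩
      refine (aux ⟨b, j⟩).trans ((Quot.sound ?_).trans (aux ⟨b', j'⟩).symm)
      exact ⟨_, _, (str_hangEnd S n hn hD ⟨b, j⟩).trans
        ((congrArg Sum.inl h).trans (str_hangEnd S n hn hD ⟨b', j'⟩).symm)⟩
    have hq : Nat.card (Quot (S.hang n hn).Joined) = Nat.card (Quot S.Joined) :=
      Nat.card_congr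
        { toFun := Quot.lift (fun b => Quot.mk _ (π b)) down
          invFun := Quot.lift (fun b => Quot.mk _ (b.map some)) up
          left_inv := by
            rintro ⟨_ | _ | k⟩
            · rfl
            · exact Quot.sound base
            · rfl
          right_inv := by
            rintro ⟨_ | k⟩ <;> rfl }
    rw [hb, hs, hr, hq]
    have := hS.euler
    omega

end hang

end PreTangle

/-! ### Caps as annular tangles -/

namespace PreTangle

/-- The extension to the regions of an annulus with `2 * n` strands of a function `G` on the
boundary intervals of an `n`-box. -/
def ringFill (n : ℕ) {R : Type} (G : Fin (2 * n + 1) → R) (q : Option (Fin (2 * n - 1))) : R :=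
  q.elim (G 0) (fun q => G ⟨q + 1, by omega⟩)

theorem ringFill_ringReg {n : ℕ} {R : Type} {G : Fin (2 * n + 1) → R} (hG : G (Fin.last _) = G 0)
    (j : Fin (2 * n + 1)) : ringFill n G (ringReg n j) = G j := by
  unfold ringReg
  split_ifs with h
  · simp only [ringFill, Option.elim_some]
    congr 1
    ext
    simp only
    omega
  · have h' : j = 0 ∨ j = Fin.last _ := by
      rcases Nat.eq_zero_or_pos j with h0 | h0
      · exact Or.inl (Fin.ext h0)
      · exact Or.inr (Fin.ext (by simp only [Fin.val_last]; omega))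
    rcases h' with rfl | rfl
    · rfl
    · exact hG.symm

/-- The boxes of a composite with a single substitution. -/
def boxOne (κ : Type) : κ ≃ (_ : Fin 1) × κ where
  toFun k := ⟨0, k⟩
  invFun p := p.2
  left_inv _ := rfl
  right_inv := by
    rintro ⟨i, k⟩
    rw [Subsingleton.elim i 0]

theorem stackStr_injective (c : Colour) : Function.Injective (stackStr 1 c 0 1) := by
  intro i j h
  have hi := i.2
  have hj := j.2
  unfold stackStr at h
  split_ifs at h <;> simp [Prod.mk.injEq, Fin.ext_iff] at h <;> exact Fin.ext (by omega)

theorem stackStr_surjective (c : Colour) : Function.Surjective (stackStr 1 c 0 1) := by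
  rintro ⟨l, j⟩
  have hj := j.2
  rcases Fin.exists_fin_two.mp ⟨l, rfl⟩ with rfl | rfl
  · refine ⟨⟨j, by omega⟩, ?_⟩
    simp [stackStr]
  · refine ⟨⟨2 * c.size - 1 - j, by omega⟩, ?_⟩
    have h1 : ¬ 2 * c.size - 1 - (j : ℕ) < c.size := by omega
    have h2 : 2 * c.size - 1 - (2 * c.size - 1 - (j : ℕ)) = j := by omega
    simp [stackStr, h1, h2]

theorem stackReg_injective (c : Colour) {i j : c.Gap} (hi : (i : ℕ) < 2 * c.size ∨ (i : ℕ) = 0)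
    (hj : (j : ℕ) < 2 * c.size ∨ (j : ℕ) = 0)
    (h : stackReg 1 c 0 1 i = stackReg 1 c 0 1 j) : i = j := by
  have hi' := i.2
  have hj' := j.2
  unfold stackReg cell at h
  split_ifs at h <;>
    simp only [Sum.inl.injEq, Sum.inr.injEq, Prod.mk.injEq, Fin.mk.injEq] at h <;>
    simp only [Fin.val_zero, Fin.val_one, true_or, not_true_eq_false, false_or, one_ne_zero]
        at * <;>
    exact Fin.ext (by omega)

theorem stackReg_surjective (c : Colour) : Function.Surjective (stackReg 1 c 0 1) := by
  rintro (j | ⟨l, q⟩)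
  · refine ⟨⟨j, by omega⟩, ?_⟩
    have h1 : (j : ℕ) ≤ c.size := by omega
    simp [stackReg, h1, cell]
  · have hq := q.2
    refine ⟨⟨2 * c.size - 1 - q, by omega⟩, ?_⟩
    have h1 : ¬ 2 * c.size - 1 - (q : ℕ) ≤ c.size := by omega
    have h2 : 2 * c.size - (2 * c.size - 1 - (q : ℕ)) = q + 1 := by omega
    have h3 : ¬ (q : ℕ) + 1 = c.size := by omega
    obtain rfl : l = 0 := Subsingleton.elim _ _
    simp [stackReg, h1, h2, h3, cell]

/-- The annulus is the identity tangle. -/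
noncomputable def reIso_ringId (n : ℕ) :
    ReIso (ringId n) (stack 1 (.nat n)) (Equiv.refl _) := by
  have hb : ∀ b : Option (Fin 1), (stack 1 (.nat n)).reg b =
      fun j : (boxColour (fun _ : Fin 1 => Colour.nat n) (.nat n) b).Gap =>
        ringFill n ((stack 1 (.nat n)).reg none) (ringReg n j) := by
    rintro (_ | k)
    · exact funext fun j => (ringFill_ringReg ((stack 1 (.nat n)).reg_last none) j).symm
    · obtain rfl : k = 0 := Subsingleton.elim _ _
      exact funext fun j => (ringFill_ringReg ((stack 1 (.nat n)).reg_last none) j).symm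
  refine ReIso.ofTight _ (fun _ => rfl)
    ⟨fun s => ⟨none, stackStr_surjective _ s⟩, fun s => ⟨none, stackReg_surjective _ s⟩⟩
    (stackStr 1 (.nat n) 0 1) (ringFill n ((stack 1 (.nat n)).reg none)) (stackStr_injective _)
        ?_ ?_ ?_
  · intro q q' h
    rcases q with _ | q <;> rcases q' with _ | q'
    · rfl
    · have := stackReg_injective (.nat n) (i := (0 : Fin (2 * n + 1)))
        (j := (⟨q' + 1, by omega⟩ : Fin (2 * n + 1))) (Or.inr rfl)
        (Or.inl (by show (q' : ℕ) + 1 < 2 * n; omega)) h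
      have : 0 = (q' : ℕ) + 1 := congrArg Fin.val this
      omega
    · have := stackReg_injective (.nat n) (i := (⟨q + 1, by omega⟩ : Fin (2 * n + 1)))
        (j := (0 : Fin (2 * n + 1))) (Or.inl (by show (q : ℕ) + 1 < 2 * n; omega))
        (Or.inr rfl) h
      have : (q : ℕ) + 1 = 0 := congrArg Fin.val this
      omega
    · have := stackReg_injective (.nat n) (i := (⟨q + 1, by omega⟩ : Fin (2 * n + 1)))
        (j := (⟨q' + 1, by omega⟩ : Fin (2 * n + 1)))
        (Or.inl (by show (q : ℕ) + 1 < 2 * n; omega))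
        (Or.inl (by show (q' : ℕ) + 1 < 2 * n; omega)) h
      have : (q : ℕ) + 1 = q' + 1 := congrArg Fin.val this
      rw [Fin.ext (show (q : ℕ) = q' by omega)]
  · rintro (_ | k) j j' h
    · obtain rfl := Fin.ext h; rfl
    · obtain rfl := Fin.ext h
      obtain rfl : k = 0 := Subsingleton.elim _ _
      rfl
  · rintro (_ | k) j j' h
    · obtain rfl := Fin.ext h
      exact congrFun (hb none) j
    · obtain rfl := Fin.ext h
      exact congrFun (hb (some k)) j

theorem ringId_isPlanar (n : ℕ) : (ringId n).IsPlanar :=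
  (reIso_ringId n).isPlanar (stack_isPlanar 1 _)

/-- Inserting a cap is substitution into an annulus with a cap. -/
def reIso_addCap {ι : Type} {c : ι → Colour} {n : ℕ} (T : PreTangle c (.nat n)) (p : ℕ)
    (hp : p ≤ 2 * n) :
    ReIso (((ringId n).addCap p hp).comp (fun _ : Fin 1 => T)) (T.addCap p hp) (boxOne ι) :=
  ReIso.comp (boxOne ι) (fun _ => rfl) (addCap_tight (ringId_tight n) hp)
    (fT := fun s : Option (Fin (2 * n)) => s.map (T.str none))
    (fS := fun _ s => (some s : Option T.Str))
    (gT := fun r : Option (Option (Fin (2 * n - 1))) => r.map (ringFill n (T.reg none)))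
    (gS := fun _ r => (some r : Option T.Reg))
    (f_glue := fun _ _ => rfl)
    (g_glue := fun _ j => congrArg some (ringFill_ringReg (T.reg_last none) j))
    (f_none := fun j => by
      show capStr T p hp j = Option.map _ (capStr (ringId n) p hp j)
      unfold capStr
      split_ifs <;> rfl)
    (g_none := fun j => by
      show capReg T p hp j = Option.map _ (capReg (ringId n) p hp j)
      unfold capReg
      split_ifs
      · exact congrArg some (ringFill_ringReg (T.reg_last none) _).symm
      · rfl
      · exact congrArg some (ringFill_ringReg (T.reg_last none) _).symm)
    (f_some := fun k j j' h => by obtain rfl := Fin.ext h; rfl)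
    (g_some := fun k j j' h => by obtain rfl := Fin.ext h; rfl)
    (sideS := fun _ _ _ => rfl)
    (shadeS := fun _ _ => rfl)
    (σ := fun s : Option T.Str => s.elim (outerStr _ _ (none : Option (Fin (2 * n))))
      (innerStr _ (fun _ : Fin 1 => T) 0))
    (ρ := fun s : Option T.Reg => s.elim (outerReg _ _ (none : Option (Option (Fin (2 * n - 1)))))
      (innerReg _ (fun _ : Fin 1 => T) 0))
    (σT := by
      rintro (_ | j)
      · rfl
      · exact (outerStr_eq ((ringId n).addCap p hp) (fun _ : Fin 1 => T) 0 j).symm)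
    (σS := fun i s => by rw [Subsingleton.elim i 0]; rfl)
    (ρT := by
      rintro (_ | q)
      · rfl
      · obtain ⟨j, rfl⟩ := ringReg_surj n q
        refine Eq.trans ?_ (outerReg_eq ((ringId n).addCap p hp) (fun _ : Fin 1 => T) 0 j).symm
        exact congrArg (innerReg _ (fun _ : Fin 1 => T) 0) (ringFill_ringReg (T.reg_last none) j))
    (ρS := fun i s => by rw [Subsingleton.elim i 0]; rfl)
    (f_surj := by
      rintro (_ | s)
      · exact Or.inl ⟨(none : Option (Fin (2 * n))), rfl⟩
      · exact Or.inr ⟨0, s, rfl⟩)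
    (g_surj := by
      rintro (_ | s)
      · exact Or.inl ⟨(none : Option (Option (Fin (2 * n - 1)))), rfl⟩
      · exact Or.inr ⟨0, s, rfl⟩)

/-- The annulus which caps off the points `p`, `p + 1` of an `(n + 1)`-box. -/
def capOff (n p : ℕ) (hp : p ≤ 2 * n) : PreTangle (fun _ : Fin 1 => Colour.nat (n + 1)) (.nat n) :=
  ((ringId n).addCap p hp).insideOut

theorem capOff_isPlanar (n p : ℕ) (hp : p ≤ 2 * n) : (capOff n p hp).IsPlanar :=
  insideOut_isPlanar (addCap_isPlanar (ringId_isPlanar n) hp)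

theorem capOff_tight (n p : ℕ) (hp : p ≤ 2 * n) : (capOff n p hp).Tight :=
  insideOut_tight (addCap_tight (ringId_tight n) hp)

section capEval

variable {ι : Type} {c : ι → Colour} {n : ℕ} (T : PreTangle c (.nat n)) {p : ℕ} (hp : p ≤ 2 * n)

theorem capStr_of_lt {m : ℕ} (hm : m < 2 * (n + 1)) (h : m < p) :
    capStr T p hp (⟨m, hm⟩ : Fin (2 * (n + 1))) =
      some (T.str none (⟨m, lt_of_lt_of_le h hp⟩ : Fin (2 * n))) := by
  simp [capStr, h]

theorem capStr_mid {m : ℕ} (hm : m < 2 * (n + 1)) (h : m = p ∨ m = p + 1) :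
    capStr T p hp (⟨m, hm⟩ : Fin (2 * (n + 1))) = none := by
  have h1 : ¬ m < p := by omega
  have h2 : m < p + 2 := by omega
  simp [capStr, h1, h2]

theorem capStr_add_two {m : ℕ} (hm : m < 2 * n) (h : p ≤ m) :
    capStr T p hp (⟨m + 2, by omega⟩ : Fin (2 * (n + 1))) =
      some (T.str none (⟨m, hm⟩ : Fin (2 * n))) := by
  have h1 : ¬ m + 2 < p := by omega
  have h2 : ¬ m < p := by omega
  simp [capStr, h1, h2]

theorem capReg_of_le {m : ℕ} (hm : m < 2 * (n + 1) + 1) (h : m ≤ p) :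
    capReg T p hp (⟨m, hm⟩ : Fin (2 * (n + 1) + 1)) =
      some (T.reg none (⟨m, Nat.lt_succ_of_le (h.trans hp)⟩ : Fin (2 * n + 1))) := by
  simp [capReg, h]

theorem capReg_mid (hm : p + 1 < 2 * (n + 1) + 1) :
    capReg T p hp (⟨p + 1, hm⟩ : Fin (2 * (n + 1) + 1)) = none := by
  simp [capReg]

theorem capReg_add_two {m : ℕ} (hm : m < 2 * n + 1) (h : p ≤ m) :
    capReg T p hp (⟨m + 2, by omega⟩ : Fin (2 * (n + 1) + 1)) =
      some (T.reg none (⟨m, hm⟩ : Fin (2 * n + 1))) := by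
  have h1 : ¬ m + 2 ≤ p := by omega
  have h2 : ¬ m + 1 = p := by omega
  simp [capReg, h1, h2]

end capEval

end PreTangle

/-! ### Substitution into a hanging diagram, and boxes hanging from the unit and the Jones projection -/

namespace PreTangle

section hangComp

variable {κ₁ κ₀ : Type} {n D : ℕ}

/-- The boxes substituted for the hanging box (`none`) and for the diagram it hangs from. -/
def HangBox (κ₁ κ₀ : Type) : Option (Fin 1) → Type
  | none => κ₁
  | some _ => κ₀

/-- The colours of the boxes in `HangBox`. -/
def hangColour (d₁ : κ₁ → Colour) (d₀ : κ₀ → Colour) : (o : Option (Fin 1)) →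
    HangBox κ₁ κ₀ o → Colour
  | none => d₁
  | some _ => d₀

/-- The diagrams substituted for the hanging box (`none`) and for the diagram it hangs from. -/
def hangFamily {d₁ : κ₁ → Colour} {d₀ : κ₀ → Colour} (R : PreTangle d₁ (.nat n))
    (S : PreTangle d₀ (.nat D)) : (o : Option (Fin 1)) →
      PreTangle (hangColour d₁ d₀ o) (boxColour (fun _ : Fin 1 => Colour.nat D) (.nat n) o)
  | none => R
  | some _ => S

/-- The boxes of a diagram from which a box hangs, as those of a composite. -/
def hangBoxEquiv (κ₀ : Type) : Option κ₀ ≃ (o : Option (Fin 1)) × HangBox (Fin 1) κ₀ o where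
  toFun
    | none => ⟨none, (0 : Fin 1)⟩
    | some k => ⟨some 0, k⟩
  invFun
    | ⟨none, _⟩ => none
    | ⟨some _, k⟩ => some k
  left_inv := by rintro (_ | k) <;> rfl
  right_inv := by
    rintro ⟨_ | i, k⟩
    · exact congrArg (Sigma.mk none) (Subsingleton.elim (α := Fin 1) _ _)
    · obtain rfl : i = 0 := Subsingleton.elim _ _
      rfl

theorem hangInReg_last {κ : Type} {d : κ → Colour} (S : PreTangle d (.nat D)) (hn : D < 2 * n) :
    hangInReg S n (2 * n) = hangInReg S n 0 := by
  have h : ¬ 2 * n ≤ D := by omega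
  simp only [hangInReg, h, dite_false, lt_self_iff_false, zero_le, dite_true]
  exact congrArg Sum.inl (S.reg_last none).symm

/-- Hanging a box below `S` is substitution of `S` into the annulus from which a box hangs. -/
noncomputable def reIso_hang {d : κ₀ → Colour} (S : PreTangle d (.nat D)) (hn : D < 2 * n)
    (hD : D ≤ n) :
    ReIso (((ringId D).hang n hn).comp (hangFamily (ringId n) S)) (S.hang n hn)
      (hangBoxEquiv κ₀) := by
  let G := (ringId D).hang n hn
  let F := hangFamily (ringId n) S
  let z : Fin (2 * n + 1) → S.Reg ⊕ Fin (2 * n - 1 - D) := fun j => hangInReg S n j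
  have hz : z (Fin.last _) = z 0 := hangInReg_last S hn
  -- the annulus and its filling
  have hout : ∀ j : ℕ, Sum.map (ringFill D (S.reg none)) id (hangOutReg (ringId D) n j) =
      hangOutReg S n j := by
    intro j
    unfold hangOutReg
    split_ifs
    · exact congrArg Sum.inl (ringFill_ringReg (S.reg_last none) (⟨j, by omega⟩ : Fin (2 * D + 1)))
    · rfl
    · exact congrArg Sum.inl (ringFill_ringReg (S.reg_last none) (0 : Fin (2 * D + 1)))
  have hin : ∀ j : ℕ, Sum.map (ringFill D (S.reg none)) id (hangInReg (ringId D) n j) =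
      hangInReg S n j := by
    intro j
    unfold hangInReg
    split_ifs
    · exact congrArg Sum.inl
        (ringFill_ringReg (S.reg_last none) (⟨2 * D - j, by omega⟩ : Fin (2 * D + 1)))
    · rfl
    · exact congrArg Sum.inl (ringFill_ringReg (S.reg_last none) (0 : Fin (2 * D + 1)))
  -- the gluings
  have g1 : ∀ j : Fin (2 * D), outerStr G F (Sum.inl j : Fin (2 * D) ⊕ Fin (2 * n - D)) =
      innerStr G F (some 0) (S.str none j) := fun j => outerStr_eq G F (some 0) j
  have g2 : ∀ j : Fin (2 * n), outerStr G F (hangIn (ringId D) n j) =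
      innerStr G F none j := fun j => outerStr_eq G F none j
  have r1 : ∀ j : Fin (2 * D + 1),
      outerReg G F (Sum.inl (ringReg D j) : Option (Fin (2 * D - 1)) ⊕ Fin (2 * n - 1 - D)) =
      innerReg G F (some 0) (S.reg none j) := fun j => outerReg_eq G F (some 0) j
  have r2 : ∀ j : Fin (2 * n + 1), outerReg G F (hangInReg (ringId D) n j) =
      innerReg G F none (ringReg n j) := fun j => outerReg_eq G F none j
  refine ReIso.comp (hangBoxEquiv κ₀) ?_ (hang_tight (ringId_tight D) n hn hD)
    (fT := fun s : Fin (2 * D) ⊕ Fin (2 * n - D) => s.map (S.str none) id)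
    (fS := fun o => match o with
      | none => hangIn S n
      | some _ => (Sum.inl : S.Str → S.Str ⊕ Fin (2 * n - D)))
    (gT := fun r : Option (Fin (2 * D - 1)) ⊕ Fin (2 * n - 1 - D) =>
      r.map (ringFill D (S.reg none)) id)
    (gS := fun o => match o with
      | none => ringFill n z
      | some _ => (Sum.inl : S.Reg → S.Reg ⊕ Fin (2 * n - 1 - D)))
    (f_glue := ?_) (g_glue := ?_) (f_none := ?_) (g_none := ?_) (f_some := ?_) (g_some := ?_)
    (sideS := ?_) (shadeS := ?_)
    (σ := Sum.elim (innerStr G F (some 0))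
      (fun q => outerStr G F (Sum.inr q : Fin (2 * D) ⊕ Fin (2 * n - D))))
    (ρ := Sum.elim (innerReg G F (some 0))
      (fun q => outerReg G F (Sum.inr q : Option (Fin (2 * D - 1)) ⊕ Fin (2 * n - 1 - D))))
    (σT := ?_) (σS := ?_) (ρT := ?_) (ρS := ?_) (f_surj := ?_) (g_surj := ?_)
  · rintro (_ | k) <;> rfl
  · rintro (_ | i) j
    · show Sum.map _ _ (hangIn (ringId D) n j) = hangIn S n j
      unfold hangIn
      split_ifs <;> rfl
    · rfl
  · rintro (_ | i) j
    · exact (hin j).trans (ringFill_ringReg hz j).symm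
    · exact congrArg Sum.inl (ringFill_ringReg (S.reg_last none) j)
  · intro j
    show hangOut S n j = Sum.map _ _ (hangOut (ringId D) n j)
    unfold hangOut
    split_ifs <;> rfl
  · exact fun j => (hout j).symm
  · rintro (_ | k) j j' h <;> obtain rfl := Fin.ext h <;> rfl
  · rintro (_ | k) j j' h <;> obtain rfl := Fin.ext h
    · exact (ringFill_ringReg hz j).symm
    · rfl
  · rintro (_ | i) s w
    · change Fin (2 * n) at s
      show hangSide S n (hangIn S n s) w =
        ringFill n z (ringReg n (if w = (Colour.nat n).shadeAt s then s else s + 1))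
      by_cases hw : w = (Colour.nat n).shadeAt s
      · rw [if_pos hw, hw]
        exact (hangSide_in_before S n s).trans (ringFill_ringReg hz s.castSucc).symm
      · rw [if_neg hw, eq_not_of_ne hw]
        exact (hangSide_in_after S n s).trans (ringFill_ringReg hz s.succ).symm
    · rfl
  · rintro (_ | i) r
    · obtain ⟨j, rfl⟩ := ringReg_surj n r
      exact (congrArg (hangShade S n) (ringFill_ringReg hz j)).trans
        ((shade_hangInReg S n (by omega)).trans (shade_ringReg n j (by omega)).symm)
    · rfl
  · rintro (j | q)
    · exact (g1 j).symm
    · rfl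
  · rintro (_ | i) s
    · change Fin (2 * n) at s
      refine Eq.trans ?_ (g2 s)
      show Sum.elim _ _ (hangIn S n s) = _
      unfold hangIn
      split_ifs
      · exact (g1 _).symm
      · rfl
    · obtain rfl : i = 0 := Subsingleton.elim _ _
      rfl
  · rintro (q | q)
    · obtain ⟨j, rfl⟩ := ringReg_surj D q
      exact (congrArg (innerReg G F (some 0)) (ringFill_ringReg (S.reg_last none) j)).trans
        (r1 j).symm
    · rfl
  · rintro (_ | i) s
    · obtain ⟨j, rfl⟩ := ringReg_surj n s
      refine Eq.trans ?_ (r2 j)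
      refine (congrArg (Sum.elim _ _) (ringFill_ringReg hz j)).trans ?_
      show Sum.elim _ _ (hangInReg S n j) = _
      unfold hangInReg
      split_ifs
      · exact (r1 (⟨2 * D - j, by omega⟩ : Fin (2 * D + 1))).symm
      · rfl
      · exact (r1 (0 : Fin (2 * D + 1))).symm
    · obtain rfl : i = 0 := Subsingleton.elim _ _
      rfl
  · rintro (s | q)
    · exact Or.inr ⟨some 0, s, rfl⟩
    · exact Or.inl ⟨(Sum.inr q : Fin (2 * D) ⊕ Fin (2 * n - D)), rfl⟩
  · rintro (s | q)
    · exact Or.inr ⟨some 0, s, rfl⟩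
    · exact Or.inl ⟨(Sum.inr q : Option (Fin (2 * D - 1)) ⊕ Fin (2 * n - 1 - D)), rfl⟩

end hangComp

section hangOne

/-- The single box which hangs from a diagram without boxes. -/
def hangBoxOfEmpty : Fin 1 ≃ Option (Fin 0) where
  toFun _ := none
  invFun _ := 0
  left_inv _ := Subsingleton.elim _ _
  right_inv := by rintro (_ | k); exacts [rfl, k.elim0]

theorem cell_eq_inl {m n : ℕ} (l : Fin (m + 1)) (j : Fin (n + 1))
    (h : (l : ℕ) = 0 ∨ (j : ℕ) = 0 ∨ (j : ℕ) = n) : cell m n l j = Sum.inl j :=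
  dif_pos h

theorem stackStr_of_lt {D : ℕ} (m : ℕ) (t l : Fin (m + 1)) {j : ℕ} (hj : j < 2 * D)
    (h : j < D) :
    stackStr m (.nat D) t l (⟨j, hj⟩ : Fin (2 * D)) = (t, (⟨j, h⟩ : Fin D)) :=
  dif_pos h

theorem stackStr_of_ge {D : ℕ} (m : ℕ) (t l : Fin (m + 1)) {j : ℕ} (hj : j < 2 * D)
    (h : ¬ j < D) :
    stackStr m (.nat D) t l (⟨j, hj⟩ : Fin (2 * D)) = (l, (⟨2 * D - 1 - j, by omega⟩ : Fin D)) :=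
  dif_neg h

theorem stackReg_of_le {D m : ℕ} (t l : Fin (m + 1)) {j : ℕ} (hj : j < 2 * D + 1)
    (h : j ≤ D) :
    stackReg m (.nat D) t l (⟨j, hj⟩ : Fin (2 * D + 1)) =
      cell m D t (⟨j, by omega⟩ : Fin (D + 1)) :=
  dif_pos h

theorem stackReg_of_gt {D m : ℕ} (t l : Fin (m + 1)) {j : ℕ} (hj : j < 2 * D + 1)
    (h : ¬ j ≤ D) :
    stackReg m (.nat D) t l (⟨j, hj⟩ : Fin (2 * D + 1)) =
      cell m D l (⟨2 * D - j, by omega⟩ : Fin (D + 1)) :=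
  dif_neg h

/-- A box hanging from vertical strands. -/
noncomputable def reIso_hang_one (n D : ℕ) (hn : D < 2 * n) :
    ReIso ((stack 0 (.nat D)).hang n hn) (ringId n) hangBoxOfEmpty := by
  let f : (Fin 1 × Fin D) ⊕ Fin (2 * n - D) → Fin (2 * n) :=
    Sum.elim (fun p => ⟨p.2, by omega⟩) (fun q => ⟨q + D, by omega⟩)
  let g : (Fin (D + 1) ⊕ (Fin 0 × Fin (D - 1))) ⊕ Fin (2 * n - 1 - D) → Option (Fin (2 * n - 1)) :=
    Sum.elim (Sum.elim (fun j => ringReg n j) (fun q => q.1.elim0)) (fun q => ringReg n (q + D + 1))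
  have hg : ∀ (j : ℕ) (hj : j < 2 * D + 1), g (Sum.inl (stackReg 0 (.nat D) 0 0
      (⟨j, hj⟩ : Fin (2 * D + 1)))) = ringReg n (if j ≤ D then j else 2 * D - j) := by
    intro j hj
    by_cases h : j ≤ D
    · rw [stackReg_of_le (m := 0) 0 0 hj h, cell_eq_inl _ _ (Or.inl rfl), if_pos h]
      rfl
    · rw [stackReg_of_gt (m := 0) 0 0 hj h, cell_eq_inl _ _ (Or.inl rfl), if_neg h]
      rfl
  refine ReIso.ofTight hangBoxOfEmpty (fun _ => rfl) (ringId_tight n) f g ?_ ?_ ?_ ?_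
  · rintro (⟨a, i⟩ | i) (⟨b, j⟩ | j) h
    · change Fin D at i j
      have h' : (i : ℕ) = j := congrArg (Fin.val (n := 2 * n)) h
      obtain rfl : a = b := Subsingleton.elim (α := Fin 1) _ _
      rw [Fin.ext h']
    · change Fin D at i
      have h' : (i : ℕ) = j + D := congrArg (Fin.val (n := 2 * n)) h
      omega
    · change Fin D at j
      have h' : (i : ℕ) + D = j := congrArg (Fin.val (n := 2 * n)) h
      omega
    · have h' : (i : ℕ) + D = j + D := congrArg (Fin.val (n := 2 * n)) h
      rw [Fin.ext (show (i : ℕ) = j by omega)]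
  · rintro ((i | i) | i) ((j | j) | j) h
    · change Fin (D + 1) at i j
      have h' : ringReg n i = ringReg n j := h
      rw [ringReg_eq_iff (by omega) (by omega)] at h'
      rw [Fin.ext (show (i : ℕ) = j by omega)]
    · exact (j.1 : Fin 0).elim0
    · change Fin (D + 1) at i
      have h' : ringReg n i = ringReg n (j + D + 1) := h
      rw [ringReg_eq_iff (by omega) (by omega)] at h'
      omega
    · exact (i.1 : Fin 0).elim0
    · exact (i.1 : Fin 0).elim0
    · exact (i.1 : Fin 0).elim0
    · change Fin (D + 1) at j
      have h' : ringReg n (i + D + 1) = ringReg n j := h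
      rw [ringReg_eq_iff (by omega) (by omega)] at h'
      omega
    · exact (j.1 : Fin 0).elim0
    · have h' : ringReg n (i + D + 1) = ringReg n (j + D + 1) := h
      rw [ringReg_eq_iff (by omega) (by omega)] at h'
      rw [Fin.ext (show (i : ℕ) = j by omega)]
  · rintro (_ | k) j j' h <;> obtain rfl := Fin.ext h
    · change Fin (2 * n) at j
      show j = f (hangOut (stack 0 (.nat D)) n j)
      unfold hangOut
      split_ifs with h
      · show j = f (Sum.inl (stackStr 0 (.nat D) 0 0 (⟨j, by omega⟩ : Fin (2 * D))))
        rw [stackStr_of_lt 0 0 0 _ h]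
        rfl
      · exact Fin.ext (show (j : ℕ) = j - D + D by omega)
    · change Fin (2 * n) at j
      show j = f (hangIn (stack 0 (.nat D)) n j)
      unfold hangIn
      split_ifs with h
      · show j = f (Sum.inl (stackStr 0 (.nat D) 0 0 (⟨2 * D - 1 - j, by omega⟩ : Fin (2 * D))))
        rw [stackStr_of_ge 0 0 0 _ (by omega)]
        exact Fin.ext (show (j : ℕ) = 2 * D - 1 - (2 * D - 1 - j) by omega)
      · exact Fin.ext (show (j : ℕ) = j - D + D by omega)
  · rintro (_ | k) j j' h <;> obtain rfl := Fin.ext h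
    · change Fin (2 * n + 1) at j
      have hj : (j : ℕ) < 2 * n + 1 := j.2
      show ringReg n j = g (hangOutReg (stack 0 (.nat D)) n j)
      unfold hangOutReg
      split_ifs with h h'
      · refine Eq.trans ?_ (hg j (by omega)).symm
        rw [if_pos h]
      · exact congrArg (ringReg n) (show (j : ℕ) = j - D - 1 + D + 1 by omega)
      · refine Eq.trans ?_ (hg 0 (by omega)).symm
        rw [show (j : ℕ) = 2 * n by omega, if_pos (by omega)]
        exact ringReg_last n
    · change Fin (2 * n + 1) at j
      have hj : (j : ℕ) < 2 * n + 1 := j.2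
      show ringReg n j = g (hangInReg (stack 0 (.nat D)) n j)
      unfold hangInReg
      split_ifs with h h'
      · refine Eq.trans ?_ (hg (2 * D - j) (by omega)).symm
        split_ifs with h'
        · exact congrArg (ringReg n) (by omega)
        · exact congrArg (ringReg n) (by omega)
      · exact congrArg (ringReg n) (show (j : ℕ) = j - D - 1 + D + 1 by omega)
      · refine Eq.trans ?_ (hg 0 (by omega)).symm
        rw [show (j : ℕ) = 2 * n by omega, if_pos (by omega)]
        exact ringReg_last n

end hangOne

section hangJones

/-- The diagram of the Jones projection. -/
def jonesDiagram (m : ℕ) : PreTangle (fun _ : Fin 0 => Colour.nat m) (.nat (m + 2)) :=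
  ((stack 0 (.nat m)).addCap m (by omega)).addCap (m + 2) (by omega)

/-- A box hanging from the Jones projection: two of its points are capped off, and a cap is added
outside. -/
noncomputable def reIso_hang_jones (n m : ℕ) (h : m + 2 ≤ n + 1) :
    ReIso ((jonesDiagram m).hang (n + 1) (by omega)) ((capOff n m (by omega)).addCap m (by omega))
      hangBoxOfEmpty := by
  let f : Option (Option (Fin 1 × Fin m)) ⊕ Fin (2 * (n + 1) - (m + 2)) →
      Option (Option (Fin (2 * n))) :=
    Sum.elim (fun s => s.elim (some none) (fun s => s.map (fun p => some ⟨p.2, by omega⟩)))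
      (fun q => some (some ⟨q + m, by omega⟩))
  let g : Option (Option (Fin (m + 1) ⊕ (Fin 0 × Fin (m - 1)))) ⊕ Fin (2 * (n + 1) - 1 - (m + 2)) →
      Option (Option (Option (Fin (2 * n - 1)))) :=
    Sum.elim (fun s => s.elim (some none)
      (fun s : Option (Fin (m + 1) ⊕ (Fin 0 × Fin (m - 1))) => s.map (fun p =>
        some (Sum.elim (fun j : Fin (m + 1) => ringReg n j)
          (fun q : Fin 0 × Fin (m - 1) => q.1.elim0) p))))
      (fun q => some (some (ringReg n (q + m + 1))))
  have hm : m ≤ 2 * n := by omega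
  have hm2 : m + 2 ≤ 2 * (m + 1) := by omega
  have hmm : m ≤ 2 * m := by omega
  let T := capOff n m hm
  let A := stack 0 (.nat m)
  let B := A.addCap m hmm
  have hg : ∀ (j : ℕ) (hj : j < 2 * m + 1), g (Sum.inl (some (some (stackReg 0 (.nat m) 0 0
      (⟨j, hj⟩ : Fin (2 * m + 1)))))) =
      some (some (ringReg n (if j ≤ m then j else 2 * m - j))) := by
    intro j hj
    by_cases h : j ≤ m
    · rw [stackReg_of_le (m := 0) 0 0 hj h, cell_eq_inl _ _ (Or.inl rfl), if_pos h]
      rfl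
    · rw [stackReg_of_gt (m := 0) 0 0 hj h, cell_eq_inl _ _ (Or.inl rfl), if_neg h]
      rfl
  have hf1 : ∀ (j : ℕ) (hj : j < 2 * m) (h : j < m), f (Sum.inl (some (some (stackStr 0 (.nat m) 0 0
      (⟨j, hj⟩ : Fin (2 * m)))))) = some (some ⟨j, by omega⟩) := by
    intro j hj h
    rw [stackStr_of_lt 0 0 0 hj h]
    rfl
  have hf2 : ∀ (j : ℕ) (hj : j < 2 * m) (h : ¬ j < m),
      f (Sum.inl (some (some (stackStr 0 (.nat m) 0 0
      (⟨j, hj⟩ : Fin (2 * m)))))) = some (some ⟨2 * m - 1 - j, by omega⟩) := by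
    intro j hj h
    rw [stackStr_of_ge 0 0 0 hj h]
    rfl
  have hfi : Function.Injective f := by
    rintro ((_ | _ | ⟨a, i⟩) | i) ((_ | _ | ⟨b, j⟩) | j) h <;> simp [f] at h
    · rfl
    · rfl
    · obtain rfl : a = b := Subsingleton.elim (α := Fin 1) _ _
      rw [Fin.ext h]
    · omega
    · omega
    · rw [Fin.ext h]
  have hgi : Function.Injective g := by
    rintro ((_ | _ | i | i) | i) ((_ | _ | j | j) | j) h
    all_goals first | exact i.1.elim0 | exact j.1.elim0 | skip
    all_goals simp [g] at h
    · rfl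
    · rfl
    · rw [ringReg_eq_iff (by omega) (by omega)] at h
      rw [Fin.ext (show (i : ℕ) = j by omega)]
    · rw [ringReg_eq_iff (by omega) (by omega)] at h
      omega
    · rw [ringReg_eq_iff (by omega) (by omega)] at h
      omega
    · rw [ringReg_eq_iff (by omega) (by omega)] at h
      rw [Fin.ext (show (i : ℕ) = j by omega)]
  refine ReIso.ofTight hangBoxOfEmpty (fun _ => rfl) (addCap_tight (capOff_tight n m hm) hm)
    f g hfi hgi ?_ ?_
  · rintro (_ | k) j j' h <;> obtain rfl := Fin.ext h
    · obtain ⟨j, hj⟩ := j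
      change j < 2 * (n + 1) at hj
      show capStr T m hm (⟨j, hj⟩ : Fin (2 * (n + 1))) =
        f (hangOut (jonesDiagram m) (n + 1) (⟨j, hj⟩ : Fin (2 * (n + 1))))
      unfold hangOut
      split_ifs with h'
      · change j < m + 2 at h'
        show _ = f (Sum.inl (capStr B (m + 2) hm2 (⟨j, by omega⟩ : Fin (2 * (m + 1 + 1)))))
        rw [capStr_of_lt B hm2 _ h']
        show _ = f (Sum.inl (some (capStr A m hmm (⟨j, by omega⟩ : Fin (2 * (m + 1))))))
        obtain h1 | h1 : j < m ∨ (j = m ∨ j = m + 1) := by omega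
        · rw [capStr_of_lt T hm _ h1, capStr_of_lt A hmm _ h1]
          exact (hf1 j (by omega) h1).symm
        · rw [capStr_mid T hm _ h1, capStr_mid A hmm _ h1]
          rfl
      · change ¬ j < m + 2 at h'
        obtain ⟨j, rfl⟩ := Nat.exists_eq_add_of_le' (show 2 ≤ j by omega)
        rw [capStr_add_two T hm (by omega) (by omega)]
        exact congrArg (fun q : Fin (2 * n) => some (some q)) (Fin.ext
          (show j = j + 2 - (m + 2) + m by omega))
    · obtain ⟨j, hj⟩ := j
      change j < 2 * (n + 1) at hj
      show some (capStr (ringId n) m hm (⟨j, hj⟩ : Fin (2 * (n + 1)))) =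
        f (hangIn (jonesDiagram m) (n + 1) (⟨j, hj⟩ : Fin (2 * (n + 1))))
      unfold hangIn
      split_ifs with h'
      · change j < m + 2 at h'
        show _ = f (Sum.inl (capStr B (m + 2) hm2
          (⟨2 * (m + 2) - 1 - j, by omega⟩ : Fin (2 * (m + 1 + 1)))))
        obtain h1 | h1 : j < m ∨ (j = m ∨ j = m + 1) := by omega
        · rw [capStr_of_lt (ringId n) hm _ h1]
          have e : (⟨2 * (m + 2) - 1 - j, by omega⟩ : Fin (2 * (m + 1 + 1))) =
              ⟨(2 * m - 1 - j) + 2 + 2, by omega⟩ := Fin.ext (by show _ = _; simp only; omega)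
          rw [e, capStr_add_two B hm2 (by omega) (by omega)]
          show _ = f (Sum.inl (some (capStr A m hmm
            (⟨(2 * m - 1 - j) + 2, by omega⟩ : Fin (2 * (m + 1))))))
          rw [capStr_add_two A hmm (by omega) (by omega)]
          refine Eq.trans ?_ (hf2 (2 * m - 1 - j) (by omega) (by omega)).symm
          exact congrArg (fun q : Fin (2 * n) => some (some q)) (Fin.ext
            (show j = 2 * m - 1 - (2 * m - 1 - j) by omega))
        · rw [capStr_mid (ringId n) hm _ h1, capStr_mid B hm2 _ (by omega)]
          rfl
      · change ¬ j < m + 2 at h'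
        obtain ⟨j, rfl⟩ := Nat.exists_eq_add_of_le' (show 2 ≤ j by omega)
        rw [capStr_add_two (ringId n) hm (by omega) (by omega)]
        exact congrArg (fun q : Fin (2 * n) => some (some q)) (Fin.ext
          (show j = j + 2 - (m + 2) + m by omega))
  · rintro (_ | k) j j' h <;> obtain rfl := Fin.ext h
    · obtain ⟨j, hj⟩ := j
      change j < 2 * (n + 1) + 1 at hj
      show capReg T m hm (⟨j, hj⟩ : Fin (2 * (n + 1) + 1)) =
        g (hangOutReg (jonesDiagram m) (n + 1) j)
      have hzero : some (some (ringReg n 0)) = g (Sum.inl (capReg B (m + 2) hm2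
          (⟨0, by omega⟩ : Fin (2 * (m + 1 + 1) + 1)))) := by
        rw [capReg_of_le B hm2 _ (by omega)]
        show _ = g (Sum.inl (some (capReg A m hmm (⟨0, by omega⟩ : Fin (2 * (m + 1) + 1)))))
        rw [capReg_of_le A hmm _ (by omega)]
        exact (hg 0 (by omega)).symm
      unfold hangOutReg
      split_ifs with h' h''
      · show _ = g (Sum.inl (capReg B (m + 2) hm2 (⟨j, by omega⟩ : Fin (2 * (m + 1 + 1) + 1))))
        rw [capReg_of_le B hm2 _ h']
        show _ = g (Sum.inl (some (capReg A m hmm (⟨j, by omega⟩ : Fin (2 * (m + 1) + 1)))))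
        obtain h1 | h1 | h1 : j ≤ m ∨ j = m + 1 ∨ j = m + 2 := by omega
        · rw [capReg_of_le T hm _ h1, capReg_of_le A hmm _ h1]
          refine Eq.trans ?_ (hg j (by omega)).symm
          rw [if_pos h1]
          rfl
        · subst h1
          rw [capReg_mid T hm, capReg_mid A hmm]
          rfl
        · subst h1
          rw [capReg_add_two T hm (by omega) le_rfl, capReg_add_two A hmm (by omega) le_rfl]
          refine Eq.trans ?_ (hg m (by omega)).symm
          rw [if_pos le_rfl]
          rfl
      · obtain ⟨j, rfl⟩ := Nat.exists_eq_add_of_le' (show 2 ≤ j by omega)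
        rw [capReg_add_two T hm (by omega) (by omega)]
        exact congrArg (fun q => some (some (ringReg n q)))
            (show j = j + 2 - (m + 2) - 1 + m + 1 by omega)
      · obtain rfl : j = 2 * n + 2 := by omega
        rw [capReg_add_two T hm (by omega) (by omega)]
        refine Eq.trans ?_ hzero
        exact congrArg (fun q => some (some q)) (ringReg_last n)
    · obtain ⟨j, hj⟩ := j
      change j < 2 * (n + 1) + 1 at hj
      show some (capReg (ringId n) m hm (⟨j, hj⟩ : Fin (2 * (n + 1) + 1))) =
        g (hangInReg (jonesDiagram m) (n + 1) j)
      have hzero : some (some (ringReg n 0)) = g (Sum.inl (capReg B (m + 2) hm2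
          (⟨0, by omega⟩ : Fin (2 * (m + 1 + 1) + 1)))) := by
        rw [capReg_of_le B hm2 _ (by omega)]
        show _ = g (Sum.inl (some (capReg A m hmm (⟨0, by omega⟩ : Fin (2 * (m + 1) + 1)))))
        rw [capReg_of_le A hmm _ (by omega)]
        exact (hg 0 (by omega)).symm
      unfold hangInReg
      split_ifs with h' h''
      · show _ = g (Sum.inl (capReg B (m + 2) hm2
          (⟨2 * (m + 2) - j, by omega⟩ : Fin (2 * (m + 1 + 1) + 1))))
        obtain h1 | h1 | h1 : j ≤ m ∨ j = m + 1 ∨ j = m + 2 := by omega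
        · rw [capReg_of_le (ringId n) hm _ h1]
          have e : (⟨2 * (m + 2) - j, by omega⟩ : Fin (2 * (m + 1 + 1) + 1)) =
              ⟨(2 * m - j) + 2 + 2, by omega⟩ := Fin.ext (by show _ = _; simp only; omega)
          rw [e, capReg_add_two B hm2 (by omega) (by omega)]
          show _ = g (Sum.inl (some (capReg A m hmm
            (⟨(2 * m - j) + 2, by omega⟩ : Fin (2 * (m + 1) + 1)))))
          rw [capReg_add_two A hmm (by omega) (by omega)]
          refine Eq.trans ?_ (hg (2 * m - j) (by omega)).symm
          show some (some (ringReg n j)) = _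
          split_ifs
          · exact congrArg (fun q => some (some (ringReg n q))) (by omega)
          · exact congrArg (fun q => some (some (ringReg n q))) (by omega)
        · subst h1
          have e : (⟨2 * (m + 2) - (m + 1), by omega⟩ : Fin (2 * (m + 1 + 1) + 1)) =
              ⟨(m + 2) + 1, by omega⟩ := Fin.ext (by show _ = _; simp only; omega)
          rw [capReg_mid (ringId n) hm, e, capReg_mid B hm2]
          rfl
        · subst h1
          have e : (⟨2 * (m + 2) - (m + 2), by omega⟩ : Fin (2 * (m + 1 + 1) + 1)) =
              ⟨m + 2, by omega⟩ := Fin.ext (by show _ = _; simp only; omega)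
          rw [capReg_add_two (ringId n) hm (by omega) le_rfl, e, capReg_of_le B hm2 _ le_rfl]
          show _ = g (Sum.inl (some (capReg A m hmm (⟨m + 2, by omega⟩ : Fin (2 * (m + 1) + 1)))))
          rw [capReg_add_two A hmm (by omega) le_rfl]
          refine Eq.trans ?_ (hg m (by omega)).symm
          rw [if_pos le_rfl]
          rfl
      · obtain ⟨j, rfl⟩ := Nat.exists_eq_add_of_le' (show 2 ≤ j by omega)
        rw [capReg_add_two (ringId n) hm (by omega) (by omega)]
        exact congrArg (fun q => some (some (ringReg n q)))
            (show j = j + 2 - (m + 2) - 1 + m + 1 by omega)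
      · obtain rfl : j = 2 * n + 2 := by omega
        rw [capReg_add_two (ringId n) hm (by omega) (by omega)]
        refine Eq.trans ?_ hzero
        exact congrArg (fun q => some (some q)) (ringReg_last n)

end hangJones

end PreTangle

/-! ### Boxes hanging from a product -/

namespace PreTangle

section hangMul

/-- The boxes of a product from which a box hangs, as those of two boxes hanging one below the
other. -/
def hangBoxTwo : Option (Fin 2) ≃ (o : Option (Fin 1)) × HangBox (Option (Fin 1)) (Fin 1) o where
  toFun
    | none => ⟨none, (none : Option (Fin 1))⟩
    | some 0 => ⟨some 0, (0 : Fin 1)⟩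
    | some 1 => ⟨none, (some 0 : Option (Fin 1))⟩
  invFun
    | ⟨none, b⟩ => (b : Option (Fin 1)).elim none (fun _ => some 1)
    | ⟨some _, _⟩ => some 0
  left_inv := by
    rintro (_ | i)
    · rfl
    · fin_cases i <;> rfl
  right_inv := by
    rintro ⟨_ | i, b⟩
    · change Option (Fin 1) at b
      rcases b with _ | b
      · rfl
      · obtain rfl : b = 0 := Subsingleton.elim _ _
        rfl
    · change Fin 1 at b
      obtain rfl : i = 0 := Subsingleton.elim _ _
      obtain rfl : b = 0 := Subsingleton.elim _ _
      rfl

theorem stackReg_of_ge {D m : ℕ} (t l : Fin (m + 1)) {j : ℕ} (hj : j < 2 * D + 1) (h : D ≤ j) :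
    stackReg m (.nat D) t l (⟨j, hj⟩ : Fin (2 * D + 1)) =
      cell m D l (⟨2 * D - j, by omega⟩ : Fin (D + 1)) := by
  by_cases h' : j ≤ D
  · rw [stackReg_of_le t l hj h', cell_eq_inl _ _ (Or.inr (Or.inr (by simp only; omega))),
      cell_eq_inl _ _ (Or.inr (Or.inr (by simp only; omega)))]
    exact congrArg Sum.inl (Fin.ext (by simp only; omega))
  · exact stackReg_of_gt t l hj h'

theorem stackReg_zero {D m : ℕ} (t l : Fin (m + 1)) :
    stackReg m (.nat D) t l (0 : Fin (2 * D + 1)) = Sum.inl (0 : Fin (D + 1)) :=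
  (stackReg_of_le t l (by omega) (Nat.zero_le D)).trans (cell_eq_inl _ _ (Or.inr (Or.inl rfl)))

theorem stackSide_ring {D m : ℕ} (t l : Fin (m + 1)) (j : Fin (2 * D)) (w : Bool) :
    stackSide m (.nat D) (stackStr m (.nat D) t l j) w =
      ringFill D (stackReg m (.nat D) t l)
        (ringReg D (if w = (Colour.nat D).shadeAt j then j else j + 1)) := by
  by_cases hw : w = (Colour.nat D).shadeAt j
  · rw [if_pos hw, hw]
    exact (stack_side_before m (.nat D) t l j).trans
      (ringFill_ringReg (stack_reg_last m (.nat D) t l) j.castSucc).symm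
  · rw [if_neg hw, eq_not_of_ne hw]
    exact (stack_side_after m (.nat D) t l j).trans
      (ringFill_ringReg (stack_reg_last m (.nat D) t l) j.succ).symm

theorem stackShade_ring {D m : ℕ} (t l : Fin (m + 1)) (r : Option (Fin (2 * D - 1))) :
    stackShade m (.nat D) (ringFill D (stackReg m (.nat D) t l) r) = (ringId D).shade r := by
  obtain ⟨j, rfl⟩ := ringReg_surj D r
  refine (congrArg _ (ringFill_ringReg (stack_reg_last m (.nat D) t l) j)).trans ?_
  exact (stack_shade_reg m (.nat D) t l j).trans (shade_ringReg D j (by omega)).symm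

/-- A box hanging from a box hanging from a box is a box hanging from a product. -/
noncomputable def reIso_hang_mul {n D : ℕ} (hn : D < 2 * n) (hD : D ≤ n) :
    ReIso (((ringId D).hang n hn).comp (hangFamily ((ringId D).hang n hn) (ringId D)))
      ((stack 2 (.nat D)).hang n hn) hangBoxTwo := by
  let G := (ringId D).hang n hn
  let F := hangFamily G (ringId D)
  let c := Colour.nat D
  have hl : ∀ t l, stackReg 2 c t l (Fin.last _) = stackReg 2 c t l 0 := stack_reg_last 2 c
  -- evaluation of the filled annuli
  have hfill : ∀ (t l : Fin 3) (j : ℕ) (hj : j < 2 * D + 1),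
      ringFill D (stackReg 2 c t l) (ringReg D j) =
        stackReg 2 c t l (⟨j, hj⟩ : Fin (2 * D + 1)) :=
    fun t l j hj => ringFill_ringReg (hl t l) (⟨j, hj⟩ : Fin (2 * D + 1))
  have hout : ∀ (t l : Fin 3) (j : ℕ), Sum.map (ringFill D (stackReg 2 c t l)) id
        (hangOutReg (ringId D) n j) =
      if h : j ≤ D then Sum.inl (cell 2 D t (⟨j, by omega⟩ : Fin (D + 1)))
      else if h' : j < 2 * n then Sum.inr ⟨j - D - 1, by omega⟩
      else Sum.inl (Sum.inl (0 : Fin (D + 1))) := by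
    intro t l j
    unfold hangOutReg
    split_ifs with h h'
    · exact congrArg Sum.inl ((hfill t l j (by omega)).trans (stackReg_of_le t l _ h))
    · rfl
    · exact congrArg Sum.inl ((hfill t l 0 (by omega)).trans (stackReg_zero t l))
  have hin : ∀ (t l : Fin 3) (j : ℕ), Sum.map (ringFill D (stackReg 2 c t l)) id
        (hangInReg (ringId D) n j) =
      if h : j ≤ D then Sum.inl (cell 2 D l (⟨j, by omega⟩ : Fin (D + 1)))
      else if h' : j < 2 * n then Sum.inr ⟨j - D - 1, by omega⟩
      else Sum.inl (Sum.inl (0 : Fin (D + 1))) := by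
    intro t l j
    unfold hangInReg
    split_ifs with h h'
    · refine congrArg Sum.inl ((hfill t l (2 * D - j) (by omega)).trans
        ((stackReg_of_ge t l _ (by omega)).trans ?_))
      exact congrArg _ (Fin.ext (show 2 * D - (2 * D - j) = j by omega))
    · rfl
    · exact congrArg Sum.inl ((hfill t l 0 (by omega)).trans (stackReg_zero t l))
  have houtU : ∀ j : ℕ, hangOutReg (stack 2 (.nat D)) n j =
      if h : j ≤ D then Sum.inl (cell 2 D 0 (⟨j, by omega⟩ : Fin (D + 1)))
      else if h' : j < 2 * n then Sum.inr ⟨j - D - 1, by omega⟩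
      else Sum.inl (Sum.inl (0 : Fin (D + 1))) := by
    intro j
    unfold hangOutReg
    split_ifs with h h'
    · exact congrArg Sum.inl (stackReg_of_le 0 2 _ h)
    · rfl
    · exact congrArg Sum.inl (stackReg_zero 0 2)
  have hinU : ∀ j : ℕ, hangInReg (stack 2 (.nat D)) n j =
      if h : j ≤ D then Sum.inl (cell 2 D 2 (⟨j, by omega⟩ : Fin (D + 1)))
      else if h' : j < 2 * n then Sum.inr ⟨j - D - 1, by omega⟩
      else Sum.inl (Sum.inl (0 : Fin (D + 1))) := by
    intro j
    unfold hangInReg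
    split_ifs with h h'
    · refine congrArg Sum.inl ((stackReg_of_ge 0 2 _ (by omega)).trans ?_)
      exact congrArg _ (Fin.ext (show 2 * D - (2 * D - j) = j by omega))
    · rfl
    · exact congrArg Sum.inl (stackReg_zero 0 2)
  have hgt : ∀ j : ℕ, D ≤ j → hangOutReg (stack 2 (.nat D)) n j =
      Sum.map (ringFill D (stackReg 2 c 1 2)) id (hangOutReg (ringId D) n j) := by
    intro j hj
    rw [houtU, hout]
    split_ifs with h
    · refine congrArg Sum.inl ?_
      rw [cell_eq_inl _ _ (Or.inl rfl), cell_eq_inl _ _ (Or.inr (Or.inr (by simp only; omega)))]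
    · rfl
    · rfl
  -- the gluings
  have g1 : ∀ j : Fin (2 * D), outerStr G F (Sum.inl j : Fin (2 * D) ⊕ Fin (2 * n - D)) =
      innerStr G F (some 0) j := fun j => outerStr_eq G F (some 0) j
  have g2 : ∀ j : Fin (2 * n), outerStr G F (hangIn (ringId D) n j) =
      innerStr G F none (hangOut (ringId D) n j) := fun j => outerStr_eq G F none j
  have g3 : ∀ (j : ℕ) (h : j < D), innerStr G F (some 0) (⟨2 * D - 1 - j, by omega⟩ : Fin (2 * D)) =
      innerStr G F none (Sum.inl ⟨j, by omega⟩ : Fin (2 * D) ⊕ Fin (2 * n - D)) := by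
    intro j h
    have := g2 ⟨j, by omega⟩
    simp only [hangIn, hangOut, h, dite_true] at this
    exact (g1 _).symm.trans this
  have g4 : ∀ q : Fin (2 * n - D), outerStr G F (Sum.inr q : Fin (2 * D) ⊕ Fin (2 * n - D)) =
      innerStr G F none (Sum.inr q : Fin (2 * D) ⊕ Fin (2 * n - D)) := by
    intro q
    have := g2 ⟨q + D, by omega⟩
    have e : ¬ (q : ℕ) + D < D := by omega
    simp only [hangIn, hangOut, e, dite_false, Nat.add_sub_cancel, Fin.eta] at this
    exact this
  have r1 : ∀ j : ℕ, j < 2 * D + 1 →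
      outerReg G F (Sum.inl (ringReg D j) : Option (Fin (2 * D - 1)) ⊕ Fin (2 * n - 1 - D)) =
      innerReg G F (some 0) (ringReg D j) :=
    fun j hj => outerReg_eq G F (some 0) (⟨j, hj⟩ : Fin (2 * D + 1))
  have r2 : ∀ j : ℕ, j < 2 * n + 1 → outerReg G F (hangInReg (ringId D) n j) =
      innerReg G F none (hangOutReg (ringId D) n j) :=
    fun j hj => outerReg_eq G F none (⟨j, hj⟩ : Fin (2 * n + 1))
  have r3 : ∀ (j : ℕ), j ≤ D → innerReg G F (some 0) (ringReg D (2 * D - j)) =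
      innerReg G F none
        (Sum.inl (ringReg D j) : Option (Fin (2 * D - 1)) ⊕ Fin (2 * n - 1 - D)) := by
    intro j h
    have := r2 j (by omega)
    simp only [hangInReg, hangOutReg, h, dite_true] at this
    exact (r1 _ (by omega)).symm.trans this
  have r4 : ∀ q : Fin (2 * n - 1 - D),
      outerReg G F (Sum.inr q : Option (Fin (2 * D - 1)) ⊕ Fin (2 * n - 1 - D)) =
      innerReg G F none (Sum.inr q : Option (Fin (2 * D - 1)) ⊕ Fin (2 * n - 1 - D)) := by
    intro q
    have := r2 (q + D + 1) (by omega)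
    have e : ¬ (q : ℕ) + D + 1 ≤ D := by omega
    have e' : (q : ℕ) + D + 1 < 2 * n := by omega
    have e'' : (q : ℕ) + D + 1 - D - 1 = q := by omega
    simp only [hangInReg, hangOutReg, e, e', e'', dite_false, dite_true, Fin.eta] at this
    exact this
  let σ₀ : Fin 3 × Fin D → Quot (StrGlue G F) := fun p =>
    if (p.1 : ℕ) = 0 then innerStr G F (some 0) (⟨p.2, by omega⟩ : Fin (2 * D))
    else if (p.1 : ℕ) = 1 then innerStr G F (some 0) (⟨2 * D - 1 - p.2, by omega⟩ : Fin (2 * D))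
    else innerStr G F none (Sum.inl ⟨2 * D - 1 - p.2, by omega⟩ : Fin (2 * D) ⊕ Fin (2 * n - D))
  let ρ₀ : Fin (D + 1) ⊕ (Fin 2 × Fin (D - 1)) → Quot (RegGlue G F) := Sum.elim
    (fun j => innerReg G F (some 0) (ringReg D j))
    (fun p => if (p.1 : ℕ) = 0 then innerReg G F (some 0) (ringReg D (2 * D - (p.2 + 1)))
      else innerReg G F none (Sum.inl (ringReg D (2 * D - (p.2 + 1))) :
        Option (Fin (2 * D - 1)) ⊕ Fin (2 * n - 1 - D)))
  have σ1 : ∀ j : Fin (2 * D), σ₀ (stackStr 2 c 0 1 j) = innerStr G F (some 0) j := by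
    intro j
    by_cases h : (j : ℕ) < D
    · rw [show stackStr 2 c 0 1 j = _ from stackStr_of_lt 2 0 1 j.2 h]
      rfl
    · rw [show stackStr 2 c 0 1 j = _ from stackStr_of_ge 2 0 1 j.2 h]
      exact congrArg (innerStr G F (some 0)) (Fin.ext
        (show 2 * D - 1 - (2 * D - 1 - (j : ℕ)) = j by omega))
  have σ2 : ∀ j : Fin (2 * D), σ₀ (stackStr 2 c 1 2 j) =
      innerStr G F none (Sum.inl j : Fin (2 * D) ⊕ Fin (2 * n - D)) := by
    intro j
    by_cases h : (j : ℕ) < D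
    · rw [show stackStr 2 c 1 2 j = _ from stackStr_of_lt 2 1 2 j.2 h]
      exact g3 j h
    · rw [show stackStr 2 c 1 2 j = _ from stackStr_of_ge 2 1 2 j.2 h]
      exact congrArg (fun q : Fin (2 * D) => innerStr G F none
        (Sum.inl q : Fin (2 * D) ⊕ Fin (2 * n - D))) (Fin.ext
        (show 2 * D - 1 - (2 * D - 1 - (j : ℕ)) = j by omega))
  have hr0 : ringReg D (2 * D) = ringReg D 0 := ringReg_last D
  have ρc0 : ∀ j : Fin (D + 1), ρ₀ (cell 2 D 0 j) = innerReg G F (some 0) (ringReg D j) := by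
    intro j
    rw [cell_eq_inl _ _ (Or.inl rfl)]
    rfl
  have ρc1 : ∀ j : Fin (D + 1), ρ₀ (cell 2 D 1 j) =
      innerReg G F (some 0) (ringReg D (2 * D - j)) := by
    intro j
    unfold cell
    split_ifs with h
    · refine congrArg (innerReg G F (some 0)) ?_
      rcases h with h | h | h
      · exact absurd h (by simp)
      · rw [h]; exact hr0.symm
      · exact congrArg (ringReg D) (by omega)
    · exact congrArg (fun q => innerReg G F (some 0) (ringReg D q))
        (show 2 * D - ((j : ℕ) - 1 + 1) = 2 * D - j by omega)
  have ρc2 : ∀ j : Fin (D + 1), ρ₀ (cell 2 D 2 j) =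
      innerReg G F none (Sum.inl (ringReg D (2 * D - j)) :
        Option (Fin (2 * D - 1)) ⊕ Fin (2 * n - 1 - D)) := by
    intro j
    unfold cell
    split_ifs with h
    · rcases h with h | h | h
      · exact absurd h (by simp)
      · have := r3 0 (by omega)
        show innerReg G F (some 0) (ringReg D j) = _
        rw [h, show 2 * D - 0 = 2 * D from rfl, hr0]
        exact (congrArg (innerReg G F (some 0)) hr0).symm.trans this
      · have := r3 D le_rfl
        have e : 2 * D - D = D := by omega
        rw [e] at this
        show innerReg G F (some 0) (ringReg D j) = _
        rw [h, e]
        exact this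
    · exact congrArg (fun q => innerReg G F none (Sum.inl (ringReg D q) :
        Option (Fin (2 * D - 1)) ⊕ Fin (2 * n - 1 - D)))
        (show 2 * D - ((j : ℕ) - 1 + 1) = 2 * D - j by omega)
  have ρ1 : ∀ q : Option (Fin (2 * D - 1)), ρ₀ (ringFill D (stackReg 2 c 0 1) q) =
      innerReg G F (some 0) q := by
    intro q
    obtain ⟨⟨j, hj⟩, rfl⟩ := ringReg_surj D q
    refine (congrArg ρ₀ (hfill 0 1 j hj)).trans ?_
    show _ = innerReg G F (some 0) (ringReg D j)
    by_cases h : j ≤ D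
    · rw [stackReg_of_le 0 1 hj h, ρc0]
    · rw [stackReg_of_ge 0 1 hj (by omega), ρc1]
      exact congrArg (fun q => innerReg G F (some 0) (ringReg D q))
        (show 2 * D - (2 * D - j) = j by omega)
  have ρ2 : ∀ q : Option (Fin (2 * D - 1)), ρ₀ (ringFill D (stackReg 2 c 1 2) q) =
      innerReg G F none (Sum.inl q : Option (Fin (2 * D - 1)) ⊕ Fin (2 * n - 1 - D)) := by
    intro q
    obtain ⟨⟨j, hj⟩, rfl⟩ := ringReg_surj D q
    refine (congrArg ρ₀ (hfill 1 2 j hj)).trans ?_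
    show _ = innerReg G F none (Sum.inl (ringReg D j) :
      Option (Fin (2 * D - 1)) ⊕ Fin (2 * n - 1 - D))
    by_cases h : j ≤ D
    · rw [stackReg_of_le 1 2 hj h, ρc1]
      exact r3 j h
    · rw [stackReg_of_ge 1 2 hj (by omega), ρc2]
      exact congrArg (fun q => innerReg G F none (Sum.inl (ringReg D q) :
        Option (Fin (2 * D - 1)) ⊕ Fin (2 * n - 1 - D)))
        (show 2 * D - (2 * D - j) = j by omega)
  refine ReIso.comp hangBoxTwo ?_ (hang_tight (ringId_tight D) n hn hD)
    (fT := fun s : Fin (2 * D) ⊕ Fin (2 * n - D) => s.map (stackStr 2 c 0 1) id)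
    (fS := fun o => match o with
      | none => fun s : Fin (2 * D) ⊕ Fin (2 * n - D) => s.map (stackStr 2 c 1 2) id
      | some _ => fun j : Fin (2 * D) =>
        (Sum.inl (stackStr 2 c 0 1 j) : (Fin 3 × Fin D) ⊕ Fin (2 * n - D)))
    (gT := fun r : Option (Fin (2 * D - 1)) ⊕ Fin (2 * n - 1 - D) =>
      r.map (ringFill D (stackReg 2 c 0 1)) id)
    (gS := fun o => match o with
      | none => fun r : Option (Fin (2 * D - 1)) ⊕ Fin (2 * n - 1 - D) =>
        r.map (ringFill D (stackReg 2 c 1 2)) id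
      | some _ => fun r : Option (Fin (2 * D - 1)) =>
        (Sum.inl (ringFill D (stackReg 2 c 0 1) r) :
          (Fin (D + 1) ⊕ (Fin 2 × Fin (D - 1))) ⊕ Fin (2 * n - 1 - D)))
    (f_glue := ?_) (g_glue := ?_) (f_none := ?_) (g_none := ?_) (f_some := ?_) (g_some := ?_)
    (sideS := ?_) (shadeS := ?_)
    (σ := Sum.elim σ₀ (fun q => outerStr G F (Sum.inr q : Fin (2 * D) ⊕ Fin (2 * n - D))))
    (ρ := Sum.elim ρ₀
      (fun q => outerReg G F (Sum.inr q : Option (Fin (2 * D - 1)) ⊕ Fin (2 * n - 1 - D))))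
    (σT := ?_) (σS := ?_) (ρT := ?_) (ρS := ?_) (f_surj := ?_) (g_surj := ?_)
  · rintro (_ | k)
    · rfl
    · fin_cases k <;> rfl
  · rintro (_ | i) j
    · change Fin (2 * n) at j
      show Sum.map _ _ (hangIn (ringId D) n j) = Sum.map _ _ (hangOut (ringId D) n j)
      unfold hangIn hangOut
      split_ifs with h
      · refine congrArg Sum.inl ?_
        refine (stackStr_of_ge 2 0 1 (by omega) (by omega)).trans ?_
        refine Eq.trans ?_ (stackStr_of_lt 2 1 2 (by omega) h).symm
        exact congrArg (Prod.mk 1) (Fin.ext (show 2 * D - 1 - (2 * D - 1 - (j : ℕ)) = j by omega))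
      · rfl
    · rfl
  · rintro (_ | i) j
    · exact (hin 0 1 j).trans (hout 1 2 j).symm
    · rfl
  · intro j
    change Fin (2 * n) at j
    show hangOut (stack 2 (.nat D)) n j = Sum.map _ _ (hangOut (ringId D) n j)
    unfold hangOut
    split_ifs with h
    · refine congrArg Sum.inl ?_
      exact (stackStr_of_lt 2 0 2 (by omega) h).trans
        (stackStr_of_lt 2 0 1 (by omega) h).symm
    · rfl
  · exact fun j => (houtU j).trans (hout 0 1 j).symm
  · rintro (_ | k) j j' h
    · obtain rfl := Fin.ext h
      change Fin (2 * n) at j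
      show hangIn (stack 2 (.nat D)) n j = Sum.map _ _ (hangIn (ringId D) n j)
      unfold hangIn
      split_ifs with h
      · refine congrArg Sum.inl ?_
        exact (stackStr_of_ge 2 0 2 (by omega) (by omega)).trans
          (stackStr_of_ge 2 1 2 (by omega) (by omega)).symm
      · rfl
    · fin_cases k <;> obtain rfl := Fin.ext h <;> rfl
  · rintro (_ | k) j j' h
    · obtain rfl := Fin.ext h
      exact (hinU j).trans (hin 1 2 j).symm
    · fin_cases k <;> obtain rfl := Fin.ext h
      · exact congrArg Sum.inl (hfill 0 1 j j.2).symm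
      · exact congrArg Sum.inl (hfill 1 2 j j.2).symm
  · rintro (_ | i) s w
    · change Fin (2 * D) ⊕ Fin (2 * n - D) at s
      rcases s with j | q
      · exact congrArg Sum.inl (stackSide_ring 1 2 j w)
      · have hq := q.2
        exact hgt _ (by simp only [id]; split_ifs <;> omega)
    · exact congrArg Sum.inl (stackSide_ring 0 1 s w)
  · rintro (_ | i) r
    · change Option (Fin (2 * D - 1)) ⊕ Fin (2 * n - 1 - D) at r
      rcases r with r | q
      · exact stackShade_ring 1 2 r
      · rfl
    · exact stackShade_ring 0 1 r
  · rintro (j | q)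
    · exact (σ1 j).trans (g1 j).symm
    · rfl
  · rintro (_ | i) s
    · change Fin (2 * D) ⊕ Fin (2 * n - D) at s
      rcases s with j | q
      · exact σ2 j
      · exact g4 q
    · obtain rfl : i = 0 := Subsingleton.elim _ _
      exact σ1 s
  · rintro (r | q)
    · obtain ⟨⟨j, hj⟩, rfl⟩ := ringReg_surj D r
      exact (ρ1 _).trans (r1 j hj).symm
    · rfl
  · rintro (_ | i) s
    · change Option (Fin (2 * D - 1)) ⊕ Fin (2 * n - 1 - D) at s
      rcases s with r | q
      · exact ρ2 r
      · exact r4 q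
    · obtain rfl : i = 0 := Subsingleton.elim _ _
      exact ρ1 s
  · rintro (⟨l, j⟩ | q)
    · change Fin 3 at l
      change Fin D at j
      have e : (⟨2 * D - 1 - (2 * D - 1 - (j : ℕ)), by omega⟩ : Fin D) = j :=
        Fin.ext (show 2 * D - 1 - (2 * D - 1 - (j : ℕ)) = j by omega)
      fin_cases l
      · exact Or.inr ⟨some 0, (⟨j, by omega⟩ : Fin (2 * D)),
          congrArg Sum.inl (stackStr_of_lt 2 0 1 (by omega) j.2)⟩
      · refine Or.inr ⟨some 0, (⟨2 * D - 1 - j, by omega⟩ : Fin (2 * D)),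
          congrArg Sum.inl ((stackStr_of_ge 2 0 1 (by omega) (by omega)).trans ?_)⟩
        exact congrArg (Prod.mk 1) e
      · refine Or.inr ⟨none, (Sum.inl (⟨2 * D - 1 - j, by omega⟩ : Fin (2 * D)) :
          Fin (2 * D) ⊕ Fin (2 * n - D)),
          congrArg Sum.inl ((stackStr_of_ge 2 1 2 (by omega) (by omega)).trans ?_)⟩
        exact congrArg (Prod.mk 2) e
    · exact Or.inl ⟨(Sum.inr q : Fin (2 * D) ⊕ Fin (2 * n - D)), rfl⟩
  · rintro ((j | ⟨l, q⟩) | q)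
    · change Fin (D + 1) at j
      refine Or.inr ⟨some 0, ringReg D j, congrArg Sum.inl ?_⟩
      exact (hfill 0 1 j (by omega)).trans
        ((stackReg_of_le 0 1 _ (by omega)).trans (cell_eq_inl _ _ (Or.inl rfl)))
    · change Fin (D - 1) at q
      have hq := q.2
      have key : ∀ l : Fin 3, ∀ i : Fin 2, (l : ℕ) = i + 1 →
          cell 2 D l (⟨2 * D - (2 * D - 1 - q), by omega⟩ : Fin (D + 1)) = Sum.inr (i, q) := by
        intro l i h
        unfold cell
        rw [dif_neg (by simp only; omega)]
        refine congrArg Sum.inr (Prod.ext (Fin.ext ?_) (Fin.ext ?_))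
        · simp only; omega
        · simp only; omega
      fin_cases l
      · exact Or.inr ⟨some 0, ringReg D (2 * D - 1 - q), congrArg Sum.inl
          ((hfill 0 1 _ (by omega)).trans ((stackReg_of_ge 0 1 _ (by omega)).trans (key 1 0 rfl)))⟩
      · exact Or.inr ⟨none, (Sum.inl (ringReg D (2 * D - 1 - q)) :
          Option (Fin (2 * D - 1)) ⊕ Fin (2 * n - 1 - D)), congrArg Sum.inl
          ((hfill 1 2 _ (by omega)).trans ((stackReg_of_ge 1 2 _ (by omega)).trans (key 2 1 rfl)))⟩
    · exact Or.inl ⟨(Sum.inr q : Option (Fin (2 * D - 1)) ⊕ Fin (2 * n - 1 - D)), rfl⟩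

end hangMul

end PreTangle

/-! ### Closing up one of two juxtaposed boxes -/

namespace PreTangle

section closeOne

variable (k : ℕ) (i : Fin 2)

/-- Of two `k`-boxes, the `i`-th is joined straight to the external box and the other is closed up:
the string at a point of one of them. -/
def closeOneStr (p : Fin 2 × Fin (2 * k)) : Fin k ⊕ Fin (2 * k - 0) :=
  if p.1 = i then hangIn (close k) k p.2 else Sum.inl (closeStr k p.2)

/-- Of two `k`-boxes, the `i`-th is joined straight to the external box and the other is closed up:
the region at an interval of one of them. -/
def closeOneReg (b : Fin 2) (j : Fin (2 * k + 1)) : Fin (k + 1) ⊕ Fin (2 * k - 1 - 0) :=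
  if b = i then hangInReg (close k) k j else Sum.inl (closeReg k j)

theorem hangOut_close (j : Fin (2 * k)) : hangOut (close k) k j = Sum.inr j :=
  dif_neg (Nat.not_lt_zero _)

theorem hangIn_close (j : Fin (2 * k)) : hangIn (close k) k j = Sum.inr j :=
  dif_neg (Nat.not_lt_zero _)

theorem closeOneStr_self (j : Fin (2 * k)) : closeOneStr k i (i, j) = hangIn (close k) k j :=
  if_pos rfl

theorem closeOneStr_of_ne {b : Fin 2} (h : b ≠ i) (j : Fin (2 * k)) :
    closeOneStr k i (b, j) = Sum.inl (closeStr k j) := if_neg h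

theorem closeOneReg_self (j : Fin (2 * k + 1)) : closeOneReg k i i j = hangInReg (close k) k j :=
  if_pos rfl

theorem closeOneReg_of_ne {b : Fin 2} (h : b ≠ i) (j : Fin (2 * k + 1)) :
    closeOneReg k i b j = Sum.inl (closeReg k j) := if_neg h

theorem closeReg_last : closeReg k (Fin.last _) = 0 :=
  Fin.ext (show min (2 * k) (2 * k - 2 * k) = 0 by omega)

theorem closeReg_zero : closeReg k 0 = 0 :=
  Fin.ext (Nat.zero_min _)

theorem closeOneReg_zero (b : Fin 2) : closeOneReg k i b 0 = Sum.inl 0 := by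
  by_cases hb : b = i
  · subst hb
    exact closeOneReg_self k b 0
  · rw [closeOneReg_of_ne k i hb, closeReg_zero]

theorem closeOneReg_last (hk : 0 < 2 * k) (b : Fin 2) :
    closeOneReg k i b (Fin.last _) = Sum.inl 0 := by
  by_cases hb : b = i
  · subst hb
    exact (closeOneReg_self k b _).trans (hangInReg_last (close k) hk)
  · rw [closeOneReg_of_ne k i hb, closeReg_last]

theorem shade_closeOneReg (b : Fin 2) (j : Fin (2 * k + 1)) :
    hangShade (close k) k (closeOneReg k i b j) = (Colour.nat k).shadeAt j := by
  by_cases hb : b = i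
  · subst hb
    exact (congrArg _ (closeOneReg_self k b j)).trans
      (shade_hangInReg (close k) k (Nat.le_of_lt_succ j.2))
  · exact (congrArg _ (closeOneReg_of_ne k i hb j)).trans ((close k).shade_reg (some 0) j)

theorem side_closeOneStr (p : Fin 2 × Fin (2 * k)) (w : Bool) :
    hangSide (close k) k (closeOneStr k i p) w = closeOneReg k i p.1
      (if w = (Colour.nat k).shadeAt p.2 then p.2.castSucc else p.2.succ) := by
  obtain ⟨b, j⟩ := p
  by_cases hb : b = i
  · subst hb
    refine (congrArg (hangSide (close k) k · w) (closeOneStr_self k b j)).trans ?_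
    refine Eq.trans ?_ (closeOneReg_self k b _).symm
    by_cases hw : w = (Colour.nat k).shadeAt j
    · rw [if_pos hw, hw]
      exact hangSide_in_before (close k) k j
    · rw [if_neg hw, eq_not_of_ne hw]
      exact hangSide_in_after (close k) k j
  · refine (congrArg (hangSide (close k) k · w) (closeOneStr_of_ne k i hb j)).trans ?_
    refine Eq.trans ?_ (closeOneReg_of_ne k i hb _).symm
    by_cases hw : w = (Colour.nat k).shadeAt j
    · rw [if_pos hw, hw]
      exact congrArg Sum.inl (close_side_before k j)
    · rw [if_neg hw, eq_not_of_ne hw]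
      exact congrArg Sum.inl (close_side_after k j)

/-- The extension of `closeOneReg` to the regions of the juxtaposition. -/
def closeOneFill (q : Option (Fin 2 × Fin (2 * k - 1))) : Fin (k + 1) ⊕ Fin (2 * k - 1 - 0) :=
  q.elim (Sum.inl 0) (fun p => closeOneReg k i p.1 ⟨p.2 + 1, by omega⟩)

theorem closeOneFill_juxtReg (hk : 0 < 2 * k) (b : Fin 2) (j : Fin (2 * k + 1)) :
    closeOneFill k i (juxtReg k b j) = closeOneReg k i b j := by
  unfold juxtReg
  split_ifs with h
  · rcases h with h | h
    · rw [show j = 0 from Fin.ext h, closeOneReg_zero]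
      rfl
    · rw [show j = Fin.last _ from Fin.ext h, closeOneReg_last k i hk]
      rfl
  · exact congrArg (closeOneReg k i b) (Fin.ext (show (j : ℕ) - 1 + 1 = j by omega))

/-- The annulus from a `2 * k`-box to a `k`-box which joins the points of the `i`-th half of the
inner box straight to the external box and closes up the other half. -/
def closeOne (hk : 0 < 2 * k) : PreTangle (fun _ : Fin 1 => Colour.nat (2 * k)) (.nat k) where
  Str := Fin k ⊕ Fin (2 * k - 0)
  Reg := Fin (k + 1) ⊕ Fin (2 * k - 1 - 0)
  shade := hangShade (close k) k
  side := hangSide (close k) k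
  str
    | none => hangOut (close k) k
    | some _ => fun j => closeOneStr k i (juxtOutStr k j)
  reg
    | none => fun j => hangOutReg (close k) k j
    | some _ => fun j => closeOneFill k i (juxtOutReg k j)
  shade_side := ((close k).hang k hk).shade_side
  shade_reg
    | none => ((close k).hang k hk).shade_reg none
    | some _ => fun j => by
      have e : ∀ q, hangShade (close k) k (closeOneFill k i q) = juxtShade k q := by
        rintro (_ | q)
        · exact (congrArg _ (closeOneReg_zero k i 0).symm).trans (shade_closeOneReg k i 0 0)
        · exact shade_closeOneReg k i q.1 _
      exact (e _).trans ((juxt k).shade_reg none j)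
  reg_last
    | none => ((close k).hang k hk).reg_last none
    | some _ => congrArg (closeOneFill k i) ((juxt k).reg_last none)
  side_before
    | none => ((close k).hang k hk).side_before none
    | some _ => fun j => by
      refine (side_closeOneStr k i _ _).trans ?_
      refine (closeOneFill_juxtReg k i hk _ _).symm.trans ?_
      exact congrArg (closeOneFill k i) (juxt_side_before k j)
  side_after
    | none => ((close k).hang k hk).side_after none
    | some _ => fun j => by
      refine (side_closeOneStr k i _ _).trans ?_
      refine (closeOneFill_juxtReg k i hk _ _).symm.trans ?_
      exact congrArg (closeOneFill k i) (juxt_side_after k j)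

/-- The point of the `2 * k`-box which is the `j`-th point of its `b`-th half. -/
def juxtPt (b : Fin 2) (j : Fin (2 * k)) : Fin (2 * (2 * k)) := ⟨2 * k * b + j, by
  fin_cases b <;> simp <;> omega⟩

theorem juxtOutStr_juxtPt (b : Fin 2) (j : Fin (2 * k)) : juxtOutStr k (juxtPt k b j) = (b, j) := by
  fin_cases b <;> simp [juxtOutStr, juxtPt]

theorem juxtPt_juxtOutStr (j : Fin (2 * (2 * k))) :
    juxtPt k (juxtOutStr k j).1 (juxtOutStr k j).2 = j := by
  unfold juxtOutStr
  split_ifs with h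
  · exact Fin.ext (by simp [juxtPt])
  · exact Fin.ext (by simp [juxtPt]; omega)

theorem juxtOutReg_eq (b : Fin 2) (j : Fin (2 * k)) (h : 0 < (j : ℕ)) :
    juxtOutReg k (⟨juxtPt k b j, by omega⟩ : Fin (2 * (2 * k) + 1)) =
        some (b, ⟨j - 1, by omega⟩) := by
  have h1 : ¬ ((j : ℕ) = 0 ∨ (j : ℕ) = 2 * k) := by omega
  fin_cases b
  · have h2 : (j : ℕ) ≤ 2 * k := by omega
    simp [juxtOutReg, juxtPt, juxtReg, h1, h2]
  · have h2 : ¬ 2 * k + (j : ℕ) ≤ 2 * k := by omega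
    simp [juxtOutReg, juxtPt, juxtReg, h1, h2]

theorem leaves_juxtPt {ι : Type} (x : ι) (b : Fin 2) (j : Fin (2 * k)) :
    leaves (some x) (juxtPt k b j) = leaves (some x) j := by
  have : (juxtPt k b j : ℕ) % 2 = (j : ℕ) % 2 := by
    simp only [juxtPt]
    rw [mul_assoc]
    omega
  simp only [leaves, this]

theorem closeOne_isPlanar (hk : 0 < 2 * k) : (closeOne k i hk).IsPlanar where
  finite_box := inferInstance
  finite_str := inferInstanceAs (Finite (Fin k ⊕ Fin (2 * k - 0)))
  finite_reg := inferInstanceAs (Finite (Fin (k + 1) ⊕ Fin (2 * k - 1 - 0)))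
  end_unique := by
    have hs : ∀ (x : Fin 1) (b : Fin 2) (j : Fin (2 * k)),
        (closeOne k i hk).str (some x) (juxtPt k b j) = closeOneStr k i (b, j) := fun x b j =>
      congrArg (closeOneStr k i) (juxtOutStr_juxtPt k b j)
    have hself : ∀ (b : Fin 2) (j : Fin (2 * k)), closeOneStr k b (b, j) = Sum.inr j :=
      fun b j => (closeOneStr_self k b j).trans (hangIn_close k j)
    have mixed : ∀ (x : Fin 1) (j j' : Fin (2 * k)) (b : Fin 2),
        closeOneStr k i (b, j') = Sum.inr j →
            leaves (none : Option (Fin 1)) j ≠ leaves (some x) j' := by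
      intro x j j' b h
      by_cases hb : b = i
      · rw [hb, closeOneStr_self] at h
        obtain rfl := Sum.inr.inj h
        rw [leaves_none_eq x]
        simp
      · rw [closeOneStr_of_ne k i hb] at h
        cases h
    rintro ⟨_ | x, j⟩ ⟨_ | x', j'⟩ hs' hl
    · have h : hangOut (close k) k j = hangOut (close k) k j' := hs'
      have h' : j = j' := Sum.inr.inj
          ((hangOut_close k j).symm.trans (h.trans (hangOut_close k j')))
      rw [h']
    · change Fin (2 * (2 * k)) at j'
      rw [← juxtPt_juxtOutStr k j'] at hs' hl
      rw [leaves_juxtPt] at hl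
      have h := (hs x' _ _).symm.trans (hs'.symm.trans (hangOut_close k j))
      exact absurd hl (mixed _ _ _ _ h)
    · change Fin (2 * (2 * k)) at j
      rw [← juxtPt_juxtOutStr k j] at hs' hl
      rw [leaves_juxtPt] at hl
      have h := (hs x _ _).symm.trans (hs'.trans (hangOut_close k j'))
      exact absurd hl.symm (mixed _ _ _ _ h)
    · obtain rfl : x = x' := Subsingleton.elim _ _
      change Fin (2 * (2 * k)) at j j'
      obtain ⟨b, a, rfl⟩ : ∃ b a, j = juxtPt k b a := ⟨_, _, (juxtPt_juxtOutStr k j).symm⟩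
      obtain ⟨b', a', rfl⟩ : ∃ b a, j' = juxtPt k b a := ⟨_, _, (juxtPt_juxtOutStr k j').symm⟩
      rw [leaves_juxtPt, leaves_juxtPt] at hl
      have h := (hs x _ _).symm.trans (hs'.trans (hs x _ _))
      by_cases hb : b = i <;> by_cases hb' : b' = i
      · subst hb; subst hb'
        rw [Sum.inr.inj ((hself b' a).symm.trans (h.trans (hself b' a')))]
      · subst hb
        cases (hself b a).symm.trans (h.trans (closeOneStr_of_ne k b hb' a'))
      · subst hb'
        cases (closeOneStr_of_ne k b' hb a).symm.trans (h.trans (hself b' a'))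
      · rw [closeOneStr_of_ne _ _ hb, closeOneStr_of_ne _ _ hb'] at h
        have h1 : min (a : ℕ) (2 * k - 1 - a) = min (a' : ℕ) (2 * k - 1 - a') :=
          congrArg Fin.val (Sum.inl.inj h)
        simp only [leaves, decide_eq_decide] at hl
        obtain rfl : a = a' := Fin.ext (by omega)
        obtain rfl : b = b' := by omega
        rfl
  end_partner := by
    have hs : ∀ (x : Fin 1) (b : Fin 2) (j : Fin (2 * k)),
        (closeOne k i hk).str (some x) (juxtPt k b j) = closeOneStr k i (b, j) := fun x b j =>
      congrArg (closeOneStr k i) (juxtOutStr_juxtPt k b j)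
    rintro ⟨_ | x, j⟩
    · refine ⟨⟨some 0, juxtPt k i j⟩, ?_, ?_⟩
      · exact (hs 0 i j).trans ((closeOneStr_self k i j).trans
          ((hangIn_close k j).trans (hangOut_close k j).symm))
      · change Fin (2 * k) at j
        show leaves (some (0 : Fin 1)) (juxtPt k i j) ≠ leaves none (j : ℕ)
        rw [leaves_juxtPt, leaves_none_eq (0 : Fin 1)]
        simp
    · change Fin (2 * (2 * k)) at j
      obtain ⟨b, a, rfl⟩ : ∃ b a, j = juxtPt k b a := ⟨_, _, (juxtPt_juxtOutStr k j).symm⟩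
      by_cases hb : b = i
      · subst hb
        refine ⟨⟨none, a⟩, ?_, ?_⟩
        · exact (hangOut_close k a).trans
            (((closeOneStr_self k b a).trans (hangIn_close k a)).symm.trans (hs x b a).symm)
        · show leaves none (a : ℕ) ≠ leaves (some x) (juxtPt k b a)
          rw [leaves_juxtPt, leaves_none_eq x]
          simp
      · refine ⟨⟨some x, juxtPt k b (⟨2 * k - 1 - a, by omega⟩ : Fin (2 * k))⟩, ?_, ?_⟩
        · refine (hs x b _).trans (Eq.trans ?_ (hs x b a).symm)
          rw [closeOneStr_of_ne _ _ hb, closeOneStr_of_ne _ _ hb]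
          refine congrArg Sum.inl (Fin.ext ?_)
          simp only [closeStr]
          omega
        · show leaves (some x) (juxtPt k b _) ≠ leaves (some x) (juxtPt k b a)
          rw [leaves_juxtPt, leaves_juxtPt]
          simp only [leaves, ne_eq, decide_eq_decide]
          omega
  connected := (hang_isPlanar (close_isPlanar k) k hk (Nat.zero_le k)).connected
  euler := by
    rw [card_joined_of_connected]
    · have hs : Nat.card (closeOne k i hk).Str = k + 2 * k := by
        show Nat.card (Fin k ⊕ Fin (2 * k - 0)) = _
        simp
      have hr : Nat.card (closeOne k i hk).Reg = k + 1 + (2 * k - 1) := by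
        show Nat.card (Fin (k + 1) ⊕ Fin (2 * k - 1 - 0)) = _
        simp
      rw [hs, hr]
      simp
      omega
    · intro x
      refine Quot.sound ⟨juxtPt k i ⟨0, hk⟩, (⟨0, hk⟩ : Fin (2 * k)), ?_⟩
      exact (congrArg (closeOneStr k i) (juxtOutStr_juxtPt k i _)).trans
        ((closeOneStr_self k i _).trans ((hangIn_close k _).trans (hangOut_close k _).symm))

theorem closeOne_tight (hk : 0 < 2 * k) : (closeOne k i hk).Tight where
  str_surj := by
    rintro (s | q)
    · have hne : i + 1 ≠ i := by fin_cases i <;> decide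
      refine ⟨some 0, juxtPt k (i + 1) (⟨s, by omega⟩ : Fin (2 * k)), ?_⟩
      refine (congrArg (closeOneStr k i) (juxtOutStr_juxtPt k _ _)).trans ?_
      refine (closeOneStr_of_ne k i hne _).trans (congrArg Sum.inl (Fin.ext ?_))
      simp only [closeStr]
      omega
    · exact ⟨none, q, hangOut_close k q⟩
  reg_surj := by
    rintro (r | q)
    · by_cases h : (r : ℕ) = 0
      · obtain rfl : r = 0 := Fin.ext h
        exact ⟨none, (0 : Fin (2 * k + 1)), rfl⟩
      · have hne : i + 1 ≠ i := by fin_cases i <;> decide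
        have hr := r.2
        refine ⟨some 0, (⟨juxtPt k (i + 1) (⟨r, by omega⟩ : Fin (2 * k)), by omega⟩ :
          Fin (2 * (2 * k) + 1)), ?_⟩
        refine (congrArg (closeOneFill k i) (juxtOutReg_eq k _ _ (Nat.pos_of_ne_zero h))).trans ?_
        refine (if_neg hne).trans (congrArg Sum.inl (Fin.ext ?_))
        simp only [closeReg]
        omega
    · refine ⟨none, (⟨q + 1, by omega⟩ : Fin (2 * k + 1)), ?_⟩
      show hangOutReg (close k) k (q + 1) = _
      have h2 : (q : ℕ) + 1 < 2 * k := by omega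
      simp [hangOutReg, h2]
      rfl

/-- The two boxes of a juxtaposition, the `i`-th one first. -/
def twoBoxes : Option (Fin 1) ≃ (_ : Fin 1) × Fin 2 where
  toFun o := ⟨0, o.elim i (fun _ => i + 1)⟩
  invFun p := if p.2 = i then none else some 0
  left_inv := by
    have hne : i + 1 ≠ i := by fin_cases i <;> decide
    rintro (_ | x)
    · simp
    · simp [hne]
      exact Subsingleton.elim _ _
  right_inv := by
    rintro ⟨x, b⟩
    obtain rfl : x = 0 := Subsingleton.elim _ _
    by_cases h : b = i
    · simp [h]
    · simp only [h, if_false, Option.elim_some]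
      congr 1
      omega

/-- Closing up one of two juxtaposed boxes leaves the other one next to a trace. -/
def reIso_closeOne (hk : 0 < 2 * k) :
    ReIso ((closeOne k i hk).comp (fun _ : Fin 1 => juxt k))
    ((close k).hang k hk) (twoBoxes i) := by
  have hne : i + 1 ≠ i := by fin_cases i <;> decide
  let C := closeOne k i hk
  let S := fun _ : Fin 1 => juxt k
  refine ReIso.comp (twoBoxes i) (by rintro (_ | _) <;> rfl) (closeOne_tight k i hk)
    (fT := id) (fS := fun _ => closeOneStr k i) (gT := id) (gS := fun _ => closeOneFill k i)
    (f_glue := fun _ _ => rfl) (g_glue := fun _ _ => rfl) (f_none := fun _ => rfl)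
    (g_none := fun _ => rfl)
    (f_some := ?_) (g_some := ?_)
    (sideS := fun _ s w => ?_) (shadeS := fun _ r => ?_)
    (σ := outerStr C S) (ρ := outerReg C S) (σT := fun _ => rfl) (σS := ?_) (ρT := fun _ => rfl)
    (ρS := ?_) (f_surj := fun s => Or.inl ⟨s, rfl⟩) (g_surj := fun s => Or.inl ⟨s, rfl⟩)
  · rintro (_ | x) j j' h
    · obtain rfl := Fin.ext h
      exact (if_pos rfl).symm
    · obtain rfl := Fin.ext h
      obtain rfl : x = 0 := Subsingleton.elim _ _
      exact (if_neg hne).symm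
  · rintro (_ | x) j j' h
    · obtain rfl := Fin.ext h
      exact ((closeOneFill_juxtReg k i hk i j).trans (if_pos rfl)).symm
    · obtain rfl := Fin.ext h
      obtain rfl : x = 0 := Subsingleton.elim _ _
      exact ((closeOneFill_juxtReg k i hk (i + 1) j).trans (if_neg hne)).symm
  · exact (side_closeOneStr k i s w).trans (closeOneFill_juxtReg k i hk _ _).symm
  · rcases r with _ | q
    · exact (congrArg _ (closeOneReg_zero k i 0).symm).trans (shade_closeOneReg k i 0 0)
    · exact shade_closeOneReg k i q.1 _
  · rintro x ⟨b, j⟩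
    have := outerStr_eq C S x (juxtPt k b j)
    refine Eq.trans (congrArg (outerStr C S) ?_) (this.trans (congrArg (innerStr C S x) ?_))
    · exact congrArg (closeOneStr k i) (juxtOutStr_juxtPt k b j).symm
    · exact juxtOutStr_juxtPt k b j
  · rintro x (_ | ⟨b, j⟩)
    · exact outerReg_eq C S x (0 : Fin (2 * (2 * k) + 1))
    · have e := juxtOutReg_eq k b ⟨j + 1, by omega⟩ (Nat.succ_pos _)
      have := outerReg_eq C S x (⟨juxtPt k b ⟨j + 1, by omega⟩, by omega⟩ : Fin (2 * (2 * k) + 1))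
      refine Eq.trans (congrArg (outerReg C S) ?_) (this.trans (congrArg (innerReg C S x) ?_))
      · exact congrArg (closeOneFill k i) e.symm
      · exact e

end closeOne

section adjClose

/-- The trace tangle is symmetric. -/
def reIso_close_adj (n : ℕ) : ReIso (close n).adj (close n) (Equiv.refl _) where
  color _ := rfl
  strEquiv := Equiv.refl _
  regEquiv := Equiv.refl _
  map_shade _ := rfl
  map_side _ _ := rfl
  map_str := by
    rintro (_ | k) j j' h <;> obtain rfl := Fin.ext h
    · exact absurd j.2 (by simp [Colour.size])
    · change Fin (2 * n) at j
      exact Fin.ext (show min (j : ℕ) (2 * n - 1 - j) =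
        min (2 * n - (j + 1)) (2 * n - 1 - (2 * n - (j + 1))) by omega)
  map_reg := by
    rintro (_ | k) j j' h <;> obtain rfl := Fin.ext h
    · rfl
    · change Fin (2 * n + 1) at j
      exact Fin.ext (show min (j : ℕ) (2 * n - j) =
        min (2 * n + 1 - (j + 1)) (2 * n - (2 * n + 1 - (j + 1))) by omega)

end adjClose

end PreTangle

/-! ### Closed loops, and boxes without marked points -/

namespace PreTangle

section loop

variable {ι : Type} {c : ι → Colour}

theorem addLoop_isPlanar {c₀ : Colour} {T : PreTangle c c₀} (hT : T.IsPlanar) (r : T.Reg) :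
    (T.addLoop r).IsPlanar where
  finite_box := hT.finite_box
  finite_str := by
    have := hT.finite_str
    exact inferInstanceAs (Finite (Option T.Str))
  finite_reg := by
    have := hT.finite_reg
    exact inferInstanceAs (Finite (Option T.Reg))
  end_unique E E' hs hl := hT.end_unique E E' (Option.some.inj hs) hl
  end_partner E := by
    obtain ⟨E', hs, hl⟩ := hT.end_partner E
    exact ⟨E', congrArg some hs, hl⟩
  connected := by
    have key : ∀ q q' : T.Reg, Relation.EqvGen T.Adjacent q q' →
        Relation.EqvGen (T.addLoop r).Adjacent
            (some q : Option T.Reg) (some q' : Option T.Reg) := by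
      intro q q' h
      induction h with
      | rel _ _ h =>
        obtain ⟨s, rfl, rfl⟩ := h
        exact Relation.EqvGen.rel _ _ ⟨(some s : Option T.Str), rfl, rfl⟩
      | refl => exact Relation.EqvGen.refl _
      | symm _ _ _ ih => exact Relation.EqvGen.symm _ _ ih
      | trans _ _ _ _ _ ih ih' => exact Relation.EqvGen.trans _ _ _ ih ih'
    have new : ∀ q : (T.addLoop r).Reg,
        Relation.EqvGen (T.addLoop r).Adjacent q (some r : Option T.Reg) := by
      rintro (_ | q)
      · have h := eqvGen_side (T.addLoop r) (none : Option T.Str) (!T.shade r) (T.shade r)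
        have e1 : (T.addLoop r).side (none : Option T.Str) (!T.shade r) =
            (none : Option T.Reg) := if_neg (Bool.not_ne_self _)
        have e2 : (T.addLoop r).side (none : Option T.Str) (T.shade r) =
            (some r : Option T.Reg) := if_pos rfl
        rwa [e1, e2] at h
      · exact key q r (hT.connected q r)
    exact fun q q' => Relation.EqvGen.trans _ _ _ (new q) (Relation.EqvGen.symm _ _ (new q'))
  euler := by
    have := hT.finite_str
    have := hT.finite_reg
    have hs : Nat.card (T.addLoop r).Str = Nat.card T.Str + 1 := Finite.card_option
    have hr : Nat.card (T.addLoop r).Reg = Nat.card T.Reg + 1 := Finite.card_option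
    have hq : Nat.card (Quot (T.addLoop r).Joined) = Nat.card (Quot T.Joined) :=
      Nat.card_congr (Quot.congr (Equiv.refl _) fun b b' =>
        ⟨fun ⟨j, j', h⟩ => ⟨j, j', Option.some.inj h⟩, fun ⟨j, j', h⟩ => ⟨j, j', congrArg some h⟩⟩)
    rw [hs, hr, hq]
    have := hT.euler
    omega

variable {n : ℕ} (T : PreTangle c (.nat n))

/-- Capping off a newly inserted cap gives a closed loop. -/
def reIso_addLoop (p : ℕ) (hp : p ≤ 2 * n) :
    ReIso ((capOff n p hp).comp (fun _ : Fin 1 => T.addCap p hp))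
      (T.addLoop (T.reg none (⟨p, Nat.lt_succ_of_le hp⟩ : Fin (2 * n + 1)))) (boxOne ι) := by
  let C := capOff n p hp
  let S := fun _ : Fin 1 => T.addCap p hp
  have hstr : ∀ (m : ℕ) (hm : m < 2 * (n + 1)),
      outerStr C S (capStr (ringId n) p hp (⟨m, hm⟩ : Fin (2 * (n + 1)))) =
        innerStr C S 0 (capStr T p hp (⟨m, hm⟩ : Fin (2 * (n + 1)))) :=
    fun m hm => outerStr_eq C S 0 (⟨m, hm⟩ : Fin (2 * (n + 1)))
  have hreg : ∀ (m : ℕ) (hm : m < 2 * (n + 1) + 1),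
      outerReg C S (capReg (ringId n) p hp (⟨m, hm⟩ : Fin (2 * (n + 1) + 1))) =
        innerReg C S 0 (capReg T p hp (⟨m, hm⟩ : Fin (2 * (n + 1) + 1))) :=
    fun m hm => outerReg_eq C S 0 (⟨m, hm⟩ : Fin (2 * (n + 1) + 1))
  refine ReIso.comp (boxOne ι) (fun _ => rfl) (capOff_tight n p hp)
    (fT := fun s : Option (Fin (2 * n)) => s.map (T.str none))
    (fS := fun _ (s : Option T.Str) => s)
    (gT := fun r : Option (Option (Fin (2 * n - 1))) => r.map (ringFill n (T.reg none)))
    (gS := fun _ (r : Option T.Reg) => r)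
    (f_glue := fun _ j => ?_)
    (g_glue := fun _ j => ?_)
    (f_none := fun _ => rfl)
    (g_none := fun j => congrArg some (ringFill_ringReg (T.reg_last none) j).symm)
    (f_some := fun k j j' h => by obtain rfl := Fin.ext h; rfl)
    (g_some := fun k j j' h => by obtain rfl := Fin.ext h; rfl)
    (sideS := fun _ s w => ?_)
    (shadeS := fun _ r => ?_)
    (σ := innerStr C S 0)
    (ρ := innerReg C S 0)
    (σT := ?_)
    (σS := fun i s => by rw [Subsingleton.elim i 0])
    (ρT := ?_)
    (ρS := fun i s => by rw [Subsingleton.elim i 0])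
    (f_surj := fun s => Or.inr ⟨0, s, rfl⟩)
    (g_surj := fun s => Or.inr ⟨0, s, rfl⟩)
  · show Option.map _ (capStr (ringId n) p hp j) = capStr T p hp j
    unfold capStr
    split_ifs <;> rfl
  · show Option.map _ (capReg (ringId n) p hp j) = capReg T p hp j
    unfold capReg
    split_ifs
    · exact congrArg some (ringFill_ringReg (T.reg_last none) _)
    · rfl
    · exact congrArg some (ringFill_ringReg (T.reg_last none) _)
  · rcases s with _ | s
    · have e : T.shade (T.reg none (⟨p, Nat.lt_succ_of_le hp⟩ : Fin (2 * n + 1))) =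
          (Colour.nat n).shadeAt p := T.shade_reg none _
      show (if w = T.shade (T.reg none (⟨p, Nat.lt_succ_of_le hp⟩ : Fin (2 * n + 1))) then
        some (T.reg none (⟨p, Nat.lt_succ_of_le hp⟩ : Fin (2 * n + 1))) else none) = _
      rw [e]
      rfl
    · rfl
  · rcases r with _ | r
    · exact congrArg not (T.shade_reg none (⟨p, Nat.lt_succ_of_le hp⟩ : Fin (2 * n + 1)))
    · rfl
  · rintro (_ | j)
    · have := hstr p (by omega)
      rw [capStr_mid (ringId n) hp _ (Or.inl rfl), capStr_mid T hp _ (Or.inl rfl)] at this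
      exact this.symm
    · change Fin (2 * n) at j
      by_cases h : (j : ℕ) < p
      · have := hstr j (by omega)
        rw [capStr_of_lt (ringId n) hp _ h, capStr_of_lt T hp _ h] at this
        exact this.symm
      · have := hstr (j + 2) (by omega)
        rw [capStr_add_two (ringId n) hp j.2 (by omega), capStr_add_two T hp j.2 (by omega)] at this
        exact this.symm
  · rintro (_ | q)
    · have := hreg (p + 1) (by omega)
      rw [capReg_mid (ringId n) hp, capReg_mid T hp] at this
      exact this.symm
    · obtain ⟨j, rfl⟩ := ringReg_surj n q
      refine (congrArg (fun r => innerReg C S 0 (some r : Option T.Reg))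
        (ringFill_ringReg (T.reg_last none) j)).trans ?_
      by_cases h : (j : ℕ) ≤ p
      · have := hreg j (by omega)
        rw [capReg_of_le (ringId n) hp _ h, capReg_of_le T hp _ h] at this
        exact this.symm
      · have := hreg (j + 2) (by omega)
        rw [capReg_add_two (ringId n) hp j.2 (by omega), capReg_add_two T hp j.2 (by omega)] at this
        exact this.symm

end loop

section sizeZero

theorem isEmpty_stack_str {c : Colour} (hc : c.size = 0) (m : ℕ) : IsEmpty (stack m c).Str :=
  ⟨fun s : Fin (m + 1) × Fin c.size => (Fin.cast hc s.2).elim0⟩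

theorem subsingleton_stack_reg {c : Colour} (hc : c.size = 0) (m : ℕ) :
    Subsingleton (stack m c).Reg := by
  have h : ∀ r : Fin (c.size + 1) ⊕ (Fin m × Fin (c.size - 1)), r = Sum.inl 0 := by
    rintro (j | q)
    · exact congrArg Sum.inl (Fin.ext (by simp only [Fin.val_zero]; omega))
    · exact absurd q.2.2 (by omega)
  exact ⟨fun r r' => (h r).trans (h r').symm⟩

/-- The box left when the second of two boxes is filled with a diagram without boxes. -/
def boxFirst : Fin 1 ≃ (i : Fin 2) × Fin (1 - i) where
  toFun _ := ⟨0, 0⟩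
  invFun _ := 0
  left_inv _ := Subsingleton.elim _ _
  right_inv := by
    rintro ⟨i, j⟩
    fin_cases i
    · exact congrArg (Sigma.mk _) (Subsingleton.elim (α := Fin 1) _ _)
    · exact j.elim0

/-- The unit law for boxes without marked points. -/
def reIso_mul_one {c : Colour} (hc : c.size = 0) :
    ReIso ((stack 2 c).comp (fun i : Fin 2 => stack (1 - i) c)) (stack 1 c) boxFirst := by
  have hs := isEmpty_stack_str hc
  have hr := subsingleton_stack_reg hc
  let T := stack 2 c
  let S := fun i : Fin 2 => stack (1 - i) c
  let z (m : ℕ) : (stack m c).Reg :=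
    (Sum.inl 0 : Fin (c.size + 1) ⊕ (Fin m × Fin (c.size - 1)))
  have hz : ∀ m (r : (stack m c).Reg), (stack m c).shade r = c.shadeAt 0 := fun m r =>
    congrArg _ (Subsingleton.elim r (z m))
  have hTr : ∀ r : T.Reg, r = T.reg none 0 := fun r => Subsingleton.elim _ _
  refine ReIso.comp boxFirst (fun _ => rfl)
      ⟨fun s => (hs 2).elim s, fun r => ⟨none, 0, (hTr r).symm⟩⟩
    (fT := fun s => (hs 2).elim s) (fS := fun i s => (hs _).elim s)
    (gT := fun _ => z 1) (gS := fun _ _ => z 1)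
    (f_glue := fun i j => (hs 1).elim (stackStr 1 c 0 0 j)) (g_glue := fun _ _ => rfl)
    (f_none := fun j => (hs 1).elim (stackStr 1 c 0 0 j))
    (g_none := fun j => Subsingleton.elim _ _)
    (f_some := fun k j _ _ => (hs 1).elim (stackStr 1 c 0 0 j))
    (g_some := fun k j _ _ => Subsingleton.elim _ _)
    (sideS := fun i s => (hs _).elim s) (shadeS := fun i r => (hz 1 _).trans (hz _ r).symm)
    (σ := fun s => (hs 1).elim s) (ρ := fun _ => outerReg T S (T.reg none 0))
    (σT := fun s => (hs 2).elim s) (σS := fun i s => (hs _).elim s)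
    (ρT := fun r => congrArg (outerReg T S) (hTr r).symm)
    (ρS := fun i r => ?_) (f_surj := fun s => (hs 1).elim s)
    (g_surj := fun r => Or.inl ⟨z 2, Subsingleton.elim _ _⟩)
  have := outerReg_eq T S i 0
  refine (congrArg (outerReg T S) (hTr _).symm).trans (this.trans (congrArg (innerReg T S i) ?_))
  exact (hr _).elim _ _

end sizeZero

end PreTangle

/-! ### Relations in a planar algebra -/

namespace Tangle

/-- The identity tangle in the form of an annulus. -/
def ring (n : ℕ) : Tangle (fun _ : Fin 1 => Colour.nat n) (.nat n) :=
  ⟨_, PreTangle.ringId_isPlanar n⟩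

/-- The annulus which inserts a cap at the points `p`, `p + 1`. -/
def cap (n p : ℕ) (hp : p ≤ 2 * n) : Tangle (fun _ : Fin 1 => Colour.nat n) (.nat (n + 1)) :=
  ⟨_, PreTangle.addCap_isPlanar (PreTangle.ringId_isPlanar n) hp⟩

/-- The annulus which caps off the points `p`, `p + 1`. -/
def capOff (n p : ℕ) (hp : p ≤ 2 * n) : Tangle (fun _ : Fin 1 => Colour.nat (n + 1)) (.nat n) :=
  ⟨_, PreTangle.capOff_isPlanar n p hp⟩

/-- A tangle with an `n`-box hung below it. -/
def hang {κ : Type} {d : κ → Colour} {D : ℕ} (S : Tangle d (.nat D)) {n : ℕ} (hn : D < 2 * n)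
    (hD : D ≤ n) : Tangle (boxColour d (.nat n)) (.nat n) :=
  ⟨_, PreTangle.hang_isPlanar S.planar n hn hD⟩

/-- The annulus from a `2 * k`-box to a `k`-box which closes up one half of the points. -/
def closeOne (k : ℕ) (i : Fin 2) (hk : 0 < 2 * k) :
    Tangle (fun _ : Fin 1 => Colour.nat (2 * k)) (.nat k) :=
  ⟨_, PreTangle.closeOne_isPlanar k i hk⟩

/-- The tangles substituted for the hanging box and for the diagram it hangs from. -/
def hangFamily {κ₁ κ₀ : Type} {d₁ : κ₁ → Colour} {d₀ : κ₀ → Colour} {n D : ℕ}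
    (R : Tangle d₁ (.nat n)) (S : Tangle d₀ (.nat D)) (o : Option (Fin 1)) :
    Tangle (PreTangle.hangColour d₁ d₀ o) (boxColour (fun _ : Fin 1 => Colour.nat D) (.nat n) o) :=
  ⟨PreTangle.hangFamily R.toPreTangle S.toPreTangle o, by
    cases o
    exacts [R.planar, S.planar]⟩

end Tangle

namespace PlanarAlgebra

variable (P : PlanarAlgebra.{u})

/-- The annulus acts as the identity. -/
theorem Z_ring {n : ℕ} (x : P.V (.nat n)) : P.Z (Tangle.ring n) (fun _ => x) = x := by
  rw [← P.Z_of_reIso (T := Tangle.ring n) (U := Tangle.ident (.nat n)) (PreTangle.reIso_ringId n)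
    (fun _ => x) (fun _ => x) (fun _ => HEq.rfl), P.Z_ident]

/-- Insert a cap at the points `p`, `p + 1`. -/
def cap {n : ℕ} (p : ℕ) (hp : p ≤ 2 * n) (x : P.V (.nat n)) : P.V (.nat (n + 1)) :=
  P.Z (Tangle.cap n p hp) (fun _ => x)

/-- Cap off the points `p`, `p + 1`. -/
def capOff {n : ℕ} (p : ℕ) (hp : p ≤ 2 * n) (x : P.V (.nat (n + 1))) : P.V (.nat n) :=
  P.Z (Tangle.capOff n p hp) (fun _ => x)

/-- The elements in the boxes of a tangle with a box hung below it. -/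
def hangArg {κ : Type} {d : κ → Colour} {n : ℕ} (x : (k : κ) → P.V (d k)) (z : P.V (.nat n)) :
    (o : Option κ) → P.V (boxColour d (.nat n) o)
  | none => z
  | some k => x k

/-- The element `z` hung below `w`: the product of `w` and `z` for boxes of different sizes, where
the upper points of `z` beyond those of `w` and all its lower points are joined straight to the
external box. -/
def hang {D n : ℕ} (hn : D < 2 * n) (hD : D ≤ n) (w : P.V (.nat D)) (z : P.V (.nat n)) :
    P.V (.nat n) :=
  P.Z ((Tangle.ring D).hang hn hD) (P.hangArg (fun _ => w) z)

/-- The elements in the boxes of a composite as in `Tangle.hangFamily`. -/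
def familyArg {κ₁ κ₀ : Type} {d₁ : κ₁ → Colour} {d₀ : κ₀ → Colour} (y : (k : κ₁) → P.V (d₁ k))
    (x : (k : κ₀) → P.V (d₀ k)) :
    (p : (o : Option (Fin 1)) × PreTangle.HangBox κ₁ κ₀ o) →
    P.V (PreTangle.hangColour d₁ d₀ p.1 p.2)
  | ⟨none, k⟩ => y k
  | ⟨some _, k⟩ => x k

theorem Z_familyArg {κ₁ κ₀ : Type} {d₁ : κ₁ → Colour} {d₀ : κ₀ → Colour} {n D : ℕ}
    (R : Tangle d₁ (.nat n)) (S : Tangle d₀ (.nat D)) (y : (k : κ₁) → P.V (d₁ k))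
    (x : (k : κ₀) → P.V (d₀ k)) :
    (fun o => P.Z (Tangle.hangFamily R S o) (fun k => P.familyArg y x ⟨o, k⟩)) =
      P.hangArg (fun _ => P.Z S x) (P.Z R y) := by
  funext o
  cases o <;> rfl

variable {D n : ℕ} (hn : D < 2 * n) (hD : D ≤ n)

/-- A tangle with a box hung below it evaluates to the hanging of an element from its value. -/
theorem Z_hang {κ : Type} {d : κ → Colour} (S : Tangle d (.nat D)) (x : (k : κ) → P.V (d k))
    (z : P.V (.nat n)) : P.Z (S.hang hn hD) (P.hangArg x z) = P.hang hn hD (P.Z S x) z := by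
  have h := P.Z_of_reIso_comp (T := (Tangle.ring D).hang hn hD)
    (S := Tangle.hangFamily (Tangle.ring n) S) (U := S.hang hn hD)
    (PreTangle.reIso_hang S.toPreTangle hn hD) (P.familyArg (fun _ => z) x) (P.hangArg x z)
    (by rintro (_ | k) <;> exact HEq.rfl)
  rw [Z_familyArg, Z_ring] at h
  exact h

theorem hang_one (z : P.V (.nat n)) : P.hang hn hD (P.one _) z = z := by
  refine (P.Z_hang hn hD (Tangle.one (.nat D)) _ z).symm.trans ?_
  rw [← P.Z_of_reIso (T := (Tangle.one (.nat D)).hang hn hD) (U := Tangle.ring n)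
    (PreTangle.reIso_hang_one n D hn) _ (fun _ => z) (fun _ => HEq.rfl), Z_ring]

/-- With `hang_one`, `hang_add` and `hang_smul`: hanging makes `P_n` a module over `P_D`. -/
theorem hang_mul (v w : P.V (.nat D)) (z : P.V (.nat n)) :
    P.hang hn hD (P.mul v w) z = P.hang hn hD v (P.hang hn hD w z) := by
  refine (P.Z_hang hn hD (Tangle.mul (.nat D)) _ z).symm.trans ?_
  have h := P.Z_of_reIso_comp (T := (Tangle.ring D).hang hn hD)
    (S := Tangle.hangFamily ((Tangle.ring D).hang hn hD) (Tangle.ring D))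
    (U := (Tangle.mul (.nat D)).hang hn hD)
    (PreTangle.reIso_hang_mul hn hD) (P.familyArg (P.hangArg (fun _ => w) z) (fun _ => v))
    (P.hangArg ![v, w] z) (by
      rintro (_ | k)
      · exact HEq.rfl
      · fin_cases k <;> exact HEq.rfl)
  rw [Z_familyArg, Z_ring] at h
  exact h

theorem hang_add (v w : P.V (.nat D)) (z : P.V (.nat n)) :
    P.hang hn hD (v + w) z = P.hang hn hD v z + P.hang hn hD w z := by
  have h := (P.Z ((Tangle.ring D).hang hn hD)).map_update_add
      (P.hangArg (fun _ => v) z) (some 0) v w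
  have e : ∀ w, Function.update (P.hangArg (fun _ : Fin 1 => v) z) (some 0) w =
      P.hangArg (fun _ : Fin 1 => w) z := by
    intro w
    funext o
    rcases o with _ | i
    · rfl
    · obtain rfl : i = 0 := Subsingleton.elim _ _
      exact Function.update_self _ _ _
  exact (congrArg _ (e _)).symm.trans (h.trans
    (congrArg₂ (· + ·) (congrArg _ (e v)) (congrArg _ (e w))))

theorem hang_smul (a : ℂ) (w : P.V (.nat D)) (z : P.V (.nat n)) :
    P.hang hn hD (a • w) z = a • P.hang hn hD w z := by
  have h := (P.Z ((Tangle.ring D).hang hn hD)).map_update_smul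
      (P.hangArg (fun _ => w) z) (some 0) a w
  have e : ∀ w', Function.update (P.hangArg (fun _ : Fin 1 => w) z) (some 0) w' =
      P.hangArg (fun _ : Fin 1 => w') z := by
    intro w
    funext o
    rcases o with _ | i
    · rfl
    · obtain rfl : i = 0 := Subsingleton.elim _ _
      exact Function.update_self _ _ _
  exact (congrArg _ (e _)).symm.trans (h.trans (congrArg (a • ·) (congrArg _ (e w))))

/-- An element below the Jones projection: two of its points are capped off, and a cap is added. -/
theorem hang_jones {n m : ℕ} (h : m + 2 < 2 * (n + 1)) (h' : m + 2 ≤ n + 1) (hm : m ≤ 2 * n)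
    (z : P.V (.nat (n + 1))) :
    P.hang h h' (P.jones m) z = P.cap m hm (P.capOff m hm z) := by
  let U : Tangle (fun _ : Fin 1 => Colour.nat (n + 1)) (.nat (n + 1)) :=
    ⟨_, PreTangle.addCap_isPlanar (PreTangle.capOff_isPlanar n m hm) hm⟩
  refine (P.Z_hang h h' (Tangle.jones m) _ z).symm.trans ?_
  rw [← P.Z_of_reIso (T := (Tangle.jones m).hang h h') (U := U)
    (PreTangle.reIso_hang_jones n m h') _ (fun _ => z) (fun _ => HEq.rfl)]
  exact P.Z_of_reIso_comp (T := Tangle.cap n m hm) (S := fun _ : Fin 1 => Tangle.capOff n m hm)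
    (U := U) (PreTangle.reIso_addCap (PreTangle.capOff n m hm) m hm) (fun _ => z) (fun _ => z)
    (fun _ => HEq.rfl)

/-- Closing up one of two juxtaposed elements. -/
theorem closeOne_juxt {k : ℕ} (hk : 0 < 2 * k) (i : Fin 2) (x : Fin 2 → P.V (.nat k)) :
    P.Z (Tangle.closeOne k i hk) (fun _ => P.Z (Tangle.juxt k) x) =
      P.hang hk (Nat.zero_le k) (P.Z (Tangle.trace k) (fun _ => x (i + 1))) (x i) := by
  rw [← P.Z_hang]
  exact (P.Z_of_reIso_comp (T := Tangle.closeOne k i hk) (S := fun _ : Fin 1 => Tangle.juxt k)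
    (U := (Tangle.trace k).hang hk (Nat.zero_le k)) (PreTangle.reIso_closeOne k i hk)
    (fun p => x p.2) (P.hangArg (fun _ => x (i + 1)) (x i))
    (by rintro (_ | k) <;> exact HEq.rfl)).symm

theorem mul_one_of_size_eq_zero {c : Colour} (hc : c.size = 0) (x : P.V c) :
    P.mul x (P.one c) = x := by
  have h := P.Z_of_reIso_comp (T := Tangle.mul c)
    (S := fun i : Fin 2 => ⟨_, PreTangle.stack_isPlanar (1 - i) c⟩) (U := Tangle.ident c)
    (PreTangle.reIso_mul_one hc) (fun _ => x) (fun _ => x) (fun _ => HEq.rfl)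
  rw [P.Z_ident] at h
  refine Eq.trans (congrArg (P.Z (Tangle.mul c)) ?_) h.symm
  funext i
  fin_cases i
  · exact (P.Z_ident c x).symm
  · refine congrArg (P.Z (Tangle.one c)) ?_
    funext j
    exact j.elim0

/-- The trace tangle is its own reflection. -/
theorem trace_adj {k : ℕ} (x : Fin 1 → P.V (.nat k)) :
    P.Z (Tangle.trace k).adj x = P.Z (Tangle.trace k) x :=
  (P.Z_of_reIso (T := (Tangle.trace k).adj) (U := Tangle.trace k) (PreTangle.reIso_close_adj k)
    x x (fun _ => HEq.rfl)).symm

end PlanarAlgebra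

namespace SubfactorPlanarAlgebra

variable (P : SubfactorPlanarAlgebra.{u})

/-- Capping off an inserted cap creates a closed loop. -/
theorem capOff_cap {n : ℕ} (p : ℕ) (hp : p ≤ 2 * n) (x : P.V (.nat n)) :
    P.capOff p hp (P.cap p hp x) = (P.δ : ℂ) • x := by
  let r : (Tangle.ring n).Reg :=
    (Tangle.ring n).reg none (⟨p, Nat.lt_succ_of_le hp⟩ : Fin (2 * n + 1))
  let U : Tangle (fun _ : Fin 1 => Colour.nat n) (.nat n) :=
    ⟨_, PreTangle.addLoop_isPlanar (Tangle.ring n).planar r⟩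
  have h := P.Z_of_reIso_comp (T := Tangle.capOff n p hp) (S := fun _ : Fin 1 => Tangle.cap n p hp)
    (U := U) (PreTangle.reIso_addLoop (PreTangle.ringId n) p hp) (fun _ => x) (fun _ => x)
    (fun _ => HEq.rfl)
  refine h.symm.trans ?_
  rw [P.modulus (Tangle.ring n) U r ⟨⟨Equiv.refl _, Equiv.refl _, fun _ => rfl, fun _ _ => rfl,
    fun _ _ => rfl, fun _ _ => rfl⟩⟩, P.Z_ring]

end SubfactorPlanarAlgebra

/-! ### Planar subalgebras containing a generator of `P_k` -/

namespace PlanarAlgebra.Subalgebra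

variable {P : PlanarAlgebra.{u}} (Q : P.Subalgebra)

theorem hang_mem {D n : ℕ} (hn : D < 2 * n) (hD : D ≤ n) {w : P.V (.nat D)} {z : P.V (.nat n)}
    (hw : w ∈ Q.carrier _) (hz : z ∈ Q.carrier _) : P.hang hn hD w z ∈ Q.carrier _ :=
  Q.Z_mem _ _ (by rintro (_ | i); exacts [hz, hw])

theorem one_mem (c : Colour) : P.one c ∈ Q.carrier c :=
  Q.Z_mem _ _ fun i => i.elim0

theorem mul_mem {c : Colour} {x y : P.V c} (hx : x ∈ Q.carrier c) (hy : y ∈ Q.carrier c) :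
    P.mul x y ∈ Q.carrier c :=
  Q.Z_mem _ _ fun i => by fin_cases i; exacts [hx, hy]

/-- A planar subalgebra which contains all elements of the colours up to the depth contains
everything of higher colour. -/
theorem carrier_succ_eq_top {m n : ℕ}
    (hd : Submodule.span ℂ {z : P.V (.nat (m + 2)) | ∃ x y : P.V (.nat (m + 1)),
      z = P.mul (P.mul (P.incl x) (P.jones m)) (P.incl y)} = ⊤) (hmn : m + 1 ≤ n)
    (hm : Q.carrier (.nat (m + 1)) = ⊤) (hn : Q.carrier (.nat n) = ⊤) :
    Q.carrier (.nat (n + 1)) = ⊤ := by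
  have h1 : m + 2 < 2 * (n + 1) := by omega
  have h2 : m + 2 ≤ n + 1 := by omega
  have h3 : m ≤ 2 * n := by omega
  have hincl : ∀ a : P.V (.nat (m + 1)), P.incl a ∈ Q.carrier _ := fun a =>
    Q.Z_mem _ _ fun _ => hm ▸ Submodule.mem_top
  refine Submodule.eq_top_iff'.mpr fun z => ?_
  -- write the unit which `z` may be hung from as a combination of products `a E b`
  have key : ∀ w ∈ (⊤ : Submodule ℂ (P.V (.nat (m + 2)))), P.hang h1 h2 w z ∈ Q.carrier _ := by
    rw [← hd]
    intro w hw
    induction hw using Submodule.span_induction with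
    | mem w hw =>
      obtain ⟨a, b, rfl⟩ := hw
      rw [hang_mul, hang_mul, hang_jones P h1 h2 h3]
      exact Q.hang_mem h1 h2 (hincl a) (Q.Z_mem _ _ fun _ => hn ▸ Submodule.mem_top)
    | zero =>
      have := P.hang_smul h1 h2 0 0 z
      rw [zero_smul, zero_smul] at this
      rw [this]
      exact Submodule.zero_mem _
    | add v w _ _ hv hw =>
      rw [hang_add]
      exact Submodule.add_mem _ hv hw
    | smul a w _ hw =>
      rw [hang_smul]
      exact Submodule.smul_mem _ _ hw
  have := key (P.one _) Submodule.mem_top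
  rwa [hang_one] at this

end PlanarAlgebra.Subalgebra

namespace SubfactorPlanarAlgebra

variable (P : SubfactorPlanarAlgebra.{u})

section star

variable {c : Colour}

theorem star_add (x y : P.V c) : P.star (x + y) = P.star x + P.star y := by
  obtain ⟨A, _, φ, -, h⟩ := P.cstar c
  apply φ.injective
  simp [h]

theorem star_smul (a : ℂ) (x : P.V c) : P.star (a • x) = (starRingEnd ℂ) a • P.star x := by
  obtain ⟨A, _, φ, -, h⟩ := P.cstar c
  apply φ.injective
  simp [h]

theorem star_star (x : P.V c) : P.star (P.star x) = x := by
  obtain ⟨A, _, φ, -, h⟩ := P.cstar c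
  apply φ.injective
  simp [h]

theorem star_zero : P.star (0 : P.V c) = 0 := by
  have := P.star_smul 0 (0 : P.V c)
  simpa using this

end star

theorem one_ne_zero {c : Colour} (hc : c.size = 0) : P.one c ≠ 0 := by
  intro h
  have : Subsingleton (P.V c) := ⟨fun x y => by
    have hz : ∀ x : P.V c, x = 0 := fun x => by
      rw [← P.mul_one_of_size_eq_zero hc x, h]
      exact (P.Z (Tangle.mul c)).map_coord_zero 1 rfl
    rw [hz x, hz y]⟩
  have h1 := P.connected c hc
  rw [Module.finrank_zero_of_subsingleton] at h1
  exact zero_ne_one h1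

theorem exists_smul_one {c : Colour} (hc : c.size = 0) (x : P.V c) : ∃ a : ℂ, x = a • P.one c := by
  obtain ⟨a, ha⟩ := (finrank_eq_one_iff_of_nonzero' _ (P.one_ne_zero hc)).mp (P.connected c hc) x
  exact ⟨a, ha.symm⟩

/-- As the trace tangle is symmetric, the trace of `x*` is the adjoint of that of `x`. -/
theorem trace_star_ne_zero {n : ℕ} {x : P.V (.nat n)} (h : P.Z (Tangle.trace n) (fun _ => x) ≠ 0) :
    P.Z (Tangle.trace n) (fun _ => P.star x) ≠ 0 := by
  intro h'
  apply h
  rw [← P.star_star (P.Z (Tangle.trace n) fun _ => x), P.star_Z]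
  have : P.Z (Tangle.trace n).adj (fun _ => P.star x) = 0 := (P.trace_adj _).trans h'
  rw [this, star_zero]

/-- Every element is, up to the factor `δ`, an inserted cap which has been capped off, so a planar
subalgebra which contains everything of one colour contains everything of the colour below. -/
theorem carrier_of_succ {Q : P.Subalgebra} {n : ℕ} (h : Q.carrier (.nat (n + 1)) = ⊤) :
    Q.carrier (.nat n) = ⊤ := by
  refine Submodule.eq_top_iff'.mpr fun y => ?_
  have hδ : (P.δ : ℂ) ≠ 0 := by exact_mod_cast P.δ_pos.ne'
  have : (P.δ : ℂ) • y ∈ Q.carrier (.nat n) := by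
    rw [← P.capOff_cap 0 (Nat.zero_le _) y]
    exact Q.Z_mem _ _ fun _ => h ▸ Submodule.mem_top
  exact (Submodule.smul_mem_iff _ hδ).mp this

/-- A planar subalgebra containing a generator of the C*-algebra `P_n` and its adjoint contains
`P_n`. -/
theorem carrier_eq_top_of_generates {Q : P.Subalgebra} {n : ℕ} {x : P.V (.nat n)}
    (hx : P.GeneratesCStar x) (h : x ∈ Q.carrier _) (h' : P.star x ∈ Q.carrier _) :
    Q.carrier (.nat n) = ⊤ := by
  let W : Submodule ℂ (P.V (.nat n)) :=
    { carrier := {y | y ∈ Q.carrier _ ∧ P.star y ∈ Q.carrier _}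
      add_mem' := fun ha hb => ⟨add_mem ha.1 hb.1, by
        rw [star_add]
        exact add_mem ha.2 hb.2⟩
      zero_mem' := ⟨zero_mem _, by
        rw [star_zero]
        exact zero_mem _⟩
      smul_mem' := fun a y hy => ⟨Submodule.smul_mem _ _ hy.1, by
        rw [star_smul]
        exact Submodule.smul_mem _ _ hy.2⟩ }
  have hW : W = ⊤ := by
    refine hx W ⟨h, h'⟩ ⟨Q.one_mem _, ?_⟩ ?_ ?_
    · unfold PlanarAlgebra.one
      rw [P.star_Z]
      exact Q.Z_mem _ _ fun i => i.elim0
    · rintro y ⟨hy, hy'⟩ z ⟨hz, hz'⟩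
      refine ⟨Q.mul_mem hy hz, ?_⟩
      unfold PlanarAlgebra.mul
      rw [P.star_Z]
      refine Q.Z_mem _ _ fun i => ?_
      fin_cases i
      exacts [hy', hz']
    · rintro y ⟨hy, hy'⟩
      refine ⟨hy', ?_⟩
      rw [star_star]
      exact hy
  refine Submodule.eq_top_iff'.mpr fun y => ?_
  have : y ∈ W := hW ▸ Submodule.mem_top
  exact this.1

/-- Closing up either half of `x ⊔ x*` recovers `x` and `x*` up to non-zero scalars; these generate
`P_k`, and `P_k` generates all colours above and below it. -/
theorem generatedBy_juxtStar {k : ℕ} (hk : P.DepthAtMost k) {x : P.V (.nat k)}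
    (hx : P.GeneratesCStar x) (ht : P.tau x ≠ 0) : P.GeneratedBy (P.juxtStar x) := by
  obtain ⟨m, hmk, hd⟩ := hk
  intro Q hz
  have hkk : 0 < 2 * k := by omega
  have ht1 : P.Z (Tangle.trace k) (fun _ => x) ≠ 0 := fun h => ht (by simp [tau, h])
  have ht2 := P.trace_star_ne_zero ht1
  have half : ∀ i : Fin 2, P.Z (Tangle.trace k) (fun _ => (![x, P.star x] : Fin 2 → _) (i + 1)) ≠ 0 →
      (![x, P.star x] : Fin 2 → P.V (.nat k)) i ∈ Q.carrier _ := by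
    intro i hi
    obtain ⟨a, ha⟩ := P.exists_smul_one (c := .nat 0) rfl
      (P.Z (Tangle.trace k) (fun _ => (![x, P.star x] : Fin 2 → _) (i + 1)))
    have hmem : P.Z (Tangle.closeOne k i hkk) (fun _ => P.juxtStar x) ∈ Q.carrier _ :=
      Q.Z_mem _ _ fun _ => hz
    have e := P.closeOne_juxt hkk i ![x, P.star x]
    rw [ha, PlanarAlgebra.hang_smul, PlanarAlgebra.hang_one] at e
    unfold juxtStar at hmem
    rw [e] at hmem
    have ha0 : a ≠ 0 := by
      rintro rfl
      exact hi (ha.trans (zero_smul _ _))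
    exact (Submodule.smul_mem_iff _ ha0).mp hmem
  have hQk : Q.carrier (.nat k) = ⊤ := P.carrier_eq_top_of_generates hx (half 0 ht2) (half 1 ht1)
  have below : ∀ d n, n + d = k → Q.carrier (.nat n) = ⊤ := by
    intro d
    induction d with
    | zero => rintro n rfl; exact hQk
    | succ d ih => exact fun n hn => P.carrier_of_succ (ih (n + 1) (by omega))
  have above : ∀ d, Q.carrier (.nat (k + d)) = ⊤ := by
    intro d
    induction d with
    | zero => exact hQk
    | succ d ih =>
      exact Q.carrier_succ_eq_top (n := k + d) hd (by omega)
          (below (k - (m + 1)) (m + 1) (by omega)) ih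
  rintro (n | _)
  · rcases le_total n k with h | h
    · exact below (k - n) n (by omega)
    · obtain ⟨d, rfl⟩ := Nat.exists_eq_add_of_le h
      exact above d
  · refine Submodule.eq_top_iff'.mpr fun y => ?_
    obtain ⟨a, rfl⟩ := P.exists_smul_one (c := .zeroMinus) rfl y
    exact Submodule.smul_mem _ _ (Q.one_mem _)

end SubfactorPlanarAlgebra

/-! ### Single generators of finite-dimensional C*-algebras -/

section generation

/-- A pair of elements generates `A` as an algebra without unit. -/
def GeneratesPair {A : Type*} [Ring A] [Algebra ℂ A] (a b : A) : Prop :=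
  ∀ W : Submodule ℂ A, a ∈ W → b ∈ W → (∀ y ∈ W, ∀ z ∈ W, y * z ∈ W) → W = ⊤

/-- A subspace of functions on a finite set which is closed under multiplication and contains an
injective function without zeros consists of all functions. -/
theorem eq_top_of_injective_mem {X : Type*} [Fintype X] [DecidableEq X] {v : X → ℂ}
    (hv : Function.Injective v) (hv0 : ∀ p, v p ≠ 0) (W : Submodule ℂ (X → ℂ)) (hvW : v ∈ W)
    (hW : ∀ y ∈ W, ∀ z ∈ W, y * z ∈ W) : W = ⊤ := by
  -- polynomials without constant term in `v` separate the points
  have key : ∀ (s : Finset X), (fun q => v q * ∏ p ∈ s, (v q - v p)) ∈ W := by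
    intro s
    induction s using Finset.induction_on with
    | empty => simpa using hvW
    | insert p s hp ih =>
      have h : (fun q => v q * ∏ p ∈ insert p s, (v q - v p)) =
          v * (fun q => v q * ∏ p ∈ s, (v q - v p)) -
            v p • (fun q => v q * ∏ p ∈ s, (v q - v p)) := by
        funext q
        simp only [Finset.prod_insert hp, Pi.sub_apply, Pi.mul_apply, Pi.smul_apply, smul_eq_mul]
        ring
      rw [h]
      exact W.sub_mem (hW _ hvW _ ih) (W.smul_mem _ ih)
  have hsingle : ∀ p : X, Pi.single p (1 : ℂ) ∈ W := by
    intro p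
    have h := key (Finset.univ.erase p)
    have hne : v p * ∏ q ∈ Finset.univ.erase p, (v p - v q) ≠ 0 := by
      refine mul_ne_zero (hv0 p) (Finset.prod_ne_zero_iff.mpr fun q hq => ?_)
      exact sub_ne_zero.mpr fun e => (Finset.ne_of_mem_erase hq) (hv e).symm
    have e : (fun q => v q * ∏ q' ∈ Finset.univ.erase p, (v q - v q')) =
        (v p * ∏ q ∈ Finset.univ.erase p, (v p - v q)) • Pi.single p (1 : ℂ) := by
      funext q
      by_cases hq : q = p
      · subst hq
        simp
      · have : ∏ q' ∈ Finset.univ.erase p, (v q - v q') = 0 :=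
          Finset.prod_eq_zero (Finset.mem_erase.mpr ⟨hq, Finset.mem_univ q⟩) (sub_self _)
        simp [this, hq]
    rw [e] at h
    exact (W.smul_mem_iff hne).mp h
  refine Submodule.eq_top_iff'.mpr fun y => ?_
  have : y = ∑ p, y p • Pi.single p (1 : ℂ) := by
    funext q
    simp [Finset.sum_apply, Pi.single_apply]
  rw [this]
  exact W.sum_mem fun p _ => W.smul_mem _ (hsingle p)

variable {n : ℕ} {d : Fin n → ℕ}

/-- The block-diagonal matrix with given diagonal. -/
def blockDiag (u : ((i : Fin n) × Fin (d i)) → ℂ) :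
    (i : Fin n) → Matrix (Fin (d i)) (Fin (d i)) ℂ :=
  fun i => Matrix.diagonal fun j => u ⟨i, j⟩

/-- All entries in the blocks are `1`. -/
def blockOnes (n : ℕ) (d : Fin n → ℕ) : (i : Fin n) → Matrix (Fin (d i)) (Fin (d i)) ℂ :=
  fun _ => Matrix.of fun _ _ => 1

theorem blockDiag_mul_ones_mul (u w : ((i : Fin n) × Fin (d i)) → ℂ) (i : Fin n) (j l : Fin (d i)) :
    (blockDiag u * blockOnes n d * blockDiag w) i j l = u ⟨i, j⟩ * w ⟨i, l⟩ := by
  simp [blockDiag, blockOnes, Matrix.mul_diagonal, Matrix.diagonal_mul]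

/-- The diagonal matrix provides all diagonal matrices, and `e_{jj} J e_{ll} = e_{jl}` for the
matrix `J` whose entries are all `1`. -/
theorem generatesPair_block {v : ((i : Fin n) × Fin (d i)) → ℂ} (hv : Function.Injective v)
    (hv0 : ∀ p, v p ≠ 0) : GeneratesPair (blockDiag v) (blockOnes n d) := by
  intro W hD hJ hW
  let L : (((i : Fin n) × Fin (d i)) → ℂ) →ₗ[ℂ]
      ((i : Fin n) → Matrix (Fin (d i)) (Fin (d i)) ℂ) :=
    { toFun := blockDiag
      map_add' := fun u w => by
        funext i
        exact (Matrix.diagonal_add _ _).symm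
      map_smul' := fun a u => by
        funext i
        exact (Matrix.diagonal_smul a _) }
  have hL : W.comap L = ⊤ := by
    refine eq_top_of_injective_mem hv hv0 _ hD fun y hy z hz => ?_
    have : L (y * z) = L y * L z := by
      funext i
      exact (Matrix.diagonal_mul_diagonal _ _).symm
    show L (y * z) ∈ W
    rw [this]
    exact hW _ hy _ hz
  have hdiag : ∀ u, blockDiag u ∈ W := fun u => by
    have : u ∈ W.comap L := hL ▸ Submodule.mem_top
    exact this
  refine Submodule.eq_top_iff'.mpr fun M => ?_
  have : M = ∑ p : (i : Fin n) × Fin (d i), ∑ l : Fin (d p.1), M p.1 p.2 l •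
      (blockDiag (Pi.single p 1) * blockOnes n d * blockDiag (Pi.single ⟨p.1, l⟩ 1)) := by
    funext i
    ext j l
    simp only [Finset.sum_apply, Pi.smul_apply, Matrix.sum_apply, Matrix.smul_apply,
      blockDiag_mul_ones_mul, smul_eq_mul]
    rw [Finset.sum_eq_single ⟨i, j⟩, Finset.sum_eq_single l]
    · simp
    · intro l' _ hl
      have : (⟨i, l⟩ : (i : Fin n) × Fin (d i)) ≠ ⟨i, l'⟩ := fun h => hl (by simpa using h.symm)
      simp [this]
    · simp
    · intro p _ hp
      refine Finset.sum_eq_zero fun l' _ => ?_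
      simp [Pi.single_apply, hp.symm]
    · simp
  rw [this]
  exact W.sum_mem fun p _ => W.sum_mem fun l _ =>
    W.smul_mem _ (hW _ (hW _ (hdiag _) _ hJ) _ (hdiag _))

/-- A semisimple algebra is generated by two elements, the first of them outside the kernel of a
given functional. -/
theorem exists_generatesPair {A : Type*} [Ring A] [Algebra ℂ A] [FiniteDimensional ℂ A]
    [IsSemisimpleRing A] (f : A →ₗ[ℂ] ℂ) (hf : f 1 ≠ 0) :
    ∃ a b : A, GeneratesPair a b ∧ f a ≠ 0 := by
  obtain ⟨n, d, -, ⟨φ⟩⟩ := IsSemisimpleRing.exists_algEquiv_pi_matrix_of_isAlgClosed ℂ A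
  let v (s : ℕ) : ((i : Fin n) × Fin (d i)) → ℂ := fun p =>
    ((Fintype.equivFin ((i : Fin n) × Fin (d i)) p : ℕ) + 1 + s : ℕ)
  have hv : ∀ s, Function.Injective (v s) := fun s p q h => by
    have h' := Nat.cast_injective h
    exact (Fintype.equivFin _).injective (Fin.ext (by omega))
  have hv0 : ∀ s p, v s p ≠ 0 := fun s p => Nat.cast_ne_zero.mpr (by omega)
  have hgen : ∀ s, GeneratesPair (φ.symm (blockDiag (v s))) (φ.symm (blockOnes n d)) := by
    intro s W ha hb hW
    have h := generatesPair_block (hv s) (hv0 s) (W.comap φ.symm.toLinearMap) ha hb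
      fun y hy z hz => by
        show φ.symm (y * z) ∈ W
        rw [map_mul]
        exact hW _ hy _ hz
    refine Submodule.eq_top_iff'.mpr fun y => ?_
    have : φ y ∈ W.comap φ.symm.toLinearMap := h ▸ Submodule.mem_top
    simpa using this
  -- shifting the diagonal entries by one adds the unit, so `f` does not vanish at both choices
  have h1 : φ.symm (blockDiag (v 1)) = φ.symm (blockDiag (v 0)) + 1 := by
    rw [← map_one φ.symm, ← map_add]
    congr 1
    funext i
    ext j l
    by_cases h : j = l
    · subst h
      simp [blockDiag, v]
    · simp [blockDiag, h]
  by_cases h0 : f (φ.symm (blockDiag (v 0))) = 0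
  · refine ⟨_, _, hgen 1, ?_⟩
    rw [h1, map_add, h0, zero_add]
    exact hf
  · exact ⟨_, _, hgen 0, h0⟩

/-- The words in a generating pair span. -/
theorem GeneratesPair.span_words {A : Type*} [Ring A] [Algebra ℂ A] {a b : A}
    (h : GeneratesPair a b) :
    Submodule.span ℂ (Set.range (FreeSemigroup.lift (fun s : Bool => cond s a b))) = ⊤ := by
  refine h _ (Submodule.subset_span ⟨FreeSemigroup.of true, rfl⟩)
    (Submodule.subset_span ⟨FreeSemigroup.of false, rfl⟩) fun y hy z hz => ?_
  have := Submodule.mul_mem_mul hy hz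
  rw [Submodule.span_mul_span] at this
  refine Submodule.span_mono ?_ this
  rintro _ ⟨_, ⟨s, rfl⟩, _, ⟨t, rfl⟩, rfl⟩
  exact ⟨s * t, map_mul _ _ _⟩

theorem word_mem {A : Type*} [Ring A] [Algebra ℂ A] {a b : A} {W : Submodule ℂ A} (ha : a ∈ W)
    (hb : b ∈ W) (hW : ∀ y ∈ W, ∀ z ∈ W, y * z ∈ W) (s : FreeSemigroup Bool) :
    FreeSemigroup.lift (fun s : Bool => cond s a b) s ∈ W := by
  induction s using FreeSemigroup.recOnMul with
  | ih1 x => cases x; exacts [hb, ha]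
  | ih2 x y hx hy =>
    rw [map_mul]
    exact hW _ hx _ hy

end generation

section cstar

variable {A : Type u} [CStarAlgebra A]

/-- A finite-dimensional C*-algebra is semisimple: if `x` is in the radical, then `x* x` is
nilpotent and self-adjoint, hence zero. -/
theorem isSemisimpleRing_of_cstar [FiniteDimensional ℂ A] : IsSemisimpleRing A := by
  have : IsArtinianRing A := IsArtinianRing.of_finite ℂ A
  rw [IsArtinianRing.isSemisimpleRing_iff_jacobson, eq_bot_iff]
  intro x hx
  obtain ⟨m, hm⟩ := IsSemiprimaryRing.isNilpotent (R := A)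
  have hy : star x * x ∈ Ring.jacobson A := Ideal.mul_mem_left _ _ hx
  have hpow : (star x * x) ^ 2 ^ m = 0 := by
    have h1 : (star x * x) ^ m ∈ Ring.jacobson A ^ m := Ideal.pow_mem_pow hy m
    rw [hm] at h1
    have h2 : (star x * x) ^ m = 0 := h1
    exact pow_eq_zero_of_le Nat.lt_two_pow_self.le h2
  have hsa : IsSelfAdjoint (star x * x) := IsSelfAdjoint.star_mul_self x
  have h := hsa.nnnorm_pow_two_pow m
  rw [hpow, nnnorm_zero] at h
  have h0 : star x * x = 0 := nnnorm_eq_zero.mp (pow_eq_zero_iff (by positivity) |>.mp h.symm)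
  exact (CStarRing.star_mul_self_eq_zero_iff x).mp h0

/-- The line through the real and imaginary parts of `c`: self-adjoint at real parameters, and `c`
at the parameter `i`. -/
noncomputable def realLine (c : A) (t : ℂ) : A := (realPart c : A) + t • (imaginaryPart c : A)

theorem realLine_I (c : A) : realLine c Complex.I = c := realPart_add_I_smul_imaginaryPart c

theorem star_realLine (c : A) (t : ℝ) : star (realLine c t) = realLine c t := by
  simp [realLine, star_smul]

theorem differentiable_realLine (c : A) : Differentiable ℂ (realLine c) := by
  unfold realLine
  fun_prop

/-- A finite-dimensional C*-algebra has a single generator, which may be chosen outside the kernel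
of a given functional which does not vanish at the unit.  A generating pair is joined by a complex
line to pairs `(a, a*)`: the pairs on the line which do not generate are the zeros of an entire
function, and the parameters of the pairs `(a, a*)` contain all real numbers. -/
theorem exists_cstar_generator [FiniteDimensional ℂ A] (f : A →ₗ[ℂ] ℂ) (hf : f 1 ≠ 0) :
    ∃ a : A, GeneratesPair a (star a) ∧ f a ≠ 0 := by
  have := isSemisimpleRing_of_cstar (A := A)
  obtain ⟨a₀, b₀, hgen, hf₀⟩ := exists_generatesPair f hf
  -- `a₀ = c + i e` and `b₀ = c - i e`; replacing `c`, `e` by self-adjoint elements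
  -- gives a pair `(a, a*)`
  let c : A := (2⁻¹ : ℂ) • (a₀ + b₀)
  let e : A := (2⁻¹ * Complex.I⁻¹ : ℂ) • (a₀ - b₀)
  let a : ℂ → A := fun t => realLine c t + Complex.I • realLine e t
  let b : ℂ → A := fun t => realLine c t - Complex.I • realLine e t
  have he : Differentiable ℂ fun t => Complex.I • realLine e t :=
    (differentiable_realLine e).const_smul Complex.I
  have ha : Differentiable ℂ a := (differentiable_realLine c).add he
  have hb : Differentiable ℂ b := (differentiable_realLine c).sub he
  have hI : Complex.I • e = (2⁻¹ : ℂ) • (a₀ - b₀) := by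
    rw [smul_smul]
    congr 1
    field_simp
  have haI : a Complex.I = a₀ := by
    simp only [a, realLine_I, hI, c]
    module
  have hbI : b Complex.I = b₀ := by
    simp only [b, realLine_I, hI, c]
    module
  have hstar : ∀ t : ℝ, star (a t) = b t := fun t => by
    simp only [a, b, star_add, star_smul, star_realLine]
    simp [sub_eq_add_neg]
  let word : ℂ → FreeSemigroup Bool → A := fun t =>
    FreeSemigroup.lift (fun s : Bool => cond s (a t) (b t))
  have hword : ∀ s, Differentiable ℂ fun t => word t s := by
    intro s
    induction s using FreeSemigroup.recOnMul with
    | ih1 x =>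
      cases x
      · exact hb
      · exact ha
    | ih2 x y hx hy =>
      have : (fun t => word t (FreeSemigroup.of x * y)) =
          fun t => word t (FreeSemigroup.of x) * word t y := funext fun t => map_mul _ _ _
      rw [this]
      exact hx.mul hy
  have hspan : Submodule.span ℂ (Set.range (word Complex.I)) = ⊤ := by
    have := hgen.span_words
    simpa only [word, haI, hbI] using this
  obtain ⟨κ, w, -, hw, hli⟩ := exists_linearIndependent' ℂ (word Complex.I)
  let B := Module.Basis.mk hli (by rw [hw, hspan])
  have : Finite κ := Module.Finite.finite_basis B
  have := Fintype.ofFinite κ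
  classical
  -- where `h` does not vanish the same words still form a basis
  let h : ℂ → ℂ := fun t => B.det (fun k => word t (w k)) * f (a t)
  have hlin : ∀ (g : A →ₗ[ℂ] ℂ) {u : ℂ → A}, Differentiable ℂ u →
      Differentiable ℂ fun t => g (u t) := fun g u hu =>
    (LinearMap.toContinuousLinearMap g).differentiable.comp hu
  have hh : Differentiable ℂ h := by
    refine Differentiable.mul ?_ (hlin f ha)
    simp only [Module.Basis.det_apply, Matrix.det_apply]
    refine Differentiable.fun_sum fun σ _ => Differentiable.const_smul ?_ _
    refine Differentiable.fun_finsetProd fun k _ => ?_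
    exact hlin (B.coord (σ k)) (hword (w k))
  have hhI : h Complex.I ≠ 0 := by
    have e : (fun k => word Complex.I (w k)) = B := by
      funext k
      exact (Module.Basis.mk_apply hli _ k).symm
    simp only [h, e, Module.Basis.det_self, one_mul, haI]
    exact hf₀
  -- an entire function which does not vanish identically has a real non-zero
  obtain ⟨t, ht⟩ : ∃ t : ℝ, h t ≠ 0 := by
    by_contra! hzero
    have hfreq : ∃ᶠ z in nhdsWithin (0 : ℂ) {0}ᶜ, h z = (fun _ => 0 : ℂ → ℂ) z := by
      have hlim : Filter.Tendsto (fun t : ℝ => (t : ℂ)) (nhdsWithin (0 : ℝ) {0}ᶜ)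
          (nhdsWithin (0 : ℂ) {0}ᶜ) := by
        refine tendsto_nhdsWithin_iff.mpr ⟨?_, ?_⟩
        · exact (Complex.continuous_ofReal.tendsto' 0 0 rfl).mono_left nhdsWithin_le_nhds
        · filter_upwards [self_mem_nhdsWithin] with t ht
          simpa using ht
      exact hlim.frequently (Filter.Frequently.of_forall hzero)
    have hEq := AnalyticOnNhd.eq_of_frequently_eq (f := h) (g := fun _ => 0)
      (fun z _ => hh.analyticAt z) (fun z _ => analyticAt_const) hfreq
    exact hhI (congrFun hEq _)
  refine ⟨a t, ?_, right_ne_zero_of_mul ht⟩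
  have hdet : IsUnit (B.det fun k => word t (w k)) :=
      isUnit_iff_ne_zero.mpr (left_ne_zero_of_mul ht)
  have htop := (B.is_basis_iff_det.mpr hdet).2
  intro W h1 h2 h3
  rw [eq_top_iff, ← htop, Submodule.span_le]
  rintro _ ⟨k, rfl⟩
  rw [hstar] at h2
  exact word_mem h1 h2 h3 (w k)

end cstar

/-! ### The box space `P_k`, and the conclusion -/

namespace SubfactorPlanarAlgebra

variable (P : SubfactorPlanarAlgebra.{u})

/-- Inserting a cap is injective, since capping it off multiplies by `δ`. -/
theorem nontrivial_nat (n : ℕ) : Nontrivial (P.V (.nat n)) := by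
  induction n with
  | zero => exact ⟨_, _, P.one_ne_zero (c := .nat 0) rfl⟩
  | succ n ih =>
    obtain ⟨x, hx⟩ := exists_ne (0 : P.V (.nat n))
    refine ⟨P.cap 0 (Nat.zero_le _) x, 0, fun h => hx ?_⟩
    have hδ : (P.δ : ℂ) ≠ 0 := by exact_mod_cast P.δ_pos.ne'
    have e := P.capOff_cap 0 (Nat.zero_le _) x
    have h0 : P.capOff 0 (Nat.zero_le _) (0 : P.V (.nat (n + 1))) = 0 :=
      (P.Z (Tangle.capOff n 0 (Nat.zero_le _))).map_coord_zero 0 rfl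
    rw [h, h0] at e
    exact (smul_eq_zero_iff_right hδ).mp e.symm

/-- The coefficient of the trace with respect to the unit of `P_0`. -/
theorem exists_trace_functional (n : ℕ) :
    ∃ f : P.V (.nat n) →ₗ[ℂ] ℂ, ∀ x, f x ≠ 0 ↔ P.tau x ≠ 0 := by
  let B := Module.basisUnique Unit (P.connected (.nat 0) rfl)
  let T : P.V (.nat n) →ₗ[ℂ] P.V (.nat 0) :=
    { toFun := fun x => P.tau x
      map_add' := fun x y => by
        have h := (P.Z (Tangle.trace n)).map_update_add (fun _ => x) 0 x y
        have e : ∀ w, Function.update (fun _ : Fin 1 => x) 0 w = fun _ => w := fun w => by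
          funext i
          rw [Subsingleton.elim i 0, Function.update_self]
        rw [e, e, e] at h
        simp only [tau, h, smul_add]
      map_smul' := fun a x => by
        have h := (P.Z (Tangle.trace n)).map_update_smul (fun _ => x) 0 a x
        have e : ∀ w, Function.update (fun _ : Fin 1 => x) 0 w = fun _ => w := fun w => by
          funext i
          rw [Subsingleton.elim i 0, Function.update_self]
        rw [e, e] at h
        simp only [tau, h, RingHom.id_apply]
        rw [smul_comm] }
  refine ⟨(B.coord ()).comp T, fun x => not_congr ⟨fun h => ?_, fun h => ?_⟩⟩
  · refine B.repr.map_eq_zero_iff.mp (Finsupp.ext fun i => ?_)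
    exact h
  · have h' : T x = 0 := h
    simp [h']

/-- A generator of the C*-algebra `P_k` of non-zero trace. -/
theorem exists_generatesCStar (k : ℕ) :
    ∃ x : P.V (.nat k), P.GeneratesCStar x ∧ P.tau x ≠ 0 := by
  obtain ⟨A, hA, φ, hmul, hstar⟩ := P.cstar (.nat k)
  have := P.finiteDimensional (.nat k)
  have : FiniteDimensional ℂ A := Module.Finite.equiv φ
  have := P.nontrivial_nat k
  have : Nontrivial A := φ.injective.nontrivial
  obtain ⟨f, hf⟩ := P.exists_trace_functional k
  -- positivity of the trace at the unit of the C*-algebra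
  have h1 : (f.comp φ.symm.toLinearMap) 1 ≠ 0 := by
    obtain ⟨a, ha, hτ⟩ := P.trace_pos k (φ.symm 1) fun h =>
      _root_.one_ne_zero (φ.symm.map_eq_zero_iff.mp h)
    have e : P.mul (P.star (φ.symm 1)) (φ.symm 1) = φ.symm 1 := by
      apply φ.injective
      rw [hmul, hstar, φ.apply_symm_apply, _root_.star_one, mul_one]
    rw [e] at hτ
    exact (hf _).mpr fun h0 => smul_ne_zero (Complex.ofReal_ne_zero.mpr ha.ne')
      (P.one_ne_zero (c := .nat 0) rfl) (hτ.symm.trans h0)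
  obtain ⟨a, hgen, ha⟩ := exists_cstar_generator _ h1
  refine ⟨φ.symm a, fun W hW _ hWmul hWstar => ?_, (hf _).mp ha⟩
  have hW' : W.comap φ.symm.toLinearMap = ⊤ := by
    refine hgen _ hW ?_ fun y hy z hz => ?_
    · have e : φ.symm (Star.star a) = P.star (φ.symm a) := by
        apply φ.injective
        rw [hstar, φ.apply_symm_apply, φ.apply_symm_apply]
      show φ.symm (Star.star a) ∈ W
      rw [e]
      exact hWstar _ hW
    · have e : φ.symm (y * z) = P.mul (φ.symm y) (φ.symm z) := by
        apply φ.injective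
        rw [hmul, φ.apply_symm_apply, φ.apply_symm_apply, φ.apply_symm_apply]
      show φ.symm (y * z) ∈ W
      rw [e]
      exact hWmul _ hy _ hz
  refine Submodule.eq_top_iff'.mpr fun y => ?_
  have : φ y ∈ W.comap φ.symm.toLinearMap := hW' ▸ Submodule.mem_top
  simpa using this

end SubfactorPlanarAlgebra
end Planar

theorem proposition5p1 (P : Planar.SubfactorPlanarAlgebra.{u}) (k : ℕ) (hk : P.DepthAtMost k) :
    (∃ z : P.V (.nat (2 * k)), P.GeneratedBy z) ∧
    (∃ x : P.V (.nat k), P.GeneratesCStar x ∧ P.tau x ≠ 0) ∧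
    ∀ x : P.V (.nat k), P.GeneratesCStar x → P.tau x ≠ 0 → P.GeneratedBy (P.juxtStar x) := by
  obtain ⟨x, hx, ht⟩ := P.exists_generatesCStar k
  exact ⟨⟨_, P.generatedBy_juxtStar hk hx ht⟩, ⟨x, hx, ht⟩, fun _ => P.generatedBy_juxtStar hk⟩
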